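/- **Setting.** Let $d\ge 1$. A $d$-evolution scattering system $\mathfrak S=(\mathcal K;\mathcal U_1,\dots,\mathcal U_d;\mathcal F,\mathcal F_*)$ consists of a complex Hilbert space $\mathcal K$, commuting unitary operators $\mathcal U_k$ and closed subspaces $\mathcal F,\mathcal F_*$ with $\mathcal U^n\mathcal F\perp\mathcal F$ and $\mathcal U^n\mathcal F_*\perp\mathcal F_*$ for $0\ne n\in\mathbb Z^d$, and $\mathcal U^n\mathcal F\perp\mathcal U^m\mathcal F_*$ for $n\in\mathbb Z^d_+$, $m\notin\mathbb Z^d_+$. Let $\mathcal K_{\text{scat-min}}$ be the closed span of all $\mathcal U^n\mathcal F$, $\mathcal U^n\mathcal F_*$; $\mathfrak S$ is scattering-minimal if $\mathcal K_{\text{scat-min}}=\mathcal K$. Put $\mathcal N=(\mathcal K_{\text{scat-min}})^\perp$. A set $\Omega\subset\mathbb Z^d$ is shift-invariant if $\Omega+e_k\subset\Omega$ for all $k$. Let $\partial_k\Omega_{\rm fin}$ be the set of $n\in\mathbb{Z}^d$ such that $n_k$ is the least integer $m$ with $(n_1,\dots,n_{k-1},m,n_{k+1},\dots,n_d)\in\Omega$,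 and let $\partial_k\Omega_{+\infty}$, resp. $\partial_k\Omega_{-\infty}$, be the set of lines $n+\mathbb Ze_k$ disjoint from, resp. contained in, $\Omega$, each represented by its point with $n_k=0$. Put $\mathcal V^\Omega=\mathcal K\ominus\big[\bigoplus_{n\in\Omega}\mathcal U^n\mathcal F\oplus\bigoplus_{n\notin\Omega}\mathcal U^n\mathcal F_*\big]$. Given subspaces $\mathcal L_k,\mathcal M_k,\mathcal M_{*k}$, the *summands* of $\Omega$ are $$\chi=\mathcal U^n\mathcal L_k\ (n\in\partial_k\Omega_{\rm fin}),\qquad \chi=\mathcal U^{n}\mathcal M_k\ (n+\mathbb Ze_k\in\partial_k\Omega_{+\infty},\ n_k=0),\qquad \chi=\mathcal U^{n}\mathcal M_{*k}\ (n+\mathbb Ze_k\in\partial_k\Omega_{-\infty},\ n_k=0),$$ $1\le k\le d$, and $(OD)_\Omega$ means that $\mathcal V^\Omega$ is the orthogonal direct sum of the summands of $\Omega$. A GR-unitary colligation is a unitary operator $U=\begin{bmatrix}A&B\\C&D\end{bmatrix}:\mathcal H\oplus\mathcal E\to\mathcal H\oplus\mathcal E_*$ between Hilbert spaces together with orthogonal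 projections $P_1,\dots,P_d$ on $\mathcal H$ with $P_jP_k=0$ $(j\neq k)$, $\sum_kP_k=I$. Put $Z(z)=\sum_kz_kP_k$ and $S(z)=D+C(I-Z(z)A)^{-1}Z(z)B=\sum_nS_nz^n$ (formal power series). $U$ is closely connected if $\mathcal H_{cc}=\mathcal H$, where $\mathcal H_{cc}$ is the smallest closed subspace containing $\operatorname{im}B$ and $\operatorname{im}C^*$ and invariant under $A,A^*,P_1,\dots,P_d$. An embedding of $U$ in $\mathfrak S$ consists of isometries $i_{\mathcal H}:\mathcal H\to\mathcal K$, $i_{\mathcal E}:\mathcal E\to\mathcal K$ with range $\mathcal F$, $i_{\mathcal E_*}:\mathcal E_*\to\mathcal K$ with range $\mathcal F_*$, and closed subspaces $\mathcal M_k,\mathcal M_{*k}$ with $\mathcal U_k\mathcal M_k=\mathcal M_k$, $\mathcal U_k\mathcal M_{*k}=\mathcal M_{*k}$ such that, with $\mathcal L_k=i_{\mathcal H}P_k\mathcal H$: $(\bigoplus_k\mathcal L_k)\oplus\mathcal F=\mathcal F_*\oplus(\bigoplus_k\mathcal U_k\mathcal L_k)$ (orthogonal sums); $P_{\mathcal U_k^m\mathcal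 L_k}\to P_{\mathcal M_k}$ strongly as $m\to+\infty$ and $P_{\mathcal U_k^m\mathcal L_k}\to P_{\mathcal M_{*k}}$ strongly as $m\to-\infty$; $P_kA=P_ki_{\mathcal H}^*\mathcal U_k^*i_{\mathcal H}$, $P_kB=P_ki_{\mathcal H}^*\mathcal U_k^*i_{\mathcal E}$, $C=i_{\mathcal E_*}^*i_{\mathcal H}$, $D=i_{\mathcal E_*}^*i_{\mathcal E}$; and $(OD)_{\Omega^B}$ holds for $\Omega^B=\{n:\sum_in_i\ge0\}$. The dBR map is $\Pi\xi=\sum_{n\in\mathbb Z^d}\begin{bmatrix}i_{\mathcal E_*}^*\mathcal U^{-n}\xi\\ i_{\mathcal E}^*\mathcal U^{-n}\xi\end{bmatrix}z^n$ (a formal series). For a positive formal kernel $\kappa(z,w)=\sum\kappa_{n,m}z^nw^{-m}$ on $\mathcal E_*\oplus\mathcal E$ let $\mathcal H(\kappa)$ be its reproducing kernel Hilbert space of formal series. Let $K_k(z,w)=H_k(z)H_k(w)^*$ with $$H_k(z)=\begin{bmatrix}C(I-Z(z)A)^{-1}\\ z_k^{-1}B^*(I-Z(z)^{-1}A^*)^{-1}\end{bmatrix}P_k$$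 (the augmented Agler decomposition; $H_k(z)$ is expanded in powers of $Z(z)A$ and $Z(z)^{-1}A^*$, $w^*=w^{-1}$), let $K^{22}_{+\infty,k}$ be the limit as $t\to+\infty$ of the $\mathcal E$-diagonal block of $z_k^tK_kw_k^{-t}$ and $K^{11}_{-\infty,k}$ the limit as $t\to-\infty$ of its $\mathcal E_*$-diagonal block (strong limits of coefficients). Put $$K_\chi=z^nK_kw^{-n},\qquad K_\chi=z^n\begin{bmatrix}0&0\\0&K^{22}_{+\infty,k}\end{bmatrix}w^{-n},\qquad K_\chi=z^n\begin{bmatrix}K^{11}_{-\infty,k}&0\\0&0\end{bmatrix}w^{-n}$$ for the three types of summands respectively. Let $K_{\mathcal V^{S,\Omega}_{dBR}}$ be the kernel with coefficients (with $\chi_\Omega$ the indicator function, $\delta$ the Kronecker symbol, $S_n=0$ for $n\notin\mathbb{Z}^d_+$, and weakly convergent sums) $$\begin{bmatrix}\chi_\Omega(n)\delta_{n,m}I-\sum_{l\in\Omega}S_{n-l}S_{m-l}^*&(\chi_\Omega(n)-\chi_\Omega(m))S_{n-m}\\(\chi_\Omega(m)-\chi_\Omega(n))S_{m-n}^*&(1-\chi_\Omega(n))\delta_{n,m}I-\sum_{l\notin\Omega}S_{l-n}^*S_{l-m}\end{bmatrix}.$$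 The overlapping space of a family $(\kappa_i)$ of positive kernels is $\{(f_i)\in\bigoplus_i\mathcal H(\kappa_i):\sum_if_i=0\}$ (Hilbert direct sum; $\sum_i f_i$ is a weakly convergent sum of coefficients). Let $\boldsymbol{\mathcal L}_{\mathcal V^\Omega}$ be the overlapping space of the family $(K_\chi)$, $\chi$ running through the summands of $\Omega$. The decomposition $\{K_k\}$ is minimal with respect to $\Omega$ if the overlapping spaces of $(K_k)_k$ and of $(z_kK_kw_k^{-1})_k$ and $\boldsymbol{\mathcal L}_{\mathcal V^\Omega}$ are all trivial. Finally $\mathcal V^\Omega_{cc}$ is the closed span of the summands of $\Omega$ formed with $\mathcal L_{cc,k}=i_{\mathcal H}P_k\mathcal H_{cc}$ and with the ranges $\mathcal M_{cc,k}$, $\mathcal M_{*cc,k}$ of the strong limits of $P_{\mathcal U_k^m\mathcal L_{cc,k}}$ as $m\to+\infty$, $m\to-\infty$ in place of $\mathcal L_k,\mathcal M_k,\mathcal M_{*k}$. **Proposition.** Let $U$ be a GR-unitary colligation embedded in the $d$-evolution scattering system $\mathfrak S$. Then all the limits and sums defining the kernels above converge, for every shift-invariant $\Omega$, and: 1. For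 every shift-invariant $\Omega$, $\Pi$ restricts to unitary maps $\mathcal V^\Omega\cap\mathcal K_{\text{scat-min}}\to\mathcal H(K_{\mathcal V^{S,\Omega}_{dBR}})$ and $\chi\ominus(\chi\cap\mathcal N)\to\mathcal H(K_\chi)$, for every summand $\chi$ of $\Omega$. 2. For every shift-invariant $\Omega$ with $(OD)_\Omega$ the following are equivalent: (a) $\boldsymbol{\mathcal L}_{\mathcal V^\Omega}=\{0\}$; (b) $\mathcal V^\Omega\cap\mathcal N=\mathcal N$ and $\mathcal N$ is invariant under $P_\chi$ for every summand $\chi$ of $\Omega$; (c) $\mathcal V^\Omega\cap\mathcal K_{\text{scat-min}}$ is invariant under $P_\chi$ for every summand $\chi$ of $\Omega$. 3. If $\Omega$ is shift-invariant with $(OD)_\Omega$, $\partial_k\Omega_{\rm fin}\ne\emptyset$ for each $k$ and $\boldsymbol{\mathcal L}_{\mathcal V^\Omega}=\{0\}$, then $\mathcal N$ is invariant under $P_{\mathcal L_k}$ for each $k$. Conversely, if $\mathcal N$ is invariant under $P_{\mathcal L_k}$ for each $k$, then $\boldsymbol{\mathcal L}_{\mathcal V^\Omega}=\{0\}$ for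 every shift-invariant $\Omega$. 4. If $\Omega$ is shift-invariant with $(OD)_\Omega$ and $\partial_k\Omega_{\rm fin}\neq\emptyset$ for each $k$, then $\{K_k\}$ is minimal with respect to $\Omega$ if and only if $\mathcal N$ is invariant under $P_{\mathcal L_k}$ for each $k$. In this case $\{K_k\}$ is minimal with respect to every shift-invariant $\Omega'$; the strong limits of $P_{\mathcal U_k^m\mathcal L_{cc,k}}$ as $m\to\pm\infty$ exist and are the orthogonal projections onto $\mathcal M_{cc,k}$ and $\mathcal M_{*cc,k}$; $\mathcal V^{\Omega'}\ominus\mathcal V^{\Omega'}_{cc}=\mathcal N$ for every shift-invariant $\Omega'$ with $(OD)_{\Omega'}$; and $U$ is closely connected if and only if $\mathfrak S$ is scattering-minimal. -/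

import Mathlib

open Filter Topology
open scoped InnerProduct

namespace Multievolution

noncomputable section

/-! ### The lattice and its shift-invariant subsets -/

/-- The lattice `ℤ^d`. -/
abbrev Lattice (d : ℕ) : Type := Fin d → ℤ

/-- The standard basis vector `e_k` of `ℤ^d`. -/
def stdVec {d : ℕ} (k : Fin d) : Lattice d := Pi.single k 1

/-- A subset `Ω` of `ℤ^d` with `Ω + e_k ⊆ Ω` for every `k`
(a shift-invariant sublattice; it need not be a subgroup). -/
def ShiftInvariant {d : ℕ} (Ω : Set (Lattice d)) : Prop :=
  ∀ n ∈ Ω, ∀ k : Fin d, n + stdVec k ∈ Ω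

/-- The balanced shift-invariant sublattice `{n : n_1 + ⋯ + n_d ≥ 0}`. -/
def balanced (d : ℕ) : Set (Lattice d) := {n | 0 ≤ ∑ k, n k}

/-- The finite part of the `k`-th boundary of `Ω`: the points `n` whose `k`-th coordinate is the
least integer `m` such that `(n_1, …, n_{k-1}, m, n_{k+1}, …, n_d) ∈ Ω`. -/
def finBoundary {d : ℕ} (Ω : Set (Lattice d)) (k : Fin d) : Set (Lattice d) :=
  {n | IsLeast {m : ℤ | Function.update n k m ∈ Ω} (n k)}

/-- The part of the `k`-th boundary of `Ω` at `+∞`: the lines `n + ℤ e_k` disjoint from `Ω`. Each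
line in direction `e_k` is recorded through its unique point `n` with `n_k = 0`. -/
def posInfBoundary {d : ℕ} (Ω : Set (Lattice d)) (k : Fin d) : Set (Lattice d) :=
  {n | n k = 0 ∧ ∀ m : ℤ, Function.update n k m ∉ Ω}

/-- The part of the `k`-th boundary of `Ω` at `-∞`: the lines `n + ℤ e_k` contained in `Ω`. Each
line in direction `e_k` is recorded through its unique point `n` with `n_k = 0`. -/
def negInfBoundary {d : ℕ} (Ω : Set (Lattice d)) (k : Fin d) : Set (Lattice d) :=
  {n | n k = 0 ∧ ∀ m : ℤ, Function.update n k m ∈ Ω}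

/-- The index set of the direct summands attached to `Ω`: all boundary components of `Ω`. -/
inductive BoundaryIndex {d : ℕ} (Ω : Set (Lattice d)) : Type
  | fin (k : Fin d) (n : Lattice d) (h : n ∈ finBoundary Ω k) : BoundaryIndex Ω
  | posInf (k : Fin d) (n : Lattice d) (h : n ∈ posInfBoundary Ω k) : BoundaryIndex Ω
  | negInf (k : Fin d) (n : Lattice d) (h : n ∈ negInfBoundary Ω k) : BoundaryIndex Ω

section HilbertSpace

variable {K : Type*} [NormedAddCommGroup K] [InnerProductSpace ℂ K] [CompleteSpace K]

/-- The orthogonal projection `P_X` of `K` onto (the closure of) the subspace `X`. -/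
def proj (X : Submodule ℂ K) : K →L[ℂ] K := X.topologicalClosure.starProjection

/-- The image of the subspace `X` under the unitary `T`. -/
def image (T : K ≃ₗᵢ[ℂ] K) (X : Submodule ℂ K) : Submodule ℂ K :=
  X.map T.toLinearEquiv.toLinearMap

/-- `X` is invariant under the operator `T`. -/
def InvariantUnder (X : Submodule ℂ K) (T : K →L[ℂ] K) : Prop := ∀ ξ ∈ X, T ξ ∈ X

end HilbertSpace

/-! ### Multievolution scattering systems -/

/-- The operator `U^n = U_1^{n_1} ⋯ U_d^{n_d}`. -/
def evolPow {K : Type*} [NormedAddCommGroup K] [InnerProductSpace ℂ K] {d : ℕ}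
    (evol : Fin d → (K ≃ₗᵢ[ℂ] K)) (n : Lattice d) : K ≃ₗᵢ[ℂ] K :=
  (List.ofFn fun k => evol k ^ n k).prod

/-- A `d`-evolution unitary scattering system `(K; U_1, …, U_d; F, F_*)`: commuting unitary
operators together with closed wandering subspaces `F`, `F_*` such that `U^n F ⟂ U^m F_*`
whenever `n ∈ ℤ^d_+` and `m ∉ ℤ^d_+`. -/
structure ScatteringSystem (d : ℕ) (K : Type*) [NormedAddCommGroup K] [InnerProductSpace ℂ K]
    [CompleteSpace K] where
  evol : Fin d → (K ≃ₗᵢ[ℂ] K)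
  F : Submodule ℂ K
  Fs : Submodule ℂ K
  evol_comm : ∀ j k, Commute (evol j) (evol k)
  isClosed_F : IsClosed (F : Set K)
  isClosed_Fs : IsClosed (Fs : Set K)
  wandering_F : ∀ n : Lattice d, n ≠ 0 → image (evolPow evol n) F ⟂ F
  wandering_Fs : ∀ n : Lattice d, n ≠ 0 → image (evolPow evol n) Fs ⟂ Fs
  orthogonal : ∀ n m : Lattice d, 0 ≤ n → ¬ 0 ≤ m →
    image (evolPow evol n) F ⟂ image (evolPow evol m) Fs

namespace ScatteringSystem

variable {d : ℕ} {K : Type*} [NormedAddCommGroup K] [InnerProductSpace ℂ K] [CompleteSpace K]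
  (𝔖 : ScatteringSystem d K)

/-- The translate `U^n X`. -/
def translate (n : Lattice d) (X : Submodule ℂ K) : Submodule ℂ K :=
  image (evolPow 𝔖.evol n) X

/-- The outgoing space `⊕_{n ∈ Ω} U^n F`. -/
def W (Ω : Set (Lattice d)) : Submodule ℂ K :=
  (⨆ n ∈ Ω, 𝔖.translate n 𝔖.F).topologicalClosure

/-- The incoming space `⊕_{n ∉ Ω} U^n F_*`. -/
def Ws (Ω : Set (Lattice d)) : Submodule ℂ K :=
  (⨆ n ∈ Ωᶜ, 𝔖.translate n 𝔖.Fs).topologicalClosure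

/-- The scattering subspace `V^Ω = K ⊖ [(⊕_{n ∈ Ω} U^n F) ⊕ (⊕_{n ∉ Ω} U^n F_*)]`. -/
def V (Ω : Set (Lattice d)) : Submodule ℂ K := (𝔖.W Ω ⊔ 𝔖.Ws Ω)ᗮ

/-- The scattering-minimal part of `K`: the closed span of all `U^n F` and all `U^n F_*`. -/
def scatMin : Submodule ℂ K := (𝔖.W Set.univ ⊔ 𝔖.Ws ∅).topologicalClosure

/-- The system is scattering-minimal. -/
def IsScatteringMinimal : Prop := 𝔖.scatMin = ⊤

/-- The subspace attached to a boundary component of `Ω` by subspaces `L_k`, `M_k`, `M_{*k}`: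
`U^n L_k` for `n` in the finite part of the `k`-th boundary, `(Û^k)^n M_k` for the lines at `+∞`
and `(Û^k)^n M_{*k}` for the lines at `-∞`, where `Û^k` omits `U_k` (recall `n_k = 0`). -/
def summand (L M Ms : Fin d → Submodule ℂ K) {Ω : Set (Lattice d)} :
    BoundaryIndex Ω → Submodule ℂ K
  | .fin k n _ => 𝔖.translate n (L k)
  | .posInf k n _ => 𝔖.translate n (M k)
  | .negInf k n _ => 𝔖.translate n (Ms k)

/-- The orthogonal decomposition of `V^Ω` as the Hilbert-space direct sum of the subspaces
attached to the boundary components of `Ω`. -/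
def OrthDecomp (L M Ms : Fin d → Submodule ℂ K) (Ω : Set (Lattice d)) : Prop :=
  (∀ i j : BoundaryIndex Ω, i ≠ j → 𝔖.summand L M Ms i ⟂ 𝔖.summand L M Ms j) ∧
    𝔖.V Ω = (⨆ i : BoundaryIndex Ω, 𝔖.summand L M Ms i).topologicalClosure

/-- For a subspace `X` and a filter `l` (`atTop` or `atBot`): the subspace of all `ξ` with
`P_{U_k^m X} ξ → ξ` as `m` runs along `l`. If the strong limit of the projections `P_{U_k^m X}`
exists and is a projection, this is the range of the strong limit. -/
def limitSubspace (l : Filter ℤ) (k : Fin d) (X : Submodule ℂ K) : Submodule ℂ K where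
  carrier := {ξ | Tendsto (fun m : ℤ => proj (image (𝔖.evol k ^ m) X) ξ) l (𝓝 ξ)}
  add_mem' := by
    intro a b ha hb
    simpa using Filter.Tendsto.add (f := fun m : ℤ => proj (image (𝔖.evol k ^ m) X) a) ha hb
  zero_mem' := by simpa using tendsto_const_nhds
  smul_mem' := by
    intro c a ha
    simpa using Filter.Tendsto.const_smul
      (f := fun m : ℤ => proj (image (𝔖.evol k ^ m) X) a) ha c

end ScatteringSystem

/-! ### Givone-Roesser unitary colligations -/

/-- A Givone-Roesser unitary colligation in coordinate-free form: a unitary operator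
`[A B; C D] : H ⊕ E → H ⊕ E_*` together with orthogonal projections `P_1, …, P_d` on `H` having
pairwise orthogonal ranges `H_k = P_k H` and sum the identity. -/
structure Colligation (d : ℕ) (H E Es : Type*)
    [NormedAddCommGroup H] [InnerProductSpace ℂ H] [CompleteSpace H]
    [NormedAddCommGroup E] [InnerProductSpace ℂ E] [CompleteSpace E]
    [NormedAddCommGroup Es] [InnerProductSpace ℂ Es] [CompleteSpace Es] where
  A : H →L[ℂ] H
  B : E →L[ℂ] H
  C : H →L[ℂ] Es
  D : E →L[ℂ] Es
  P : Fin d → H →L[ℂ] H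
  P_selfAdjoint : ∀ k, (P k)† = P k
  P_idem : ∀ k, P k ∘L P k = P k
  P_orth : ∀ j k, j ≠ k → P j ∘L P k = 0
  P_sum : ∑ k, P k = ContinuousLinearMap.id ℂ H
  isom_HH : A† ∘L A + C† ∘L C = ContinuousLinearMap.id ℂ H
  isom_HE : A† ∘L B + C† ∘L D = 0
  isom_EE : B† ∘L B + D† ∘L D = ContinuousLinearMap.id ℂ E
  coisom_HH : A ∘L A† + B ∘L B† = ContinuousLinearMap.id ℂ H
  coisom_HE : A ∘L C† + B ∘L D† = 0
  coisom_EE : C ∘L C† + D ∘L D† = ContinuousLinearMap.id ℂ Es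

/-- For orthogonal projections `P_k` and an operator `A` on `H`: the coefficient of `z^n` in
`(Z(z) A)^N`, where `Z(z) = ∑_k z_k P_k`. -/
def powCoeff {d : ℕ} {H : Type*} [NormedAddCommGroup H] [InnerProductSpace ℂ H]
    (P : Fin d → H →L[ℂ] H) (A : H →L[ℂ] H) : ℕ → Lattice d → (H →L[ℂ] H)
  | 0, n => if n = 0 then ContinuousLinearMap.id ℂ H else 0
  | N + 1, n => ∑ k, P k ∘L A ∘L powCoeff P A N (n - stdVec k)

/-- The coefficient of `z^n` in the formal power series `(I - Z(z) A)^{-1} = ∑_N (Z(z) A)^N`.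
Since `(Z(z) A)^N` is homogeneous of degree `N`, only `N = n_1 + ⋯ + n_d` contributes. -/
def resolventCoeff {d : ℕ} {H : Type*} [NormedAddCommGroup H] [InnerProductSpace ℂ H]
    (P : Fin d → H →L[ℂ] H) (A : H →L[ℂ] H) (n : Lattice d) : H →L[ℂ] H :=
  powCoeff P A (∑ k, n k).toNat n

/-! ### Formal kernels on the lattice and their reproducing kernel Hilbert spaces -/

section Kernels

/-- A formal kernel `∑ K_{n,m} z^n w^{-m}` with coefficients in the operators on `E_* ⊕ E`,
recorded through the array of its coefficients. -/
abbrev FormalKernel (d : ℕ) (E Es : Type*)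
    [NormedAddCommGroup E] [InnerProductSpace ℂ E]
    [NormedAddCommGroup Es] [InnerProductSpace ℂ Es] : Type _ :=
  Matrix (Lattice d) (Lattice d) (WithLp 2 (Es × E) →L[ℂ] WithLp 2 (Es × E))

variable {d : ℕ} {H E Es : Type*}
  [NormedAddCommGroup H] [InnerProductSpace ℂ H]
  [NormedAddCommGroup E] [InnerProductSpace ℂ E]
  [NormedAddCommGroup Es] [InnerProductSpace ℂ Es]

/-- The column operator `[X; Y] : H → E_* ⊕ E`. -/
def column (X : H →L[ℂ] Es) (Y : H →L[ℂ] E) : H →L[ℂ] WithLp 2 (Es × E) :=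
  ((WithLp.prodContinuousLinearEquiv 2 ℂ Es E).symm : Es × E →L[ℂ] WithLp 2 (Es × E)) ∘L
    X.prod Y

/-- The coordinate projection of `E_* ⊕ E` onto `E_*`. -/
def coordEs : WithLp 2 (Es × E) →L[ℂ] Es :=
  ContinuousLinearMap.fst ℂ Es E ∘L
    ((WithLp.prodContinuousLinearEquiv 2 ℂ Es E) : WithLp 2 (Es × E) →L[ℂ] Es × E)

/-- The coordinate projection of `E_* ⊕ E` onto `E`. -/
def coordE : WithLp 2 (Es × E) →L[ℂ] E :=
  ContinuousLinearMap.snd ℂ Es E ∘L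
    ((WithLp.prodContinuousLinearEquiv 2 ℂ Es E) : WithLp 2 (Es × E) →L[ℂ] Es × E)

/-- The block operator `[a b; c e]` on `E_* ⊕ E`. -/
def block (a : Es →L[ℂ] Es) (b : E →L[ℂ] Es) (c : Es →L[ℂ] E) (e : E →L[ℂ] E) :
    WithLp 2 (Es × E) →L[ℂ] WithLp 2 (Es × E) :=
  column (a ∘L coordEs + b ∘L coordE) (c ∘L coordEs + e ∘L coordE)

/-- The kernel `z^n K(z,w) w^{-n}`. -/
def shiftKernel (n : Lattice d) (κ : FormalKernel d E Es) : FormalKernel d E Es :=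
  Matrix.of fun p q => κ (p - n) (q - n)

/-- The linear map `Π` is unitary from the subspace `X` of `K` onto the reproducing kernel Hilbert
space of the kernel `κ`, which in particular is a positive kernel. Here `Π ξ` is a formal series,
recorded through its coefficients. -/
def IsUnitaryOnto [CompleteSpace E] [CompleteSpace Es]
    {K : Type*} [NormedAddCommGroup K] [InnerProductSpace ℂ K]
    (Pi : K → Lattice d → WithLp 2 (Es × E)) (X : Submodule ℂ K) (κ : FormalKernel d E Es) :
    Prop :=
  ∃ hκ : κ.PosSemidef, haveI : Fact κ.PosSemidef := ⟨hκ⟩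
    ∃ T : X ≃ₗᵢ[ℂ] RKHS.OfKernel κ, ∀ (ξ : X) (n : Lattice d), T ξ n = Pi ξ n

/-- The kernels `κ_i` are positive and their overlapping space, that is, the space of all
square-summable families `(f_i)` in the Hilbert-space direct sum of the reproducing kernel Hilbert
spaces of the `κ_i` such that `∑_i f_i = 0` (weakly coefficientwise), is trivial. -/
def OverlapTrivial [CompleteSpace E] [CompleteSpace Es] {ι : Type*}
    (κ : ι → FormalKernel d E Es) : Prop :=
  ∃ hκ : ∀ i, (κ i).PosSemidef, haveI : ∀ i, Fact (κ i).PosSemidef := fun i => ⟨hκ i⟩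
    ∀ f : lp (fun i => RKHS.OfKernel (κ i)) 2,
      (∀ (n : Lattice d) (v : WithLp 2 (Es × E)), HasSum (fun i => inner ℂ v (f i n)) 0) → f = 0

end Kernels

namespace Colligation

variable {d : ℕ} {H E Es : Type*}
  [NormedAddCommGroup H] [InnerProductSpace ℂ H] [CompleteSpace H]
  [NormedAddCommGroup E] [InnerProductSpace ℂ E] [CompleteSpace E]
  [NormedAddCommGroup Es] [InnerProductSpace ℂ Es] [CompleteSpace Es]
  (U : Colligation d H E Es)

/-- The coefficient `S_n` of the transfer function
`S(z) = D + C (I - Z(z) A)^{-1} Z(z) B = ∑_n S_n z^n`. -/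
def transfer (n : Lattice d) : E →L[ℂ] Es :=
  (if n = 0 then U.D else 0) +
    ∑ k, U.C ∘L resolventCoeff U.P U.A (n - stdVec k) ∘L U.P k ∘L U.B

/-- The coefficient of `z^n` in
`H_k(z) = [C (I - Z(z) A)^{-1}; z_k^{-1} B^* (I - Z(z)^{-1} A^*)^{-1}] P_k`. -/
def aglerFactor (k : Fin d) (n : Lattice d) : H →L[ℂ] WithLp 2 (Es × E) :=
  column (U.C ∘L resolventCoeff U.P U.A n ∘L U.P k)
    (U.B† ∘L resolventCoeff U.P (U.A†) (-n - stdVec k) ∘L U.P k)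

/-- The kernels `K_k(z,w) = H_k(z) H_k(w)^*` of the augmented Agler decomposition. -/
def aglerKernel (k : Fin d) : FormalKernel d E Es :=
  Matrix.of fun n m => U.aglerFactor k n ∘L (U.aglerFactor k m)†

/-- The coefficient of `z^p w^{-q}` in the `E`-diagonal block of `z_k^t K_k(z,w) w_k^{-t}`. -/
def aglerShiftE (k : Fin d) (t : ℤ) (p q : Lattice d) : E →L[ℂ] E :=
  coordE ∘L U.aglerKernel k (p - t • stdVec k) (q - t • stdVec k) ∘L column 0 (.id ℂ E)

/-- The coefficient of `z^p w^{-q}` in the `E_*`-diagonal block of `z_k^t K_k(z,w) w_k^{-t}`. -/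
def aglerShiftEs (k : Fin d) (t : ℤ) (p q : Lattice d) : Es →L[ℂ] Es :=
  coordEs ∘L U.aglerKernel k (p - t • stdVec k) (q - t • stdVec k) ∘L column (.id ℂ Es) 0

/-- The limit, as `t → +∞`, of the `E`-diagonal blocks of `z_k^t K_k(z,w) w_k^{-t}`,
coefficientwise in the weak operator topology. -/
def limitE (k : Fin d) (p q : Lattice d) : E →L[ℂ] E :=
  (limUnder atTop fun t : ℤ => ContinuousLinearMapWOT.ofCLM (U.aglerShiftE k t p q)).toCLM

/-- The limit, as `t → -∞`, of the `E_*`-diagonal blocks of `z_k^t K_k(z,w) w_k^{-t}`,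
coefficientwise in the weak operator topology. -/
def limitEs (k : Fin d) (p q : Lattice d) : Es →L[ℂ] Es :=
  (limUnder atBot fun t : ℤ => ContinuousLinearMapWOT.ofCLM (U.aglerShiftEs k t p q)).toCLM

/-- The kernel attached to a boundary component of `Ω`: the shift by `z^n` of `K_k` for a point `n`
of the finite part of the `k`-th boundary, of the limit kernel at `+∞` for a line at `+∞`, and of
the limit kernel at `-∞` for a line at `-∞`. -/
def summandKernel {Ω : Set (Lattice d)} : BoundaryIndex Ω → FormalKernel d E Es
  | .fin k n _ => shiftKernel n (U.aglerKernel k)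
  | .posInf k n _ => shiftKernel n (Matrix.of fun p q => block 0 0 0 (U.limitE k p q))
  | .negInf k n _ => shiftKernel n (Matrix.of fun p q => block (U.limitEs k p q) 0 0 0)

open Classical in
/-- The indicator function `χ_Ω` times the Kronecker delta, as a multiple of the identity. -/
def indDelta {G : Type*} [NormedAddCommGroup G] [InnerProductSpace ℂ G] (Ω : Set (Lattice d))
    (n m : Lattice d) : G →L[ℂ] G :=
  if n ∈ Ω ∧ n = m then .id ℂ G else 0

open Classical in
/-- The value `χ_Ω(n)` of the indicator function. -/
def ind (Ω : Set (Lattice d)) (n : Lattice d) : ℂ := if n ∈ Ω then 1 else 0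

/-- The kernel of the de Branges-Rovnyak model space attached to `S` and `Ω`: the difference
`K_K - K_W - K_{W*}` of the kernels of the images of `K`, of the outgoing space `⊕_{n ∈ Ω} U^n F`
and of the incoming space `⊕_{n ∉ Ω} U^n F_*`. The infinite sums of
coefficients are taken in the weak operator topology. -/
def scatteringKernel (Ω : Set (Lattice d)) : FormalKernel d E Es :=
  Matrix.of fun n m => block
    (indDelta Ω n m - (∑' l : Ω, ContinuousLinearMapWOT.ofCLM
      (U.transfer (n - l) ∘L (U.transfer (m - l))†)).toCLM)
    ((ind Ω n - ind Ω m) • U.transfer (n - m))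
    ((ind Ω m - ind Ω n) • (U.transfer (m - n))†)
    (indDelta Ωᶜ n m - (∑' l : ↥(Ωᶜ), ContinuousLinearMapWOT.ofCLM
      ((U.transfer (l - n))† ∘L U.transfer (l - m))).toCLM)

/-- All infinite sums entering the kernel attached to `S` and `Ω` converge weakly. -/
def ScatteringKernelConverges (Ω : Set (Lattice d)) : Prop :=
  ∀ n m : Lattice d,
    Summable (fun l : Ω => ContinuousLinearMapWOT.ofCLM
      (U.transfer (n - l) ∘L (U.transfer (m - l))†)) ∧
    Summable (fun l : ↥(Ωᶜ) => ContinuousLinearMapWOT.ofCLM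
      ((U.transfer (l - n))† ∘L U.transfer (l - m)))

/-- The limit kernels at `±∞` exist as strong coefficientwise limits. -/
def LimitKernelsConverge : Prop :=
  ∀ (k : Fin d) (p q : Lattice d),
    (∀ e : E, Tendsto (fun t : ℤ => U.aglerShiftE k t p q e) atTop (𝓝 (U.limitE k p q e))) ∧
    (∀ e : Es, Tendsto (fun t : ℤ => U.aglerShiftEs k t p q e) atBot (𝓝 (U.limitEs k p q e)))

/-- The augmented Agler decomposition is strictly closely connected: neither the kernels `K_k` nor
the kernels `z_k K_k(z,w) w_k^{-1}` overlap. -/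
def StrictlyCloselyConnected : Prop :=
  OverlapTrivial (fun k : Fin d => U.aglerKernel k) ∧
    OverlapTrivial (fun k : Fin d => shiftKernel (stdVec k) (U.aglerKernel k))

/-- The overlapping space of the kernels attached to the boundary components of `Ω` is trivial. -/
def BoundaryOverlapTrivial (Ω : Set (Lattice d)) : Prop :=
  OverlapTrivial (fun i : BoundaryIndex Ω => U.summandKernel i)

/-- The augmented Agler decomposition is minimal with respect to `Ω`. -/
def MinimalAglerDecomp (Ω : Set (Lattice d)) : Prop :=
  U.StrictlyCloselyConnected ∧ U.BoundaryOverlapTrivial Ω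

/-- The smallest closed subspace of `H` that contains `im B` and `im C^*` and is invariant under
`A`, `A^*` and `P_1, …, P_d`. -/
def closelyConnectedPart : Submodule ℂ H :=
  sInf {X | IsClosed (X : Set H) ∧ LinearMap.range (U.B : E →ₗ[ℂ] H) ≤ X ∧
    LinearMap.range ((U.C†) : Es →ₗ[ℂ] H) ≤ X ∧ InvariantUnder X U.A ∧ InvariantUnder X (U.A†) ∧
    ∀ k, InvariantUnder X (U.P k)}

/-- The colligation is closely connected. -/
def IsCloselyConnected : Prop := U.closelyConnectedPart = ⊤

end Colligation

/-! ### Embedded colligations -/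

/-- An embedding of the Givone-Roesser unitary colligation `U` in the scattering system `𝔖`.
It consists of isometries `i_H : H → K` (with `L_k = i_H (P_k H)`), `i_E : E → K` with range `F`,
`i_{E_*} : E_* → K` with range `F_*`, and of closed subspaces `M_k`, `M_{*k}` doubly invariant for
`U_k` such that
* `V^Ω`, for the balanced `Ω`, is the orthogonal sum of the attached subspaces;
* `(⊕ L_k) ⊕ F = F_* ⊕ (⊕ U_k L_k)` (compatible decomposition property);
* `P_{U_k^m L_k}` tends strongly to `P_{M_k}` for `m → +∞` and to `P_{M_{*k}}` for `m → -∞`;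
* `U` is the compression `[i_{H_k}^* U_k^*; i_{E_*}^*] [i_H i_E]`.
These are the conditions under which the trajectory map `ξ ↦ (i_E^* U^{-n} ξ, i_H^* U^{-n} ξ,
i_{E_*}^* U^{-n} ξ)` identifies `𝔖` with the trajectory system of `U`. -/
structure Embedding {d : ℕ} {K H E Es : Type*}
    [NormedAddCommGroup K] [InnerProductSpace ℂ K] [CompleteSpace K]
    [NormedAddCommGroup H] [InnerProductSpace ℂ H] [CompleteSpace H]
    [NormedAddCommGroup E] [InnerProductSpace ℂ E] [CompleteSpace E]
    [NormedAddCommGroup Es] [InnerProductSpace ℂ Es] [CompleteSpace Es]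
    (U : Colligation d H E Es) (𝔖 : ScatteringSystem d K) where
  iH : H →ₗᵢ[ℂ] K
  iE : E →ₗᵢ[ℂ] K
  iEs : Es →ₗᵢ[ℂ] K
  L : Fin d → Submodule ℂ K
  M : Fin d → Submodule ℂ K
  Ms : Fin d → Submodule ℂ K
  L_eq : ∀ k, L k = (LinearMap.range (U.P k : H →ₗ[ℂ] H)).map iH.toLinearMap
  range_iE : LinearMap.range iE.toLinearMap = 𝔖.F
  range_iEs : LinearMap.range iEs.toLinearMap = 𝔖.Fs
  isClosed_M : ∀ k, IsClosed (M k : Set K)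
  isClosed_Ms : ∀ k, IsClosed (Ms k : Set K)
  doublyInvariant_M : ∀ k, image (𝔖.evol k) (M k) = M k
  doublyInvariant_Ms : ∀ k, image (𝔖.evol k) (Ms k) = Ms k
  orthDecomp : 𝔖.OrthDecomp L M Ms (balanced d)
  cdp_left : ∀ k, L k ⟂ 𝔖.F
  cdp_right : ∀ k, 𝔖.Fs ⟂ image (𝔖.evol k) (L k)
  cdp_shift : ∀ j k, j ≠ k → image (𝔖.evol j) (L j) ⟂ image (𝔖.evol k) (L k)
  cdp_eq : (⨆ k, L k) ⊔ 𝔖.F = 𝔖.Fs ⊔ ⨆ k, image (𝔖.evol k) (L k)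
  slim : ∀ k ξ, Tendsto (fun m : ℤ => proj (image (𝔖.evol k ^ m) (L k)) ξ) atTop
    (𝓝 (proj (M k) ξ))
  slim_s : ∀ k ξ, Tendsto (fun m : ℤ => proj (image (𝔖.evol k ^ m) (L k)) ξ) atBot
    (𝓝 (proj (Ms k) ξ))
  A_eq : ∀ k h, U.P k (U.A h) = U.P k ((iH.toContinuousLinearMap†) ((𝔖.evol k)⁻¹ (iH h)))
  B_eq : ∀ k e, U.P k (U.B e) = U.P k ((iH.toContinuousLinearMap†) ((𝔖.evol k)⁻¹ (iE e)))
  C_eq : ∀ h, U.C h = (iEs.toContinuousLinearMap†) (iH h)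
  D_eq : ∀ e, U.D e = (iEs.toContinuousLinearMap†) (iE e)

namespace Embedding

variable {d : ℕ} {K H E Es : Type*}
  [NormedAddCommGroup K] [InnerProductSpace ℂ K] [CompleteSpace K]
  [NormedAddCommGroup H] [InnerProductSpace ℂ H] [CompleteSpace H]
  [NormedAddCommGroup E] [InnerProductSpace ℂ E] [CompleteSpace E]
  [NormedAddCommGroup Es] [InnerProductSpace ℂ Es] [CompleteSpace Es]
  {U : Colligation d H E Es} {𝔖 : ScatteringSystem d K} (ε : Embedding U 𝔖)

/-- The subspace of `K` attached to a boundary component of `Ω` by the embedding. -/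
def summand {Ω : Set (Lattice d)} (i : BoundaryIndex Ω) : Submodule ℂ K :=
  𝔖.summand ε.L ε.M ε.Ms i

/-- The de Branges-Rovnyak map: it sends `ξ` to the pair of its Fourier transforms
`∑_n (i_{E_*}^* U^{-n} ξ) z^n` and `∑_n (i_E^* U^{-n} ξ) z^n`, recorded through coefficients. -/
def dBR (ξ : K) (n : Lattice d) : WithLp 2 (Es × E) :=
  WithLp.toLp 2 ((ε.iEs.toContinuousLinearMap†) ((evolPow 𝔖.evol n)⁻¹ ξ),
    (ε.iE.toContinuousLinearMap†) ((evolPow 𝔖.evol n)⁻¹ ξ))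

/-- The subspace `L_{cc,k} = i_H (P_k H_cc)` given by the closely connected part `H_cc` of `H`. -/
def Lcc (k : Fin d) : Submodule ℂ K :=
  (U.closelyConnectedPart.map (U.P k : H →ₗ[ℂ] H)).map ε.iH.toLinearMap

/-- The range `M_{cc,k}` of the strong limit of `P_{U_k^m L_{cc,k}}` for `m → +∞`. -/
def Mcc (k : Fin d) : Submodule ℂ K := 𝔖.limitSubspace atTop k (ε.Lcc k)

/-- The range `M_{*cc,k}` of the strong limit of `P_{U_k^m L_{cc,k}}` for `m → -∞`. -/
def Mscc (k : Fin d) : Submodule ℂ K := 𝔖.limitSubspace atBot k (ε.Lcc k)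

/-- The strong limits of the projections `P_{U_k^m L_{cc,k}}` exist, as projections onto `M_{cc,k}`
for `m → +∞` and onto `M_{*cc,k}` for `m → -∞`. -/
def CcLimitsExist : Prop :=
  ∀ k ξ,
    Tendsto (fun m : ℤ => proj (image (𝔖.evol k ^ m) (ε.Lcc k)) ξ) atTop
      (𝓝 (proj (ε.Mcc k) ξ)) ∧
    Tendsto (fun m : ℤ => proj (image (𝔖.evol k ^ m) (ε.Lcc k)) ξ) atBot
      (𝓝 (proj (ε.Mscc k) ξ))

/-- The closely connected part `V^Ω_cc` of `V^Ω`: the closed span of the subspaces attached to the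
boundary components of `Ω` by `L_{cc,k}`, `M_{cc,k}` and `M_{*cc,k}`. -/
def Vcc (Ω : Set (Lattice d)) : Submodule ℂ K :=
  (⨆ i : BoundaryIndex Ω, 𝔖.summand ε.Lcc ε.Mcc ε.Mscc i).topologicalClosure

end Embedding

end

end Multievolution

open Multievolution

/-! Let `ev n` be the coefficient of `z^n` of the dBR map `Π`, and `N = 𝔖.scatMinᗮ`. Then `N` is
exactly the kernel of `Π` (`mem_orthogonal_scatMin`), and every kernel in the statement has
coefficients `ev n ∘ P_X ∘ (ev m)†` for a suitable closed subspace `X`: this is `projKernel`,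
identified in `aglerKernel_eq`, `summandKernel_eq` and `scatteringKernel_eq`. The identifications
come from the system equations `iH_add_iE` and `evolPow_stdVec_iH_P`, which make the coefficients of
`Π` on the state space obey the recursions of the two resolvents. For any closed `X`, the part of
`X` in `N` does not contribute to the kernel, and `Π` maps `X ⊖ (X ∩ N)` unitarily onto its
reproducing kernel space.

Triviality of the overlap then becomes Hilbert space geometry of pairwise orthogonal closed
subspaces `χ i`. If each `P_χ` leaves `N` invariant, an overlapping family lifts to vectors `g i ∈ χ
i ∩ Nᗮ` whose sum lies in `N` and in `Nᗮ`, so all of them vanish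
(`overlapTrivial_of_invariantUnder`). Conversely, a vector of `N` orthogonal to every `χ i ∩ N` has
components whose images under `Π` overlap; hence without overlap `N` is the closed span of the `χ i
∩ N`, which is invariant (`invariantUnder_of_overlapTrivial`).

Triviality for every shift-invariant `Ω`, with no decomposition assumed for it, requires the
summands to be orthogonal in any case. This is `isOrtho_summand`: for translates of the `L k` it
follows by induction on the degree from the balanced decomposition and the system equations, and for
components at infinity by iterated limits. Finally, when `N` is invariant under the `P_{L k}`, the
orthogonal complement of the closely connected part is the part of the state space embedded in `N`
(`orthogonal_closelyConnectedPart`), so the closely connected objects are intersections with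
`𝔖.scatMin`. -/

namespace Multievolution

/-! ### Reproducing kernel Hilbert spaces with the same kernel -/

section Reproducing

variable {X V H₁ H₂ : Type*} [NormedAddCommGroup V] [InnerProductSpace ℂ V] [CompleteSpace V]
  [NormedAddCommGroup H₁] [InnerProductSpace ℂ H₁] [CompleteSpace H₁] [RKHS ℂ H₁ X V]
  [NormedAddCommGroup H₂] [InnerProductSpace ℂ H₂] [CompleteSpace H₂] [RKHS ℂ H₂ X V]

theorem denseRange_kernel_combination (H₁ : Type*)
    [NormedAddCommGroup H₁] [InnerProductSpace ℂ H₁] [CompleteSpace H₁] [RKHS ℂ H₁ X V] :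
    DenseRange (Finsupp.linearCombination ℂ fun p : X × V => RKHS.kerFun H₁ p.1 p.2) := by
  have h := RKHS.kerFun_dense (𝕜 := ℂ) (X := X) (V := V) H₁
  have hr : Set.range (fun p : X × V => RKHS.kerFun H₁ p.1 p.2) =
      {f | ∃ x v, RKHS.kerFun H₁ x v = f} := by
    ext f
    simp
  rw [DenseRange, ← LinearMap.coe_range, Finsupp.range_linearCombination, hr]
  exact Submodule.dense_iff_topologicalClosure_eq_top.2 h

/-- Reproducing kernel Hilbert spaces with the same kernel are equal as spaces of functions. -/
theorem exists_isometryEquiv_of_kernel_eq (h : RKHS.kernel H₁ = RKHS.kernel H₂) :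
    ∃ T : H₁ ≃ₗᵢ[ℂ] H₂, ∀ f x, T f x = f x := by
  set e₁ := Finsupp.linearCombination ℂ fun p : X × V => RKHS.kerFun H₁ p.1 p.2 with he₁
  set e₂ := Finsupp.linearCombination ℂ fun p : X × V => RKHS.kerFun H₂ p.1 p.2 with he₂
  -- Inner products of kernel functions are values of the kernel, so equal coefficients have equal
  -- norms in both spaces, and the identity on coefficients extends by density.
  have hn : ∀ x, ‖e₂ (LinearEquiv.refl ℂ _ x)‖ = ‖e₁ x‖ := by
    intro x
    have : inner ℂ (e₂ x) (e₂ x) = inner ℂ (e₁ x) (e₁ x) := by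
      simp only [he₁, he₂, Finsupp.linearCombination_apply, Finsupp.sum_inner, Finsupp.inner_sum,
        inner_smul_left, inner_smul_right, ← RKHS.kernel_inner, h]
    rw [inner_self_eq_norm_sq_to_K, inner_self_eq_norm_sq_to_K] at this
    have h2 : ‖e₂ x‖ ^ 2 = ‖e₁ x‖ ^ 2 := by exact_mod_cast this
    simpa using h2
  let T := (LinearEquiv.refl ℂ _).extendOfIsometry e₁ e₂ (denseRange_kernel_combination H₁)
    (denseRange_kernel_combination H₂) hn
  refine ⟨T, fun f x => ext_inner_left ℂ fun v => ?_⟩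
  have hT : T (RKHS.kerFun H₁ x v) = RKHS.kerFun H₂ x v := by
    have := (LinearEquiv.refl ℂ _).extendOfIsometry_eq e₁ e₂ (denseRange_kernel_combination H₁)
      (denseRange_kernel_combination H₂) hn (Finsupp.single (x, v) 1)
    simpa [he₁, he₂] using this
  rw [← RKHS.kerFun_inner, ← RKHS.kerFun_inner, ← hT, T.inner_map_map]

end Reproducing

/-! ### Projections onto closed subspaces -/

section Proj

variable {K : Type*} [NormedAddCommGroup K] [InnerProductSpace ℂ K] [CompleteSpace K]
  {X Y : Submodule ℂ K}

theorem proj_mem (hX : IsClosed (X : Set K)) (ξ : K) : proj X ξ ∈ X := by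
  exact X.topologicalClosure_minimal le_rfl hX
    (X.topologicalClosure.starProjection_apply_mem ξ)

theorem sub_proj_mem (ξ : K) : ξ - proj X ξ ∈ Xᗮ := by
  have := X.topologicalClosure.sub_starProjection_mem_orthogonal ξ
  rwa [Submodule.orthogonal_closure] at this

theorem proj_eq {ξ η : K} (h : η ∈ X) (h' : ξ - η ∈ Xᗮ) : proj X ξ = η := by
  refine Submodule.eq_starProjection_of_mem_orthogonal (X.le_topologicalClosure h) ?_
  rwa [Submodule.orthogonal_closure]

theorem proj_eq_self {ξ : K} (h : ξ ∈ X) : proj X ξ = ξ := proj_eq h (by simp)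

theorem proj_eq_zero {ξ : K} (h : ξ ∈ Xᗮ) : proj X ξ = 0 := proj_eq X.zero_mem (by simpa)

theorem proj_eq_zero_of_isOrtho (h : X ⟂ Y) {ξ : K} (hξ : ξ ∈ Y) : proj X ξ = 0 :=
  proj_eq_zero (h.symm hξ)

theorem inner_proj (ξ η : K) : inner ℂ (proj X ξ) η = inner ℂ ξ (proj X η) :=
  X.topologicalClosure.inner_starProjection_left_eq_right ξ η

/-- For self-adjoint reasons, a subspace invariant under a projection has an invariant
orthogonal complement. -/
theorem InvariantUnder.orthogonal (h : InvariantUnder Y (proj X)) : InvariantUnder Yᗮ (proj X) :=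
  fun ξ hξ => (Submodule.mem_orthogonal _ _).2 fun η hη => by
    rw [← inner_proj]
    exact (Submodule.mem_orthogonal _ _).1 hξ _ (h η hη)

omit [CompleteSpace K] in
theorem isClosed_inf_orthogonal (hX : IsClosed (X : Set K)) (Z : Submodule ℂ K) :
    IsClosed ((X ⊓ Zᗮ : Submodule ℂ K) : Set K) :=
  hX.inter Z.isClosed_orthogonal

variable {ι : Type*} {χ : ι → Submodule ℂ K}

omit [CompleteSpace K] in
theorem orthogonalFamily_of_pairwise (h : ∀ i j, i ≠ j → χ i ⟂ χ j) :
    OrthogonalFamily ℂ (fun i => χ i) fun i => (χ i).subtypeₗᵢ :=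
  fun i j hij v w => (h i j hij).inner_eq v.2 w.2

/-- The continuous projection `proj (χ i)` kills every term of the series except the `i`-th, which
it fixes. -/
theorem proj_hasSum_component (h : ∀ i j, i ≠ j → χ i ⟂ χ j)
    {x : ∀ i, χ i} {ξ : K} (hx : HasSum (fun i => (x i : K)) ξ) (i : ι) : proj (χ i) ξ = x i := by
  have h1 := (proj (χ i)).hasSum hx
  refine h1.unique ?_
  convert hasSum_single i (fun j hj => proj_eq_zero_of_isOrtho (h i j hj.symm) (x j).2) using 1
  exact (proj_eq_self (x i).2).symm

/-- This is `X ⊖ (X ⊖ Y) = Y`: the difference `ξ - proj Y ξ` lies in `X ⊓ Yᗮ` and is orthogonal to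
itself. -/
theorem mem_of_mem_orthogonal_inf_orthogonal
    (hY : IsClosed (Y : Set K)) (hYX : Y ≤ X) {ξ : K} (hξ : ξ ∈ X) (h : ξ ∈ (X ⊓ Yᗮ)ᗮ) : ξ ∈ Y := by
  have h1 : ξ - proj Y ξ ∈ X ⊓ Yᗮ := ⟨sub_mem hξ (hYX (proj_mem hY ξ)), sub_proj_mem ξ⟩
  have h2 : inner ℂ (ξ - proj Y ξ) (ξ - proj Y ξ) = 0 := by
    rw [inner_sub_right, (Submodule.mem_orthogonal _ _).1 h _ h1,
      (Submodule.mem_orthogonal' _ _).1 h1.2 _ (proj_mem hY ξ), sub_zero]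
  rw [inner_self_eq_zero, sub_eq_zero] at h2
  exact h2 ▸ proj_mem hY ξ

/-- An element of the closed span of pairwise orthogonal closed subspaces is the sum of its
components, which form a square-summable family. -/
theorem exists_lp_of_mem_closure (hc : ∀ i, IsClosed (χ i : Set K))
    (h : ∀ i j, i ≠ j → χ i ⟂ χ j) {ξ : K} (hξ : ξ ∈ (⨆ i, χ i).topologicalClosure) :
    ∃ x : lp (fun i => χ i) 2, (∀ i, (x i : K) = proj (χ i) ξ) ∧
      HasSum (fun i => (x i : K)) ξ := by
  have : ∀ i, CompleteSpace (χ i) := fun i => (hc i).completeSpace_coe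
  have hO := orthogonalFamily_of_pairwise h
  have hr := hO.range_linearIsometry
  simp only [Submodule.subtypeₗᵢ_toLinearMap, Submodule.range_subtype] at hr
  rw [← hr] at hξ
  obtain ⟨x, rfl⟩ := hξ
  have hs := hO.hasSum_linearIsometry x
  exact ⟨x, fun i => (proj_hasSum_component h hs i).symm, hs⟩

theorem hasSum_proj (hc : ∀ i, IsClosed (χ i : Set K)) (h : ∀ i j, i ≠ j → χ i ⟂ χ j) (ξ : K) :
    HasSum (fun i => proj (χ i) ξ) (proj (⨆ i, χ i).topologicalClosure ξ) := by
  have hm := proj_mem (Submodule.isClosed_topologicalClosure (⨆ i, χ i)) ξ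
  obtain ⟨x, hx, hs⟩ := exists_lp_of_mem_closure hc h hm
  convert hs using 2 with i
  rw [hx i, ← sub_eq_zero, ← map_sub]
  refine proj_eq_zero (Submodule.orthogonal_le ?_ (sub_proj_mem ξ))
  exact (le_iSup χ i).trans (Submodule.le_topologicalClosure _)

theorem mem_of_mem_closure_of_proj_eq_zero (hc : ∀ i, IsClosed (χ i : Set K))
    (h : ∀ i j, i ≠ j → χ i ⟂ χ j) {ξ : K} (hξ : ξ ∈ (⨆ i, χ i).topologicalClosure)
    (h0 : ∀ i, proj (χ i) ξ = 0) : ξ = 0 := by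
  obtain ⟨x, hx, hs⟩ := exists_lp_of_mem_closure hc h hξ
  simp only [hx, h0] at hs
  exact hs.unique hasSum_zero

/-- `proj (χ i)` is the identity on `N i` and zero on the other `N j`; continuity carries this to
the closure. -/
theorem invariantUnder_closure_iSup {N : ι → Submodule ℂ K}
    (h : ∀ i j, i ≠ j → χ i ⟂ χ j) (hN : ∀ i, N i ≤ χ i) (i : ι) :
    ∀ ξ ∈ (⨆ i, N i).topologicalClosure, proj (χ i) ξ ∈ (⨆ i, N i).topologicalClosure := by
  have h1 : (⨆ i, N i) ≤ (⨆ i, N i).comap (proj (χ i) : K →ₗ[ℂ] K) := by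
    refine iSup_le fun j ξ hξ => ?_
    rw [Submodule.mem_comap]
    by_cases hij : i = j
    · subst hij
      have : (proj (χ i) : K →ₗ[ℂ] K) ξ = ξ := proj_eq_self (hN i hξ)
      rw [this]
      exact Submodule.mem_iSup_of_mem i hξ
    · have : (proj (χ i) : K →ₗ[ℂ] K) ξ = 0 := proj_eq_zero_of_isOrtho (h i j hij) (hN j hξ)
      rw [this]
      exact Submodule.zero_mem _
  intro ξ hξ
  exact map_mem_closure (proj (χ i)).continuous hξ fun η hη => h1 hη

end Proj

/-! ### Overlapping spaces of kernels of subspaces -/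

section Overlap

variable {d : ℕ} {K E Es : Type*}
  [NormedAddCommGroup K] [InnerProductSpace ℂ K] [CompleteSpace K]
  [NormedAddCommGroup E] [InnerProductSpace ℂ E] [CompleteSpace E]
  [NormedAddCommGroup Es] [InnerProductSpace ℂ Es] [CompleteSpace Es]
  (ev : Lattice d → K →L[ℂ] WithLp 2 (Es × E))

/-- The kernel of the image of the subspace `X` under the map with coefficients `ev n`. -/
noncomputable def projKernel (X : Submodule ℂ K) : FormalKernel d E Es :=
  Matrix.of fun n m => ev n ∘L proj X ∘L (ev m)†

/-- The difference of the two projections has values in `X ⊖ Y`, where all evaluations vanish. -/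
theorem projKernel_congr {X Y : Submodule ℂ K} (hX : IsClosed (X : Set K))
    (hY : IsClosed (Y : Set K)) (hYX : Y ≤ X) (h : ∀ ξ ∈ X, ξ ∈ Yᗮ → ∀ n, ev n ξ = 0) :
    projKernel ev X = projKernel ev Y := by
  ext1 n m
  refine ContinuousLinearMap.ext fun v => ?_
  simp only [projKernel, Matrix.of_apply, ContinuousLinearMap.comp_apply]
  generalize ((ev m)†) v = ξ
  rw [← sub_eq_zero, ← map_sub]
  refine h _ (sub_mem (proj_mem hX ξ) (hYX (proj_mem hY ξ))) ?_ n
  have := sub_mem (sub_proj_mem (X := Y) ξ) (Submodule.orthogonal_le hYX (sub_proj_mem (X := X) ξ))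
  rwa [sub_sub_sub_cancel_left] at this

/-- `X` is itself a reproducing kernel Hilbert space: an element is viewed as the function `n ↦ ev n
ξ`, faithfully by `h`. Its kernel function at `(m, v)` is the projection onto `X` of `(ev m)† v`, so
its kernel is `projKernel ev X`, and a space is determined by its kernel. -/
theorem isUnitaryOnto_projKernel {X : Submodule ℂ K} (hX : IsClosed (X : Set K))
    (h : ∀ ξ ∈ X, (∀ n, ev n ξ = 0) → ξ = 0) :
    IsUnitaryOnto (fun ξ n => ev n ξ) X (projKernel ev X) := by
  have : CompleteSpace X := hX.completeSpace_coe
  let : RKHS ℂ X (Lattice d) (WithLp 2 (Es × E)) :=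
    { coeCLM := ContinuousLinearMap.pi fun n => ev n ∘L X.subtypeL
      coeCLM_injective := by
        refine (injective_iff_map_eq_zero _).mpr fun f hf => ?_
        exact Subtype.ext (h f f.2 fun n => congrFun hf n) }
  have hcoe : ∀ (f : X) (n : Lattice d), f n = ev n f := fun _ _ => rfl
  have hk : RKHS.kernel X = projKernel ev X := by
    ext1 n m
    refine ContinuousLinearMap.ext fun v => ?_
    rw [← RKHS.kerFun_apply, hcoe]
    simp only [projKernel, Matrix.of_apply, ContinuousLinearMap.comp_apply]
    congr 1
    refine (proj_eq (Subtype.mem _) ((Submodule.mem_orthogonal _ _).2 fun η hη => ?_)).symm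
    rw [inner_sub_right, ContinuousLinearMap.adjoint_inner_right]
    have := RKHS.inner_kerFun m v (⟨η, hη⟩ : X)
    rw [hcoe] at this
    rw [← this, Submodule.coe_inner, sub_self]
  have hpos : (projKernel ev X).PosSemidef := hk ▸ RKHS.posSemidef_kernel X
  refine ⟨hpos, ?_⟩
  have : Fact (projKernel ev X).PosSemidef := ⟨hpos⟩
  exact exists_isometryEquiv_of_kernel_eq (hk.trans RKHS.OfKernel.kernel_ofKernel.symm)

variable {ev} {N : Submodule ℂ K}

omit [CompleteSpace K] [CompleteSpace E] [CompleteSpace Es] in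
theorem isClosed_of_mem_iff (hN : ∀ ξ, ξ ∈ N ↔ ∀ n, ev n ξ = 0) : IsClosed (N : Set K) := by
  have : (N : Set K) = ⋂ n, {ξ | ev n ξ = 0} := by
    ext ξ
    simp [hN]
  rw [this]
  exact isClosed_iInter fun n => isClosed_eq (ev n).continuous continuous_const

/-- The orthogonal complement in `X` of the part of `X` annihilated by a family of evaluations is
mapped unitarily onto the reproducing kernel Hilbert space of the kernel of `X`. -/
theorem isUnitaryOnto_projKernel_of_ker (hN : ∀ ξ, ξ ∈ N ↔ ∀ n, ev n ξ = 0)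
    {X : Submodule ℂ K} (hX : IsClosed (X : Set K)) :
    IsUnitaryOnto (fun ξ n => ev n ξ) (X ⊓ (X ⊓ N)ᗮ) (projKernel ev X) := by
  have hY := isClosed_inf_orthogonal hX (X ⊓ N)
  rw [projKernel_congr ev hX hY inf_le_left fun ξ hξ hξ' => (hN ξ).1
    (mem_of_mem_orthogonal_inf_orthogonal (hX.inter (isClosed_of_mem_iff hN)) inf_le_left
      hξ hξ').2]
  refine isUnitaryOnto_projKernel ev hY fun ξ hξ h0 => ?_
  exact inner_self_eq_zero.1 ((Submodule.mem_orthogonal _ _).1 hξ.2 ξ ⟨hξ.1, (hN ξ).2 h0⟩)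

variable {ι : Type*} {χ : ι → Submodule ℂ K} {κ : ι → FormalKernel d E Es}

/-- An overlapping family is lifted through the unitaries to an orthogonal, square-summable family
in `K`; its sum lies in `N ∩ Nᗮ`, and orthogonality then forces each member to vanish. -/
theorem overlapTrivial_of_invariantUnder (hN : ∀ ξ, ξ ∈ N ↔ ∀ n, ev n ξ = 0)
    (h : ∀ i j, i ≠ j → χ i ⟂ χ j) (hc : ∀ i, IsClosed (χ i : Set K))
    (hu : ∀ i, IsUnitaryOnto (fun ξ n => ev n ξ) (χ i ⊓ (χ i ⊓ N)ᗮ) (κ i))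
    (hinv : ∀ i, InvariantUnder N (proj (χ i))) : OverlapTrivial κ := by
  choose hκ T hT using hu
  refine ⟨hκ, fun f hf => ?_⟩
  have : ∀ i, Fact (κ i).PosSemidef := fun i => ⟨hκ i⟩
  have hN' := isClosed_of_mem_iff hN
  have : ∀ i, CompleteSpace (χ i) := fun i => (hc i).completeSpace_coe
  have hO := orthogonalFamily_of_pairwise h
  let g : ∀ i, χ i := fun i => ⟨(T i).symm (f i), ((T i).symm (f i)).2.1⟩
  have hgn : ∀ i, ‖g i‖ = ‖f i‖ := fun i => (T i).symm.norm_map (f i)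
  have hg : Memℓp g 2 := by
    have := lp.memℓp f
    rw [memℓp_gen_iff (by norm_num)] at this ⊢
    simpa only [hgn] using this
  -- A priori `g i` is orthogonal only to `χ i ⊓ N`. Invariance puts `proj (χ i) η` there for each
  -- `η ∈ N`, which gives orthogonality to all of `N`.
  have hgN : ∀ i, (g i : K) ∈ Nᗮ := fun i => (Submodule.mem_orthogonal _ _).2 fun η hη => by
    rw [← proj_eq_self (g i).2, ← inner_proj]
    exact (Submodule.mem_orthogonal _ _).1 ((T i).symm (f i)).2.2 _ ⟨proj_mem (hc i) η, hinv i η hη⟩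
  have hs : HasSum (fun i => (g i : K)) (hO.linearIsometry ⟨g, hg⟩) :=
    hO.hasSum_linearIsometry ⟨g, hg⟩
  set γ := hO.linearIsometry ⟨g, hg⟩ with hγ
  have hγN : γ ∈ Nᗮ := N.isClosed_orthogonal.mem_of_tendsto hs
    (Eventually.of_forall fun s => sum_mem fun i _ => hgN i)
  -- The relation `∑ f i = 0` says that every evaluation of the lifted sum vanishes.
  have hγN' : γ ∈ N := (hN γ).2 fun n => ext_inner_left ℂ fun v => by
    have h1 := ((innerSL ℂ v) ∘L ev n).hasSum hs
    have h2 : ∀ i, ev n (g i : K) = f i n := fun i => by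
      have := hT i ((T i).symm (f i)) n
      rw [LinearIsometryEquiv.apply_symm_apply] at this
      exact this.symm
    simp only [ContinuousLinearMap.comp_apply, innerSL_apply_apply, h2] at h1
    rw [h1.unique (hf n v), inner_zero_right]
  have h0 : γ = 0 := inner_self_eq_zero.1 ((Submodule.mem_orthogonal _ _).1 hγN γ hγN')
  have hg0 : (⟨g, hg⟩ : lp (fun i => χ i) 2) = 0 := by
    rw [← norm_eq_zero, ← hO.linearIsometry.norm_map, ← hγ, h0, norm_zero]
  ext1
  funext i
  have := congrArg (fun x : lp (fun i => χ i) 2 => ‖x i‖) hg0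
  simp only [hgn, lp.coeFn_zero, Pi.zero_apply, norm_zero] at this
  exact norm_eq_zero.1 this

/-- It suffices that `N` is the closed span `M` of the subspaces `χ i ⊓ N`. The components of a
vector of `N ⊖ M` give an overlapping family, so the vector is zero. -/
theorem invariantUnder_of_overlapTrivial (hN : ∀ ξ, ξ ∈ N ↔ ∀ n, ev n ξ = 0)
    (h : ∀ i j, i ≠ j → χ i ⟂ χ j) (hc : ∀ i, IsClosed (χ i : Set K))
    (hu : ∀ i, IsUnitaryOnto (fun ξ n => ev n ξ) (χ i ⊓ (χ i ⊓ N)ᗮ) (κ i))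
    (hle : N ≤ (⨆ i, χ i).topologicalClosure) (ht : OverlapTrivial κ) (i : ι) :
    InvariantUnder N (proj (χ i)) := by
  obtain ⟨hκ, ht⟩ := ht
  choose hκ' T hT using hu
  have : ∀ i, Fact (κ i).PosSemidef := fun i => ⟨hκ i⟩
  have hN' := isClosed_of_mem_iff hN
  set M := (⨆ i, χ i ⊓ N).topologicalClosure with hM
  have hMN : M ≤ N := Submodule.topologicalClosure_minimal _ (iSup_le fun i => inf_le_right) hN'
  suffices hNM : N ≤ M from fun ξ hξ =>
    hMN (invariantUnder_closure_iSup h (fun i => inf_le_left) i ξ (hNM hξ))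
  intro ξ hξ
  have hMc : IsClosed (M : Set K) := Submodule.isClosed_topologicalClosure _
  set η := ξ - proj M ξ with hη
  have hηN : η ∈ N := sub_mem hξ (hMN (proj_mem hMc ξ))
  have hηM : η ∈ Mᗮ := sub_proj_mem ξ
  obtain ⟨x, hx, hs⟩ := exists_lp_of_mem_closure hc h (hle hηN)
  -- Each component of `η` inherits orthogonality to `χ i ⊓ N` from `η ⟂ M`, so it lies in the
  -- domain of the unitary `T i`.
  have hxY : ∀ i, (x i : K) ∈ χ i ⊓ (χ i ⊓ N)ᗮ := fun i =>
    ⟨(x i).2, (Submodule.mem_orthogonal _ _).2 fun ζ hζ => by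
      rw [hx, ← inner_proj, proj_eq_self hζ.1]
      exact (Submodule.mem_orthogonal _ _).1 hηM ζ
        (Submodule.le_topologicalClosure _ (Submodule.mem_iSup_of_mem i hζ))⟩
  let f : ∀ i, RKHS.OfKernel (κ i) := fun i => T i ⟨x i, hxY i⟩
  have hfn : ∀ i, ‖f i‖ = ‖x i‖ := fun i => (T i).norm_map ⟨x i, hxY i⟩
  have hf : Memℓp f 2 := by
    have := lp.memℓp x
    rw [memℓp_gen_iff (by norm_num)] at this ⊢
    simpa only [hfn] using this
  have h0 := ht ⟨f, hf⟩ fun n v => by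
    have h1 := ((innerSL ℂ v) ∘L ev n).hasSum hs
    simp only [ContinuousLinearMap.comp_apply, innerSL_apply_apply, (hN η).1 hηN n,
      inner_zero_right] at h1
    have h2 : ∀ i, f i n = ev n (x i : K) := fun i => hT i ⟨x i, hxY i⟩ n
    simp only [← h2] at h1
    exact h1
  have hx0 : ∀ i, (x i : K) = 0 := fun i => by
    have := congrArg (fun y : lp (fun i => RKHS.OfKernel (κ i)) 2 => ‖y i‖) h0
    simp only [hfn, lp.coeFn_zero, Pi.zero_apply, norm_zero] at this
    exact norm_eq_zero.1 this
  simp only [hx0] at hs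
  have : ξ = proj M ξ := sub_eq_zero.1 (hs.unique hasSum_zero)
  rw [this]
  exact proj_mem hMc ξ

end Overlap

/-! ### The evolution group -/

section Evolution

variable {K : Type*} [NormedAddCommGroup K] [InnerProductSpace ℂ K] {d : ℕ}
  {e : Fin d → (K ≃ₗᵢ[ℂ] K)}

theorem prod_ofFn_zpow_add {G : Type*} [Group G] : ∀ {d : ℕ} {e : Fin d → G},
    (∀ j k, Commute (e j) (e k)) → ∀ n m : Fin d → ℤ,
    (List.ofFn fun k => e k ^ (n k + m k)).prod =
      (List.ofFn fun k => e k ^ n k).prod * (List.ofFn fun k => e k ^ m k).prod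
  | 0, _, _, _, _ => by simp
  | d + 1, e, h, n, m => by
    simp only [List.ofFn_succ, List.prod_cons]
    rw [prod_ofFn_zpow_add (e := fun k => e k.succ) (fun j k => h _ _) (fun k => n k.succ)
      fun k => m k.succ, zpow_add]
    have hc : Commute ((List.ofFn fun k : Fin d => e k.succ ^ n k.succ).prod) (e 0 ^ m 0) := by
      refine Commute.list_prod_left _ _ fun x hx => ?_
      obtain ⟨k, rfl⟩ := List.mem_ofFn.1 hx
      exact (h _ _).zpow_zpow _ _
    rw [mul_assoc, ← mul_assoc (e 0 ^ m 0), ← hc.eq, mul_assoc, mul_assoc]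

theorem prod_ofFn_zpow_single {G : Type*} [Group G] : ∀ {d : ℕ} (e : Fin d → G) (k : Fin d) (t : ℤ),
    (List.ofFn fun j => e j ^ (Pi.single k t : Fin d → ℤ) j).prod = e k ^ t
  | 0, _, k, _ => k.elim0
  | d + 1, e, k, t => by
    simp only [List.ofFn_succ, List.prod_cons]
    refine Fin.cases ?_ (fun k => ?_) k
    · simp
    · have := prod_ofFn_zpow_single (fun j => e j.succ) k t
      rw [Pi.single_eq_of_ne (Fin.succ_ne_zero _).symm, zpow_zero, one_mul, ← this]
      congr! 4 with j
      by_cases hj : j = k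
      · subst hj; simp
      · rw [Pi.single_eq_of_ne hj, Pi.single_eq_of_ne (by simpa using hj)]

/-- Commutativity makes `n ↦ U^n` a group homomorphism; below, inverses and adjoints of `U^n` are
written as `U^{-n}`. -/
theorem evolPow_add (h : ∀ j k, Commute (e j) (e k)) (n m : Lattice d) :
    evolPow e (n + m) = evolPow e n * evolPow e m :=
  prod_ofFn_zpow_add h n m

theorem evolPow_add_apply (h : ∀ j k, Commute (e j) (e k)) (n m : Lattice d) (ξ : K) :
    evolPow e (n + m) ξ = evolPow e n (evolPow e m ξ) := by
  rw [evolPow_add h]; rfl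

theorem evolPow_smul_stdVec (k : Fin d) (t : ℤ) : evolPow e (t • stdVec k) = e k ^ t := by
  have : t • (stdVec k : Lattice d) = Pi.single k t := by
    rw [stdVec, ← Pi.single_smul]; simp
  rw [this]
  exact prod_ofFn_zpow_single e k t

theorem evolPow_stdVec (k : Fin d) : evolPow e (stdVec k) = e k := by
  simpa using evolPow_smul_stdVec (e := e) k 1

theorem evolPow_zero_apply (ξ : K) : evolPow e (0 : Lattice d) ξ = ξ := by
  have : evolPow e (0 : Lattice d) = 1 := by simp [evolPow]
  rw [this]; rfl

theorem evolPow_neg_apply_self (h : ∀ j k, Commute (e j) (e k)) (n : Lattice d) (ξ : K) :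
    evolPow e (-n) (evolPow e n ξ) = ξ := by
  rw [← evolPow_add_apply h, neg_add_cancel, evolPow_zero_apply]

theorem evolPow_apply_neg_self (h : ∀ j k, Commute (e j) (e k)) (n : Lattice d) (ξ : K) :
    evolPow e n (evolPow e (-n) ξ) = ξ := by
  rw [← evolPow_add_apply h, add_neg_cancel, evolPow_zero_apply]

theorem evolPow_inv_apply (h : ∀ j k, Commute (e j) (e k)) (n : Lattice d) (ξ : K) :
    (evolPow e n)⁻¹ ξ = evolPow e (-n) ξ := by
  have : (evolPow e n)⁻¹ = evolPow e (-n) := by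
    rw [inv_eq_iff_mul_eq_one, ← evolPow_add h, add_neg_cancel]
    simp [evolPow]
  rw [this]

theorem inv_apply_eq_evolPow (h : ∀ j k, Commute (e j) (e k)) (k : Fin d) (ξ : K) :
    (e k)⁻¹ ξ = evolPow e (-stdVec k) ξ := by
  rw [← evolPow_inv_apply h, evolPow_stdVec]

theorem inner_evolPow_left (h : ∀ j k, Commute (e j) (e k)) (n : Lattice d) (ξ η : K) :
    inner ℂ (evolPow e n ξ) η = inner ℂ ξ (evolPow e (-n) η) := by
  conv_lhs => rw [← evolPow_apply_neg_self h n η]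
  exact (evolPow e n).inner_map_map _ _

theorem inner_evolPow_right (h : ∀ j k, Commute (e j) (e k)) (n : Lattice d) (ξ η : K) :
    inner ℂ ξ (evolPow e n η) = inner ℂ (evolPow e (-n) ξ) η := by
  rw [inner_evolPow_left h, neg_neg]

end Evolution

/-! ### Translates of subspaces and their orthogonality -/

namespace ScatteringSystem

variable {d : ℕ} {K : Type*} [NormedAddCommGroup K] [InnerProductSpace ℂ K] [CompleteSpace K]
  (𝔖 : ScatteringSystem d K)

theorem mem_translate {n : Lattice d} {X : Submodule ℂ K} {ξ : K} :
    ξ ∈ 𝔖.translate n X ↔ evolPow 𝔖.evol (-n) ξ ∈ X := by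
  constructor
  · rintro ⟨η, hη, rfl⟩
    have : evolPow 𝔖.evol (-n) (evolPow 𝔖.evol n η) ∈ X := by
      rwa [evolPow_neg_apply_self 𝔖.evol_comm]
    exact this
  · intro h
    exact ⟨_, h, evolPow_apply_neg_self 𝔖.evol_comm n ξ⟩

theorem apply_mem_translate {n : Lattice d} {X : Submodule ℂ K} {ξ : K} (h : ξ ∈ X) :
    evolPow 𝔖.evol n ξ ∈ 𝔖.translate n X := ⟨ξ, h, rfl⟩

theorem isClosed_translate {n : Lattice d} {X : Submodule ℂ K} (h : IsClosed (X : Set K)) :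
    IsClosed (𝔖.translate n X : Set K) := by
  have : (𝔖.translate n X : Set K) = evolPow 𝔖.evol (-n) ⁻¹' X := by
    ext ξ
    exact 𝔖.mem_translate
  rw [this]
  exact h.preimage (evolPow 𝔖.evol (-n)).continuous

theorem translate_translate (n m : Lattice d) (X : Submodule ℂ K) :
    𝔖.translate n (𝔖.translate m X) = 𝔖.translate (n + m) X := by
  ext ξ
  rw [mem_translate, mem_translate, mem_translate, ← evolPow_add_apply 𝔖.evol_comm]
  simp [add_comm]

theorem translate_zero (X : Submodule ℂ K) : 𝔖.translate 0 X = X := by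
  ext ξ
  rw [mem_translate, neg_zero, evolPow_zero_apply]

theorem image_evol (k : Fin d) (X : Submodule ℂ K) :
    image (𝔖.evol k) X = 𝔖.translate (stdVec k) X := by
  rw [translate, evolPow_stdVec]

theorem image_evol_zpow (k : Fin d) (t : ℤ) (X : Submodule ℂ K) :
    image (𝔖.evol k ^ t) X = 𝔖.translate (t • stdVec k) X := by
  rw [translate, evolPow_smul_stdVec]

theorem proj_translate {n : Lattice d} {X : Submodule ℂ K} (h : IsClosed (X : Set K)) (ξ : K) :
    proj (𝔖.translate n X) ξ = evolPow 𝔖.evol n (proj X (evolPow 𝔖.evol (-n) ξ)) := by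
  refine proj_eq (𝔖.apply_mem_translate (proj_mem h _)) ((Submodule.mem_orthogonal _ _).2 ?_)
  rintro _ ⟨η, hη, rfl⟩
  change inner ℂ (evolPow 𝔖.evol n η) _ = 0
  rw [inner_evolPow_left 𝔖.evol_comm, map_sub, evolPow_neg_apply_self 𝔖.evol_comm]
  exact (Submodule.mem_orthogonal _ _).1 (sub_proj_mem _) _ hη

theorem translate_isOrtho_translate {n m : Lattice d} {X Y : Submodule ℂ K} :
    𝔖.translate n X ⟂ 𝔖.translate m Y ↔
      ∀ x ∈ X, ∀ y ∈ Y, inner ℂ x (evolPow 𝔖.evol (m - n) y) = 0 := by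
  rw [Submodule.isOrtho_iff_inner_eq]
  have key : ∀ x y, inner ℂ (evolPow 𝔖.evol n x) (evolPow 𝔖.evol m y) =
      inner ℂ x (evolPow 𝔖.evol (m - n) y) := fun x y => by
    rw [inner_evolPow_left 𝔖.evol_comm, ← evolPow_add_apply 𝔖.evol_comm, neg_add_eq_sub]
  constructor
  · intro h x hx y hy
    rw [← key]
    exact h _ (𝔖.apply_mem_translate hx) _ (𝔖.apply_mem_translate hy)
  · rintro h _ ⟨x, hx, rfl⟩ _ ⟨y, hy, rfl⟩
    exact (key x y).trans (h x hx y hy)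

theorem isOrtho_F_F {n m : Lattice d} (h : n ≠ m) : 𝔖.translate n 𝔖.F ⟂ 𝔖.translate m 𝔖.F := by
  have := 𝔖.wandering_F (n - m) (sub_ne_zero.2 h)
  rw [← translate] at this
  rw [translate_isOrtho_translate]
  rw [← 𝔖.translate_zero 𝔖.F, translate_translate, translate_isOrtho_translate] at this
  simpa using this

theorem isOrtho_Fs_Fs {n m : Lattice d} (h : n ≠ m) :
    𝔖.translate n 𝔖.Fs ⟂ 𝔖.translate m 𝔖.Fs := by
  have := 𝔖.wandering_Fs (n - m) (sub_ne_zero.2 h)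
  rw [← translate] at this
  rw [translate_isOrtho_translate]
  rw [← 𝔖.translate_zero 𝔖.Fs, translate_translate, translate_isOrtho_translate] at this
  simpa using this

/-- Translation by `-n` reduces this to the causality axiom for the pair `0`, `m - n`. -/
theorem isOrtho_F_Fs {n m : Lattice d} (h : ¬ n ≤ m) :
    𝔖.translate n 𝔖.F ⟂ 𝔖.translate m 𝔖.Fs := by
  have := 𝔖.orthogonal 0 (m - n) le_rfl (by rwa [sub_nonneg])
  rw [← translate, ← translate, translate_isOrtho_translate] at this
  rw [translate_isOrtho_translate]
  simpa using this

end ScatteringSystem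

/-- Shift-invariant subsets are upward closed. -/
theorem ShiftInvariant.mem_of_le {d : ℕ} {Ω : Set (Lattice d)} (h : ShiftInvariant Ω)
    {n m : Lattice d} (hn : n ∈ Ω) (hnm : n ≤ m) : m ∈ Ω := by
  have h1 : ∀ (k : Fin d) (t : ℕ) (n : Lattice d), n ∈ Ω → n + t • stdVec k ∈ Ω := by
    intro k t
    induction t with
    | zero => intro n hn; simpa
    | succ t ih =>
      intro n hn
      rw [succ_nsmul, ← add_assoc]
      exact h _ (ih n hn) k
  have h2 : ∀ s : Finset (Fin d), n + ∑ k ∈ s, (m k - n k).toNat • stdVec k ∈ Ω := by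
    intro s
    induction s using Finset.induction_on with
    | empty => simpa
    | insert k s hk ih =>
      rw [Finset.sum_insert hk, add_comm (_ • _), ← add_assoc]
      exact h1 k _ _ ih
  convert h2 Finset.univ
  ext j
  have := hnm j
  simp only [Pi.add_apply, Finset.sum_apply, Pi.smul_apply, stdVec, Pi.single_apply]
  simp [max_eq_left (sub_nonneg.2 this)]

/-! ### Resolvent coefficients -/

section Resolvent

variable {d : ℕ} {H G : Type*} [NormedAddCommGroup H] [InnerProductSpace ℂ H]
  [NormedAddCommGroup G] [InnerProductSpace ℂ G]

theorem sum_sub_stdVec (n : Lattice d) (k : Fin d) :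
    ∑ j, (n - stdVec k) j = (∑ j, n j) - 1 := by
  simp [stdVec, Finset.sum_sub_distrib]

theorem sum_add_stdVec (n : Lattice d) (k : Fin d) :
    ∑ j, (n + stdVec k) j = (∑ j, n j) + 1 := by
  simp [stdVec, Finset.sum_add_distrib]

/-- The definition of `powCoeff` splits off a factor `Z(z) A` on the left; the system equations
produce the factor on the right. Both agree after exchanging two finite sums. -/
theorem powCoeff_succ_right (P : Fin d → H →L[ℂ] H) (A : H →L[ℂ] H) (N : ℕ) (n : Lattice d) :
    powCoeff P A (N + 1) n = ∑ k, powCoeff P A N (n - stdVec k) ∘L P k ∘L A := by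
  induction N generalizing n with
  | zero =>
    rw [powCoeff]
    refine Finset.sum_congr rfl fun k _ => ?_
    simp only [powCoeff]
    split_ifs <;> simp
  | succ N ih =>
    have hl : powCoeff P A (N + 1 + 1) n = ∑ k, ∑ j,
        P k ∘L A ∘L powCoeff P A N (n - stdVec k - stdVec j) ∘L P j ∘L A := by
      rw [powCoeff]
      refine Finset.sum_congr rfl fun k _ => ?_
      rw [ih, ContinuousLinearMap.comp_finsetSum, ContinuousLinearMap.comp_finsetSum]
    rw [hl, Finset.sum_comm]
    refine Finset.sum_congr rfl fun k _ => ?_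
    rw [powCoeff, ContinuousLinearMap.finsetSum_comp]
    refine Finset.sum_congr rfl fun j _ => ?_
    rw [sub_right_comm]
    rfl

/-- A family of operators that satisfies the recursion of the coefficients of
`G₀ (I - Z(z) A)^{-1}` and vanishes in negative degrees is that family. -/
theorem eq_comp_resolventCoeff (P : Fin d → H →L[ℂ] H) (A : H →L[ℂ] H) (G₀ : H →L[ℂ] G)
    (g : Lattice d → H →L[ℂ] G) (hneg : ∀ n : Lattice d, ∑ k, n k < 0 → g n = 0)
    (hrec : ∀ n : Lattice d,
      g n = (if n = 0 then G₀ else 0) + ∑ k, g (n - stdVec k) ∘L P k ∘L A) (n : Lattice d) :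
    g n = G₀ ∘L resolventCoeff P A n := by
  have hpos : ∀ (N : ℕ) (n : Lattice d), ∑ k, n k = N → g n = G₀ ∘L powCoeff P A N n := by
    intro N
    induction N with
    | zero =>
      intro n hn
      rw [hrec n, Finset.sum_eq_zero fun k _ => ?_, add_zero]
      · simp only [powCoeff]
        split_ifs <;> simp
      · rw [hneg _ (by rw [sum_sub_stdVec, hn]; simp), ContinuousLinearMap.zero_comp]
    | succ N ih =>
      intro n hn
      have h0 : n ≠ 0 := by
        rintro rfl
        simp at hn
        omega
      rw [hrec n, if_neg h0, zero_add, powCoeff_succ_right, ContinuousLinearMap.comp_finsetSum]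
      refine Finset.sum_congr rfl fun k _ => ?_
      rw [ih _ (by rw [sum_sub_stdVec, hn]; push_cast; ring), ContinuousLinearMap.comp_assoc]
  rcases lt_or_ge (∑ k, n k) 0 with h | h
  -- In negative degree `toNat` returns `0`, and the zeroth power has no coefficient at `n ≠ 0`, so
  -- `resolventCoeff` vanishes there too.
  · rw [hneg n h, resolventCoeff, Int.toNat_of_nonpos h.le, powCoeff, if_neg,
      ContinuousLinearMap.comp_zero]
    rintro rfl
    simp at h
  · exact hpos _ n (by simp [h])

end Resolvent

/-- In degree zero, lowering any coordinate leaves the balanced set. Thus all `U^n L k` with `n` of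
degree zero occur in the decomposition assumed for an embedding. -/
theorem mem_finBoundary_balanced {d : ℕ} {n : Lattice d} (hn : ∑ j, n j = 0) (k : Fin d) :
    n ∈ finBoundary (balanced d) k := by
  have h : ∀ m : ℤ, Function.update n k m ∈ balanced d ↔ n k ≤ m := fun m => by
    rw [balanced, Set.mem_ofPred_eq, Finset.sum_update_of_mem (Finset.mem_univ k)]
    have := Finset.add_sum_erase Finset.univ n (Finset.mem_univ k)
    rw [Finset.sdiff_singleton_eq_erase]
    constructor <;> intro <;> linarith
  exact ⟨(h _).2 le_rfl, fun m hm => (h m).1 hm⟩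

/-! ### Pointwise identities of the colligation -/

namespace Colligation

variable {d : ℕ} {H E Es : Type*}
  [NormedAddCommGroup H] [InnerProductSpace ℂ H] [CompleteSpace H]
  [NormedAddCommGroup E] [InnerProductSpace ℂ E] [CompleteSpace E]
  [NormedAddCommGroup Es] [InnerProductSpace ℂ Es] [CompleteSpace Es]
  (U : Colligation d H E Es)

theorem P_P (k : Fin d) (h : H) : U.P k (U.P k h) = U.P k h :=
  DFunLike.congr_fun (U.P_idem k) h

theorem P_P_of_ne {j k : Fin d} (hjk : j ≠ k) (h : H) : U.P j (U.P k h) = 0 :=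
  DFunLike.congr_fun (U.P_orth j k hjk) h

theorem sum_P (h : H) : ∑ k, U.P k h = h := by
  have := DFunLike.congr_fun U.P_sum h
  simpa using this

theorem inner_P (k : Fin d) (x y : H) : inner ℂ (U.P k x) y = inner ℂ x (U.P k y) := by
  conv_lhs => rw [← U.P_selfAdjoint k, ContinuousLinearMap.adjoint_inner_left]

/-- With `C_adjoint_add_D_adjoint` this says that the colligation maps `(A^* h, B^* h)` to `(h, 0)`,
which reverses the system equations. -/
theorem A_adjoint_add_B_adjoint (h : H) :
    U.A ((U.A†) h) + U.B ((U.B†) h) = h := by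
  have := DFunLike.congr_fun U.coisom_HH h
  simpa using this

theorem C_adjoint_add_D_adjoint (h : H) :
    U.C ((U.A†) h) + U.D ((U.B†) h) = 0 := by
  have h1 := congrArg (fun T => T†) U.coisom_HE
  simp only [map_add, ContinuousLinearMap.adjoint_comp, ContinuousLinearMap.adjoint_adjoint,
    map_zero] at h1
  have := DFunLike.congr_fun h1 h
  simpa using this

end Colligation

/-! ### System equations and the Fourier coefficients of states, inputs and outputs -/

namespace Embedding

variable {d : ℕ} {K H E Es : Type*}
  [NormedAddCommGroup K] [InnerProductSpace ℂ K] [CompleteSpace K]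
  [NormedAddCommGroup H] [InnerProductSpace ℂ H] [CompleteSpace H]
  [NormedAddCommGroup E] [InnerProductSpace ℂ E] [CompleteSpace E]
  [NormedAddCommGroup Es] [InnerProductSpace ℂ Es] [CompleteSpace Es]
  {U : Colligation d H E Es} {𝔖 : ScatteringSystem d K} (ε : Embedding U 𝔖)

theorem iH_adjoint_iH (h : H) : (ε.iH.toContinuousLinearMap†) (ε.iH h) = h :=
  ext_inner_left ℂ fun v => by
    rw [ContinuousLinearMap.adjoint_inner_right]; exact ε.iH.inner_map_map _ _

theorem iE_adjoint_iE (h : E) : (ε.iE.toContinuousLinearMap†) (ε.iE h) = h :=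
  ext_inner_left ℂ fun v => by
    rw [ContinuousLinearMap.adjoint_inner_right]; exact ε.iE.inner_map_map _ _

theorem iEs_adjoint_iEs (h : Es) : (ε.iEs.toContinuousLinearMap†) (ε.iEs h) = h :=
  ext_inner_left ℂ fun v => by
    rw [ContinuousLinearMap.adjoint_inner_right]; exact ε.iEs.inner_map_map _ _

theorem iEs_adjoint_eq_zero {ξ : K} (h : ∀ e, inner ℂ (ε.iEs e) ξ = 0) :
    (ε.iEs.toContinuousLinearMap†) ξ = 0 :=
  ext_inner_left ℂ fun v => by
    rw [ContinuousLinearMap.adjoint_inner_right, inner_zero_right]; exact h v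

theorem mem_L {k : Fin d} {ξ : K} : ξ ∈ ε.L k ↔ ∃ h, ε.iH (U.P k h) = ξ := by
  rw [ε.L_eq]
  simp

theorem iH_P_mem_L (k : Fin d) (h : H) : ε.iH (U.P k h) ∈ ε.L k := ε.mem_L.2 ⟨h, rfl⟩

theorem iE_mem (e : E) : ε.iE e ∈ 𝔖.F := by
  rw [← ε.range_iE]; exact ⟨e, rfl⟩

theorem iEs_mem (e : Es) : ε.iEs e ∈ 𝔖.Fs := by
  rw [← ε.range_iEs]; exact ⟨e, rfl⟩

theorem proj_L (k : Fin d) (ξ : K) :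
    proj (ε.L k) ξ = ε.iH (U.P k ((ε.iH.toContinuousLinearMap†) ξ)) := by
  refine proj_eq (ε.iH_P_mem_L k _) ((Submodule.mem_orthogonal _ _).2 fun η hη => ?_)
  obtain ⟨h, rfl⟩ := ε.mem_L.1 hη
  have h1 : inner ℂ (ε.iH (U.P k h)) ξ =
      inner ℂ (U.P k h) ((ε.iH.toContinuousLinearMap†) ξ) := by
    rw [ContinuousLinearMap.adjoint_inner_right]; rfl
  rw [inner_sub_right, h1, ε.iH.inner_map_map, ← U.inner_P, U.P_P, sub_self]

theorem isClosed_L (k : Fin d) : IsClosed (ε.L k : Set K) := by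
  have : (ε.L k : Set K) = {ξ | proj (ε.L k) ξ = ξ} := by
    ext ξ
    refine ⟨fun h => proj_eq_self h, fun h => ?_⟩
    rw [Set.mem_ofPred_eq, ε.proj_L] at h
    exact ε.mem_L.2 ⟨_, h⟩
  rw [this]
  exact isClosed_eq (proj _).continuous continuous_id

theorem isOrtho_L_L {j k : Fin d} (h : j ≠ k) : ε.L j ⟂ ε.L k := by
  rw [Submodule.isOrtho_iff_inner_eq]
  intro ξ hξ η hη
  obtain ⟨x, rfl⟩ := ε.mem_L.1 hξ
  obtain ⟨y, rfl⟩ := ε.mem_L.1 hη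
  rw [ε.iH.inner_map_map, U.inner_P, U.P_P_of_ne h, inner_zero_right]

theorem sum_iH_P (h : H) : ∑ k, ε.iH (U.P k h) = ε.iH h := by
  rw [← map_sum, U.sum_P]

/-- `L k` is the balanced summand at the boundary point `0`. Hence states are orthogonal to `U^n F`
in degrees `≥ 0` and to `U^n F_*` in negative degrees. -/
theorem L_le_V (k : Fin d) : ε.L k ≤ 𝔖.V (balanced d) := by
  rw [ε.orthDecomp.2]
  refine le_trans ?_ (Submodule.le_topologicalClosure _)
  have := le_iSup (fun i : BoundaryIndex (balanced d) => 𝔖.summand ε.L ε.M ε.Ms i)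
    (.fin k 0 (mem_finBoundary_balanced (by simp) k))
  rwa [ScatteringSystem.summand, 𝔖.translate_zero] at this

theorem iH_mem_V (h : H) : ε.iH h ∈ 𝔖.V (balanced d) := by
  rw [← ε.sum_iH_P h]
  exact sum_mem fun k _ => ε.L_le_V k (ε.iH_P_mem_L k h)

theorem inner_iE_iH {n : Lattice d} (hn : 0 ≤ ∑ k, n k) (e : E) (h : H) :
    inner ℂ (evolPow 𝔖.evol n (ε.iE e)) (ε.iH h) = 0 := by
  refine (Submodule.mem_orthogonal _ _).1 (ε.iH_mem_V h) _ (Submodule.mem_sup_left ?_)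
  refine Submodule.le_topologicalClosure _ ?_
  exact Submodule.mem_iSup_of_mem n (Submodule.mem_iSup_of_mem hn
    (𝔖.apply_mem_translate (ε.iE_mem e)))

theorem inner_iEs_iH {n : Lattice d} (hn : ∑ k, n k < 0) (e : Es) (h : H) :
    inner ℂ (evolPow 𝔖.evol n (ε.iEs e)) (ε.iH h) = 0 := by
  refine (Submodule.mem_orthogonal _ _).1 (ε.iH_mem_V h) _ (Submodule.mem_sup_right ?_)
  refine Submodule.le_topologicalClosure _ ?_
  exact Submodule.mem_iSup_of_mem n (Submodule.mem_iSup_of_mem (by simpa [balanced] using hn)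
    (𝔖.apply_mem_translate (ε.iEs_mem e)))

/-- These are two different summands of the balanced decomposition. -/
theorem inner_iH_P_iH_P {m : Lattice d} (hm : ∑ k, m k = 0) {j k : Fin d} (hne : m ≠ 0 ∨ k ≠ j)
    (h h' : H) : inner ℂ (ε.iH (U.P k h)) (evolPow 𝔖.evol m (ε.iH (U.P j h'))) = 0 := by
  have := ε.orthDecomp.1 (.fin k 0 (mem_finBoundary_balanced (by simp) k))
    (.fin j m (mem_finBoundary_balanced hm j)) (by
      intro heq
      injection heq with h1 h2
      rcases hne with hne | hne
      · exact hne h2.symm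
      · exact hne h1)
  simp only [ScatteringSystem.summand] at this
  rw [𝔖.translate_isOrtho_translate] at this
  simpa using this _ (ε.iH_P_mem_L k h) _ (ε.iH_P_mem_L j h')

/-- The system equations of the colligation, inside the scattering system. -/
theorem iH_add_iE (h : H) (e : E) :
    ε.iH h + ε.iE e = ε.iEs (U.C h + U.D e) +
      ∑ k, evolPow 𝔖.evol (stdVec k) (ε.iH (U.P k (U.A h + U.B e))) := by
  have hx : ε.iH h + ε.iE e ∈ (⨆ k, ε.L k) ⊔ 𝔖.F := by
    refine add_mem (Submodule.mem_sup_left ?_) (Submodule.mem_sup_right (ε.iE_mem e))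
    rw [← ε.sum_iH_P h]
    exact sum_mem fun k _ => Submodule.mem_iSup_of_mem k (ε.iH_P_mem_L k h)
  -- The decomposition on the other side supplies an unknown `F_*` component and unknown `U_k L k`
  -- components; orthogonality then identifies them.
  rw [ε.cdp_eq] at hx
  obtain ⟨f, hf, w, hw, hfw⟩ := Submodule.mem_sup.1 hx
  obtain ⟨y, hy⟩ := (Submodule.mem_iSup_iff_exists_finsupp _ _).1 hw
  rw [← ε.range_iEs] at hf
  obtain ⟨es, rfl⟩ := hf
  obtain ⟨hy, hyw⟩ := hy
  have hy' : ∀ k, ∃ x, y k = evolPow 𝔖.evol (stdVec k) (ε.iH (U.P k x)) := by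
    intro k
    have := hy k
    rw [𝔖.image_evol] at this
    obtain ⟨η, hη, hη'⟩ := this
    obtain ⟨x, rfl⟩ := ε.mem_L.1 hη
    exact ⟨x, hη'.symm⟩
  choose x hx using hy'
  rw [Finsupp.sum_fintype _ _ (fun _ => rfl)] at hyw
  have hsum : ε.iH h + ε.iE e =
      ε.iEs es + ∑ k, evolPow 𝔖.evol (stdVec k) (ε.iH (U.P k (x k))) := by
    rw [← hfw, ← hyw]
    simp only [hx]
    rfl
  have hFs : ∀ k z (v : Es), inner ℂ (ε.iEs v)
      (evolPow 𝔖.evol (stdVec k) (ε.iH (U.P k z))) = 0 := fun k z v => by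
    have := ε.cdp_right k
    rw [𝔖.image_evol, Submodule.isOrtho_iff_inner_eq] at this
    exact this _ (ε.iEs_mem v) _ (𝔖.apply_mem_translate (ε.iH_P_mem_L k z))
  have hes : es = U.C h + U.D e := by
    rw [ε.C_eq, ε.D_eq, ← map_add, hsum, map_add, ε.iEs_adjoint_iEs, map_sum,
      Finset.sum_eq_zero fun k _ => ε.iEs_adjoint_eq_zero fun v => hFs k _ v, add_zero]
  have horth : ∀ (j : Fin d) (η : K),
      (∀ z, inner ℂ (evolPow 𝔖.evol (stdVec j) (ε.iH (U.P j z))) η = 0) →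
      U.P j ((ε.iH.toContinuousLinearMap†) ((𝔖.evol j)⁻¹ η)) = 0 := fun j η hη =>
    ext_inner_left ℂ fun v => by
      rw [inner_zero_right, ← U.inner_P, ContinuousLinearMap.adjoint_inner_right,
        inv_apply_eq_evolPow 𝔖.evol_comm, inner_evolPow_right 𝔖.evol_comm, neg_neg]
      exact hη v
  -- Applying `P_j i_H^* U_j^*` gives the compression defining `A` and `B` on the left, and by
  -- orthogonality only the `j`-th term survives on the right.
  have hP : ∀ j, U.P j (x j) = U.P j (U.A h + U.B e) := fun j => by
    rw [map_add, ε.A_eq, ε.B_eq, ← map_add, ← map_add, ← map_add, hsum, map_add, map_add, map_add,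
      horth j (ε.iEs es), zero_add, map_sum, map_sum, map_sum, Finset.sum_eq_single j]
    · rw [inv_apply_eq_evolPow 𝔖.evol_comm, evolPow_neg_apply_self 𝔖.evol_comm, ε.iH_adjoint_iH,
        U.P_P]
    · intro k _ hkj
      refine horth j _ fun z => ?_
      have := ε.cdp_shift j k hkj.symm
      rw [𝔖.image_evol, 𝔖.image_evol, Submodule.isOrtho_iff_inner_eq] at this
      exact this _ (𝔖.apply_mem_translate (ε.iH_P_mem_L j z)) _
        (𝔖.apply_mem_translate (ε.iH_P_mem_L k _))
    · simp
    · intro z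
      rw [← inner_conj_symm, hFs, map_zero]
  rw [hsum, hes]
  simp only [hP]

/-- The adjoint system equations of the colligation, inside the scattering system. -/
theorem evolPow_stdVec_iH_P (k : Fin d) (h : H) :
    evolPow 𝔖.evol (stdVec k) (ε.iH (U.P k h)) =
      ε.iH ((U.A†) (U.P k h)) + ε.iE ((U.B†) (U.P k h)) := by
  -- The system equations at state `A^* P_k h` and input `B^* P_k h` have output `0` and next state
  -- `P_k h`.
  rw [ε.iH_add_iE, U.C_adjoint_add_D_adjoint, U.A_adjoint_add_B_adjoint, map_zero, zero_add,
    Finset.sum_eq_single k, U.P_P]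
  · intro j _ hjk
    rw [U.P_P_of_ne hjk, map_zero, map_zero]
  · simp

/-- The operator `i_{E_*}^* U^{-n}`. -/
noncomputable def coeffEs (n : Lattice d) : K →L[ℂ] Es :=
  (ε.iEs.toContinuousLinearMap†) ∘L
    ((evolPow 𝔖.evol (-n)).toContinuousLinearEquiv : K →L[ℂ] K)

/-- The operator `i_E^* U^{-n}`. -/
noncomputable def coeffE (n : Lattice d) : K →L[ℂ] E :=
  (ε.iE.toContinuousLinearMap†) ∘L
    ((evolPow 𝔖.evol (-n)).toContinuousLinearEquiv : K →L[ℂ] K)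

theorem coeffEs_apply (n : Lattice d) (ξ : K) :
    ε.coeffEs n ξ = (ε.iEs.toContinuousLinearMap†) (evolPow 𝔖.evol (-n) ξ) := rfl

theorem coeffE_apply (n : Lattice d) (ξ : K) :
    ε.coeffE n ξ = (ε.iE.toContinuousLinearMap†) (evolPow 𝔖.evol (-n) ξ) := rfl

theorem inner_coeffEs (n : Lattice d) (v : Es) (ξ : K) :
    inner ℂ v (ε.coeffEs n ξ) = inner ℂ (evolPow 𝔖.evol n (ε.iEs v)) ξ := by
  rw [coeffEs_apply, ContinuousLinearMap.adjoint_inner_right, inner_evolPow_left 𝔖.evol_comm]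
  rfl

theorem inner_coeffE (n : Lattice d) (v : E) (ξ : K) :
    inner ℂ v (ε.coeffE n ξ) = inner ℂ (evolPow 𝔖.evol n (ε.iE v)) ξ := by
  rw [coeffE_apply, ContinuousLinearMap.adjoint_inner_right, inner_evolPow_left 𝔖.evol_comm]
  rfl

theorem coeffEs_evolPow (n m : Lattice d) (ξ : K) :
    ε.coeffEs n (evolPow 𝔖.evol m ξ) = ε.coeffEs (n - m) ξ := by
  rw [coeffEs_apply, coeffEs_apply, ← evolPow_add_apply 𝔖.evol_comm, neg_sub, neg_add_eq_sub]

theorem coeffE_evolPow (n m : Lattice d) (ξ : K) :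
    ε.coeffE n (evolPow 𝔖.evol m ξ) = ε.coeffE (n - m) ξ := by
  rw [coeffE_apply, coeffE_apply, ← evolPow_add_apply 𝔖.evol_comm, neg_sub, neg_add_eq_sub]

theorem coeffEs_iEs (n : Lattice d) (v : Es) : ε.coeffEs n (ε.iEs v) = if n = 0 then v else 0 := by
  split_ifs with h
  · rw [coeffEs_apply, h, neg_zero, evolPow_zero_apply, ε.iEs_adjoint_iEs]
  · refine ext_inner_left ℂ fun w => ?_
    rw [inner_coeffEs, inner_zero_right]
    have := 𝔖.isOrtho_Fs_Fs h
    rw [Submodule.isOrtho_iff_inner_eq] at this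
    have := this _ (𝔖.apply_mem_translate (ε.iEs_mem w)) _ (𝔖.apply_mem_translate (ε.iEs_mem v))
    rwa [evolPow_zero_apply] at this

theorem coeffE_iE (n : Lattice d) (v : E) : ε.coeffE n (ε.iE v) = if n = 0 then v else 0 := by
  split_ifs with h
  · rw [coeffE_apply, h, neg_zero, evolPow_zero_apply, ε.iE_adjoint_iE]
  · refine ext_inner_left ℂ fun w => ?_
    rw [inner_coeffE, inner_zero_right]
    have := 𝔖.isOrtho_F_F h
    rw [Submodule.isOrtho_iff_inner_eq] at this
    have := this _ (𝔖.apply_mem_translate (ε.iE_mem w)) _ (𝔖.apply_mem_translate (ε.iE_mem v))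
    rwa [evolPow_zero_apply] at this

theorem coeffEs_iH_of_neg {n : Lattice d} (hn : ∑ k, n k < 0) (h : H) :
    ε.coeffEs n (ε.iH h) = 0 :=
  ext_inner_left ℂ fun v => by rw [inner_coeffEs, ε.inner_iEs_iH hn, inner_zero_right]

theorem coeffE_iH_of_nonneg {n : Lattice d} (hn : 0 ≤ ∑ k, n k) (h : H) :
    ε.coeffE n (ε.iH h) = 0 :=
  ext_inner_left ℂ fun v => by rw [inner_coeffE, ε.inner_iE_iH hn, inner_zero_right]

theorem coeffEs_iH_add_iE (n : Lattice d) (h : H) (e : E) :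
    ε.coeffEs n (ε.iH h + ε.iE e) = (if n = 0 then U.C h + U.D e else 0) +
      ∑ k, ε.coeffEs (n - stdVec k) (ε.iH (U.P k (U.A h + U.B e))) := by
  rw [ε.iH_add_iE, map_add, map_sum, coeffEs_iEs]
  simp only [coeffEs_evolPow]

/-- Applying `i_{E_*}^* U^{-n}` to the system equations with zero input gives the recursion of `C (I
- Z(z) A)^{-1}`; negative degrees vanish because states lie in the balanced scattering subspace. -/
theorem coeffEs_iH (n : Lattice d) (h : H) :
    ε.coeffEs n (ε.iH h) = U.C (resolventCoeff U.P U.A n h) := by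
  have := eq_comp_resolventCoeff U.P U.A U.C
    (fun n => ε.coeffEs n ∘L ε.iH.toContinuousLinearMap)
    (fun n hn => ContinuousLinearMap.ext fun h => ε.coeffEs_iH_of_neg hn h)
    (fun n => ContinuousLinearMap.ext fun h => by
      have := ε.coeffEs_iH_add_iE n h 0
      simp only [map_zero, add_zero] at this
      simp only [_root_.add_apply, _root_.sum_apply,
        ContinuousLinearMap.comp_apply, LinearIsometry.coe_toContinuousLinearMap]
      rw [this]
      split_ifs <;> rfl) n
  exact DFunLike.congr_fun this h

theorem coeffE_iH_P (n : Lattice d) (k : Fin d) (h : H) :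
    ε.coeffE n (ε.iH (U.P k h)) =
      (U.B†) (resolventCoeff U.P (U.A†) (-n - stdVec k) (U.P k h)) := by
  -- The adjoint equation shifts by `stdVec k` on the `k`-th component of the state. The reindexing
  -- `m = -n - stdVec k`, done per component, gives one family obeying the recursion of `B^* (I -
  -- Z(z) A^*)^{-1}`.
  let g : Lattice d → H →L[ℂ] E := fun m =>
    ∑ k, ε.coeffE (-m - stdVec k) ∘L ε.iH.toContinuousLinearMap ∘L U.P k
  have hg : ∀ m h, g m h = ∑ k, ε.coeffE (-m - stdVec k) (ε.iH (U.P k h)) := fun m h => by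
    simp [g]
  have hgP : ∀ m k h, g m (U.P k h) = ε.coeffE (-m - stdVec k) (ε.iH (U.P k h)) :=
    fun m k h => by
      rw [hg, Finset.sum_eq_single k, U.P_P]
      · intro j _ hjk
        rw [U.P_P_of_ne hjk, map_zero, map_zero]
      · simp
  have := eq_comp_resolventCoeff U.P (U.A†) (U.B†) g
    (fun m hm => ContinuousLinearMap.ext fun h => by
      rw [hg, Finset.sum_eq_zero fun k _ => ε.coeffE_iH_of_nonneg ?_ _]
      · rfl
      · rw [sum_sub_stdVec]
        simp only [Pi.neg_apply, Finset.sum_neg_distrib]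
        omega)
    (fun m => ContinuousLinearMap.ext fun h => by
      simp only [_root_.add_apply, _root_.sum_apply,
        ContinuousLinearMap.comp_apply, hgP]
      have h1 : ∀ k, ε.coeffE (-m - stdVec k) (ε.iH (U.P k h)) =
          ε.coeffE (-m) (ε.iH ((U.A†) (U.P k h)) + ε.iE ((U.B†) (U.P k h))) := fun k => by
        rw [← ε.evolPow_stdVec_iH_P, coeffE_evolPow]
      rw [hg]
      simp only [h1]
      rw [← map_sum, Finset.sum_add_distrib, ← map_sum, ← map_sum, ← map_sum, ← map_sum, U.sum_P,
        map_add, coeffE_iE, add_comm]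
      congr 1
      · simp only [neg_eq_zero]
        split_ifs <;> rfl
      · conv_lhs => rw [← ε.sum_iH_P ((U.A†) h), map_sum]
        refine Finset.sum_congr rfl fun k _ => ?_
        congr 1
        abel_nf) (-n - stdVec k)
  have := DFunLike.congr_fun this (U.P k h)
  rw [hgP] at this
  rw [← ContinuousLinearMap.comp_apply, ← this]
  congr 2
  abel

/-- One system step from state `0` gives the term `D` and the states `P_k B e`, whose coefficients
are already known. -/
theorem coeffEs_iE (n : Lattice d) (e : E) : ε.coeffEs n (ε.iE e) = U.transfer n e := by
  have := ε.coeffEs_iH_add_iE n 0 e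
  simp only [map_zero, zero_add] at this
  rw [this, Colligation.transfer]
  simp only [coeffEs_iH, _root_.add_apply, _root_.sum_apply,
    ContinuousLinearMap.comp_apply]
  split_ifs <;> rfl

theorem coeffE_iEs (n : Lattice d) (e : Es) :
    ε.coeffE n (ε.iEs e) = (U.transfer (-n)†) e :=
  ext_inner_left ℂ fun v => by
    rw [inner_coeffE, ContinuousLinearMap.adjoint_inner_right, ← ε.coeffEs_iE,
      ← inner_conj_symm _ e, inner_coeffEs, inner_conj_symm,
      inner_evolPow_left 𝔖.evol_comm, inner_evolPow_right 𝔖.evol_comm, neg_neg,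
      inner_evolPow_left 𝔖.evol_comm]

end Embedding

/-! ### Degrees of multiples of a basis vector, and weak operator convergence -/

theorem sum_smul_stdVec {d : ℕ} (k : Fin d) (t : ℤ) :
    ∑ j, (t • (stdVec k : Lattice d)) j = t := by
  simp [stdVec, ← Finset.mul_sum]

/-- A pointwise convergent series of operators converges in the weak operator topology. -/
theorem hasSum_ofCLM {ι E F : Type*} [NormedAddCommGroup E] [InnerProductSpace ℂ E]
    [NormedAddCommGroup F] [InnerProductSpace ℂ F] [CompleteSpace F] {f : ι → E →L[ℂ] F}
    {T : E →L[ℂ] F} (h : ∀ x, HasSum (fun i => f i x) (T x)) :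
    HasSum (fun i => ContinuousLinearMapWOT.ofCLM (f i)) (ContinuousLinearMapWOT.ofCLM T) := by
  refine ContinuousLinearMapWOT.tendsto_iff_forall_inner_apply_tendsto.2 fun x y => ?_
  have hs : ∀ s : Finset ι, (∑ i ∈ s, ContinuousLinearMapWOT.ofCLM (f i)) x =
      ∑ i ∈ s, f i x := fun s => by
    have : ∑ i ∈ s, ContinuousLinearMapWOT.ofCLM (f i) =
        ContinuousLinearMapWOT.ofCLM (∑ i ∈ s, f i) :=
      (map_sum (ContinuousLinearMapWOT.addEquiv (σ := RingHom.id ℂ) (E := E) (F := F)).symm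
        f s).symm
    rw [this, ContinuousLinearMapWOT.ofCLM_apply, _root_.sum_apply]
  simp only [hs]
  exact (innerSL ℂ y).continuous.continuousAt.tendsto.comp (h x)

theorem tendsto_ofCLM {ι E F : Type*} [NormedAddCommGroup E] [InnerProductSpace ℂ E]
    [NormedAddCommGroup F] [InnerProductSpace ℂ F] [CompleteSpace F] {f : ι → E →L[ℂ] F}
    {l : Filter ι} {T : E →L[ℂ] F} (h : ∀ x, Tendsto (fun i => f i x) l (𝓝 (T x))) :
    Tendsto (fun i => ContinuousLinearMapWOT.ofCLM (f i)) l (𝓝 (ContinuousLinearMapWOT.ofCLM T)) :=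
  ContinuousLinearMapWOT.tendsto_iff_forall_inner_apply_tendsto.2 fun x y =>
    (innerSL ℂ y).continuous.continuousAt.tendsto.comp (h x)

/-! ### Projections onto the outgoing, incoming and scattering subspaces -/

namespace ScatteringSystem

variable {d : ℕ} {K : Type*} [NormedAddCommGroup K] [InnerProductSpace ℂ K] [CompleteSpace K]
  (𝔖 : ScatteringSystem d K)

theorem hasSum_proj_W (Ω : Set (Lattice d)) (ξ : K) :
    HasSum (fun l : Ω => proj (𝔖.translate l 𝔖.F) ξ) (proj (𝔖.W Ω) ξ) := by
  have := hasSum_proj (χ := fun l : Ω => 𝔖.translate l 𝔖.F)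
    (fun l => 𝔖.isClosed_translate 𝔖.isClosed_F)
    (fun i j hij => 𝔖.isOrtho_F_F fun h => hij (Subtype.ext h)) ξ
  rwa [iSup_subtype (p := (· ∈ Ω)) (f := fun l => 𝔖.translate l.1 𝔖.F)] at this

theorem hasSum_proj_Ws (Ω : Set (Lattice d)) (ξ : K) :
    HasSum (fun l : ↥(Ωᶜ) => proj (𝔖.translate l 𝔖.Fs) ξ) (proj (𝔖.Ws Ω) ξ) := by
  have := hasSum_proj (χ := fun l : ↥(Ωᶜ) => 𝔖.translate l 𝔖.Fs)
    (fun l => 𝔖.isClosed_translate 𝔖.isClosed_Fs)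
    (fun i j hij => 𝔖.isOrtho_Fs_Fs fun h => hij (Subtype.ext h)) ξ
  rwa [iSup_subtype (p := (· ∈ Ωᶜ)) (f := fun l => 𝔖.translate l.1 𝔖.Fs)] at this

theorem translate_F_le_W {Ω : Set (Lattice d)} {n : Lattice d} (hn : n ∈ Ω) :
    𝔖.translate n 𝔖.F ≤ 𝔖.W Ω :=
  (le_iSup₂ (f := fun n _ => 𝔖.translate n 𝔖.F) n hn).trans (Submodule.le_topologicalClosure _)

theorem translate_Fs_le_Ws {Ω : Set (Lattice d)} {n : Lattice d} (hn : n ∉ Ω) :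
    𝔖.translate n 𝔖.Fs ≤ 𝔖.Ws Ω :=
  (le_iSup₂ (f := fun n (_ : n ∈ Ωᶜ) => 𝔖.translate n 𝔖.Fs) n hn).trans
    (Submodule.le_topologicalClosure _)

theorem W_le {Ω : Set (Lattice d)} {X : Submodule ℂ K} (hX : IsClosed (X : Set K))
    (h : ∀ n ∈ Ω, 𝔖.translate n 𝔖.F ≤ X) : 𝔖.W Ω ≤ X :=
  Submodule.topologicalClosure_minimal _ (iSup₂_le h) hX

theorem Ws_le {Ω : Set (Lattice d)} {X : Submodule ℂ K} (hX : IsClosed (X : Set K))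
    (h : ∀ n ∉ Ω, 𝔖.translate n 𝔖.Fs ≤ X) : 𝔖.Ws Ω ≤ X :=
  Submodule.topologicalClosure_minimal _ (iSup₂_le h) hX

theorem isClosed_W (Ω : Set (Lattice d)) : IsClosed (𝔖.W Ω : Set K) :=
  Submodule.isClosed_topologicalClosure _

theorem isClosed_Ws (Ω : Set (Lattice d)) : IsClosed (𝔖.Ws Ω : Set K) :=
  Submodule.isClosed_topologicalClosure _

theorem isClosed_V (Ω : Set (Lattice d)) : IsClosed (𝔖.V Ω : Set K) :=
  Submodule.isClosed_orthogonal _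

theorem isClosed_scatMin : IsClosed (𝔖.scatMin : Set K) :=
  Submodule.isClosed_topologicalClosure _

theorem orthogonal_orthogonal_scatMin : 𝔖.scatMinᗮᗮ = 𝔖.scatMin := by
  have : CompleteSpace 𝔖.scatMin := 𝔖.isClosed_scatMin.completeSpace_coe
  exact Submodule.orthogonal_orthogonal _

variable {Ω : Set (Lattice d)}

/-- As `Ω` is upward closed, `n ∈ Ω` and `m ∉ Ω` exclude `n ≤ m`, and causality applies. -/
theorem isOrtho_W_Ws (hΩ : ShiftInvariant Ω) : 𝔖.W Ω ⟂ 𝔖.Ws Ω := by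
  refine 𝔖.W_le (Submodule.isClosed_orthogonal _) fun n hn => ?_
  refine Submodule.IsOrtho.symm ?_
  refine 𝔖.Ws_le (Submodule.isClosed_orthogonal _) fun m hm => ?_
  exact (𝔖.isOrtho_F_Fs fun h => hm (hΩ.mem_of_le hn h)).symm

theorem sup_W_Ws_le_scatMin (Ω : Set (Lattice d)) : 𝔖.W Ω ⊔ 𝔖.Ws Ω ≤ 𝔖.scatMin := by
  refine le_trans (sup_le_sup ?_ ?_) (Submodule.le_topologicalClosure _)
  · exact 𝔖.W_le (𝔖.isClosed_W _) fun n _ => 𝔖.translate_F_le_W (Set.mem_univ n)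
  · exact 𝔖.Ws_le (𝔖.isClosed_Ws _) fun n _ => 𝔖.translate_Fs_le_Ws (Set.notMem_empty n)

/-- This makes the first half of condition (b) automatic. -/
theorem orthogonal_scatMin_le_V (Ω : Set (Lattice d)) : 𝔖.scatMinᗮ ≤ 𝔖.V Ω :=
  Submodule.orthogonal_le (𝔖.sup_W_Ws_le_scatMin Ω)

theorem proj_V (hΩ : ShiftInvariant Ω) (ξ : K) :
    proj (𝔖.V Ω) ξ = ξ - proj (𝔖.W Ω) ξ - proj (𝔖.Ws Ω) ξ := by
  have hW := proj_mem (𝔖.isClosed_W Ω) ξ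
  have hWs := proj_mem (𝔖.isClosed_Ws Ω) ξ
  have hO := 𝔖.isOrtho_W_Ws hΩ
  refine proj_eq ?_ ?_
  · rw [V, ← Submodule.inf_orthogonal]
    refine ⟨sub_mem (sub_proj_mem ξ) (hO.symm hWs), ?_⟩
    rw [sub_right_comm]
    exact sub_mem (sub_proj_mem ξ) (hO hW)
  · refine Submodule.le_orthogonal_orthogonal _ ?_
    rw [sub_sub, sub_sub_cancel]
    exact add_mem (Submodule.mem_sup_left hW) (Submodule.mem_sup_right hWs)

theorem proj_W_of_mem {n : Lattice d} (hn : n ∈ Ω) {ξ : K} (hξ : ξ ∈ 𝔖.translate n 𝔖.F) :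
    proj (𝔖.W Ω) ξ = ξ := proj_eq_self (𝔖.translate_F_le_W hn hξ)

theorem proj_W_of_notMem {n : Lattice d} (hn : n ∉ Ω) {ξ : K} (hξ : ξ ∈ 𝔖.translate n 𝔖.F) :
    proj (𝔖.W Ω) ξ = 0 := by
  refine proj_eq_zero_of_isOrtho (𝔖.W_le (Submodule.isClosed_orthogonal _) fun m hm => ?_) hξ
  exact 𝔖.isOrtho_F_F fun h => hn (h ▸ hm)

theorem proj_Ws_of_notMem {n : Lattice d} (hn : n ∉ Ω) {ξ : K} (hξ : ξ ∈ 𝔖.translate n 𝔖.Fs) :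
    proj (𝔖.Ws Ω) ξ = ξ := proj_eq_self (𝔖.translate_Fs_le_Ws hn hξ)

theorem proj_Ws_of_mem {n : Lattice d} (hn : n ∈ Ω) {ξ : K} (hξ : ξ ∈ 𝔖.translate n 𝔖.Fs) :
    proj (𝔖.Ws Ω) ξ = 0 := by
  refine proj_eq_zero_of_isOrtho (𝔖.Ws_le (Submodule.isClosed_orthogonal _) fun m hm => ?_) hξ
  exact 𝔖.isOrtho_Fs_Fs fun h => hm (h ▸ hn)

end ScatteringSystem

/-! ### The kernels of the statement as kernels of projections -/

namespace Embedding

variable {d : ℕ} {K H E Es : Type*}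
  [NormedAddCommGroup K] [InnerProductSpace ℂ K] [CompleteSpace K]
  [NormedAddCommGroup H] [InnerProductSpace ℂ H] [CompleteSpace H]
  [NormedAddCommGroup E] [InnerProductSpace ℂ E] [CompleteSpace E]
  [NormedAddCommGroup Es] [InnerProductSpace ℂ Es] [CompleteSpace Es]
  {U : Colligation d H E Es} {𝔖 : ScatteringSystem d K} (ε : Embedding U 𝔖)

/-- The coefficient of `z^n` of the de Branges-Rovnyak map. -/
noncomputable def evalCLM (n : Lattice d) : K →L[ℂ] WithLp 2 (Es × E) :=
  column (ε.coeffEs n) (ε.coeffE n)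

theorem evalCLM_apply (n : Lattice d) (ξ : K) :
    ε.evalCLM n ξ = WithLp.toLp 2 (ε.coeffEs n ξ, ε.coeffE n ξ) := rfl

theorem dBR_eq : ε.dBR = fun ξ n => ε.evalCLM n ξ := by
  funext ξ n
  rw [evalCLM_apply, coeffEs_apply, coeffE_apply, dBR, evolPow_inv_apply 𝔖.evol_comm]

theorem evalCLM_evolPow (n m : Lattice d) (ξ : K) :
    ε.evalCLM n (evolPow 𝔖.evol m ξ) = ε.evalCLM (n - m) ξ := by
  rw [evalCLM_apply, evalCLM_apply, coeffEs_evolPow, coeffE_evolPow]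

theorem evalCLM_iH_P (n : Lattice d) (k : Fin d) (h : H) :
    ε.evalCLM n (ε.iH (U.P k h)) = U.aglerFactor k n h := by
  rw [evalCLM_apply, coeffEs_iH, coeffE_iH_P]
  rfl

theorem adjoint_evalCLM (n : Lattice d) (v : WithLp 2 (Es × E)) :
    ((ε.evalCLM n)†) v = evolPow 𝔖.evol n (ε.iEs v.fst + ε.iE v.snd) :=
  ext_inner_right ℂ fun ξ => by
    rw [ContinuousLinearMap.adjoint_inner_left, evalCLM_apply, WithLp.prod_inner_apply, map_add,
      inner_add_left, inner_coeffEs, inner_coeffE]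
    rfl

theorem projKernel_apply (X : Submodule ℂ K) (n m : Lattice d) (v : WithLp 2 (Es × E)) :
    projKernel ε.evalCLM X n m v =
      ε.evalCLM n (proj X (evolPow 𝔖.evol m (ε.iEs v.fst + ε.iE v.snd))) := by
  rw [← adjoint_evalCLM]; rfl

/-- The coefficients of `H_k(z)` are `ev n ∘ i_H ∘ P_k`, and `i_H P_k i_H^*` is the projection onto
`L k`. -/
theorem aglerKernel_eq (k : Fin d) : U.aglerKernel k = projKernel ε.evalCLM (ε.L k) := by
  have h1 : ∀ n, U.aglerFactor k n = ε.evalCLM n ∘L ε.iH.toContinuousLinearMap ∘L U.P k :=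
    fun n => ContinuousLinearMap.ext fun h => (ε.evalCLM_iH_P n k h).symm
  ext1 n m
  refine ContinuousLinearMap.ext fun v => ?_
  simp only [Colligation.aglerKernel, projKernel, Matrix.of_apply, h1,
    ContinuousLinearMap.adjoint_comp, ContinuousLinearMap.comp_apply, U.P_selfAdjoint, U.P_P,
    proj_L]
  rfl

/-- Both sides conjugate the projection by `U^n`, since evaluation at `p` after `U^n` is evaluation
at `p - n`. -/
theorem shiftKernel_projKernel (n : Lattice d) {X : Submodule ℂ K} (hX : IsClosed (X : Set K)) :
    shiftKernel n (projKernel ε.evalCLM X) = projKernel ε.evalCLM (𝔖.translate n X) := by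
  ext1 p q
  refine ContinuousLinearMap.ext fun v => ?_
  simp only [shiftKernel, Matrix.of_apply, projKernel_apply, 𝔖.proj_translate hX,
    evalCLM_evolPow]
  rw [← evolPow_add_apply 𝔖.evol_comm, neg_add_eq_sub]

theorem aglerShiftE_apply (k : Fin d) (t : ℤ) (p q : Lattice d) (e : E) :
    U.aglerShiftE k t p q e =
      ε.coeffE p (proj (image (𝔖.evol k ^ t) (ε.L k)) (evolPow 𝔖.evol q (ε.iE e))) := by
  have : U.aglerShiftE k t p q e = coordE (shiftKernel (t • stdVec k) (U.aglerKernel k) p q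
    (column 0 (.id ℂ E) e)) := rfl
  rw [this, ε.aglerKernel_eq, shiftKernel_projKernel _ _ (ε.isClosed_L k), projKernel_apply,
    𝔖.image_evol_zpow]
  have h2 : ε.iEs (column (0 : E →L[ℂ] Es) (.id ℂ E) e).fst +
      ε.iE (column (0 : E →L[ℂ] Es) (.id ℂ E) e).snd = ε.iE e := by
    change ε.iEs 0 + ε.iE e = ε.iE e
    rw [map_zero, zero_add]
  rw [h2]
  rfl

theorem aglerShiftEs_apply (k : Fin d) (t : ℤ) (p q : Lattice d) (e : Es) :
    U.aglerShiftEs k t p q e =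
      ε.coeffEs p (proj (image (𝔖.evol k ^ t) (ε.L k)) (evolPow 𝔖.evol q (ε.iEs e))) := by
  have : U.aglerShiftEs k t p q e = coordEs (shiftKernel (t • stdVec k) (U.aglerKernel k) p q
    (column (.id ℂ Es) 0 e)) := rfl
  rw [this, ε.aglerKernel_eq, shiftKernel_projKernel _ _ (ε.isClosed_L k), projKernel_apply,
    𝔖.image_evol_zpow]
  have h2 : ε.iEs (column (.id ℂ Es) (0 : Es →L[ℂ] E) e).fst +
      ε.iE (column (.id ℂ Es) (0 : Es →L[ℂ] E) e).snd = ε.iEs e := by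
    change ε.iEs e + ε.iE 0 = ε.iEs e
    rw [map_zero, add_zero]
  rw [h2]
  rfl

theorem tendsto_aglerShiftE (k : Fin d) (p q : Lattice d) (e : E) :
    Tendsto (fun t : ℤ => U.aglerShiftE k t p q e) atTop
      (𝓝 (ε.coeffE p (proj (ε.M k) (evolPow 𝔖.evol q (ε.iE e))))) := by
  simp only [ε.aglerShiftE_apply]
  exact (ε.coeffE p).continuous.continuousAt.tendsto.comp (ε.slim k _)

theorem tendsto_aglerShiftEs (k : Fin d) (p q : Lattice d) (e : Es) :
    Tendsto (fun t : ℤ => U.aglerShiftEs k t p q e) atBot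
      (𝓝 (ε.coeffEs p (proj (ε.Ms k) (evolPow 𝔖.evol q (ε.iEs e))))) := by
  simp only [ε.aglerShiftEs_apply]
  exact (ε.coeffEs p).continuous.continuousAt.tendsto.comp (ε.slim_s k _)

theorem limitE_apply (k : Fin d) (p q : Lattice d) (e : E) :
    U.limitE k p q e = ε.coeffE p (proj (ε.M k) (evolPow 𝔖.evol q (ε.iE e))) := by
  -- The strong limit is written as a bounded operator so that `limUnder` can be evaluated.
  let T : E →L[ℂ] E := ε.coeffE p ∘L proj (ε.M k) ∘L
    ((evolPow 𝔖.evol q).toContinuousLinearEquiv : K →L[ℂ] K) ∘L ε.iE.toContinuousLinearMap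
  have h := tendsto_ofCLM (T := T) fun e => ε.tendsto_aglerShiftE k p q e
  rw [Colligation.limitE, h.limUnder_eq]
  rfl

theorem limitEs_apply (k : Fin d) (p q : Lattice d) (e : Es) :
    U.limitEs k p q e = ε.coeffEs p (proj (ε.Ms k) (evolPow 𝔖.evol q (ε.iEs e))) := by
  let T : Es →L[ℂ] Es := ε.coeffEs p ∘L proj (ε.Ms k) ∘L
    ((evolPow 𝔖.evol q).toContinuousLinearEquiv : K →L[ℂ] K) ∘L ε.iEs.toContinuousLinearMap
  have h := tendsto_ofCLM (T := T) fun e => ε.tendsto_aglerShiftEs k p q e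
  rw [Colligation.limitEs, h.limUnder_eq]
  rfl

theorem limitKernelsConverge (ε : Embedding U 𝔖) : U.LimitKernelsConverge := fun k p q =>
  ⟨fun e => by rw [ε.limitE_apply]; exact ε.tendsto_aglerShiftE k p q e,
    fun e => by rw [ε.limitEs_apply]; exact ε.tendsto_aglerShiftEs k p q e⟩

/-- On `U_k^t L k` this coefficient is one of degree `∑ j, p j - t` of a state, hence zero for large
`t`. Therefore only the `E`-diagonal block survives in the kernel of `M k`. -/
theorem coeffEs_proj_M (k : Fin d) (p : Lattice d) (ξ : K) :
    ε.coeffEs p (proj (ε.M k) ξ) = 0 := by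
  have h1 := (ε.coeffEs p).continuous.continuousAt.tendsto.comp (ε.slim k ξ)
  refine tendsto_nhds_unique_of_eventuallyEq h1 tendsto_const_nhds ?_
  filter_upwards [eventually_gt_atTop (∑ j, p j)] with t ht
  rw [Function.comp_apply, 𝔖.image_evol_zpow, 𝔖.proj_translate (ε.isClosed_L k), coeffEs_evolPow,
    ε.proj_L]
  refine ε.coeffEs_iH_of_neg ?_ _
  have := sum_smul_stdVec k t
  simp only [Pi.sub_apply, Finset.sum_sub_distrib, this]
  omega

theorem coeffE_proj_Ms (k : Fin d) (p : Lattice d) (ξ : K) :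
    ε.coeffE p (proj (ε.Ms k) ξ) = 0 := by
  have h1 := (ε.coeffE p).continuous.continuousAt.tendsto.comp (ε.slim_s k ξ)
  refine tendsto_nhds_unique_of_eventuallyEq h1 tendsto_const_nhds ?_
  filter_upwards [eventually_lt_atBot (∑ j, p j)] with t ht
  rw [Function.comp_apply, 𝔖.image_evol_zpow, 𝔖.proj_translate (ε.isClosed_L k), coeffE_evolPow,
    ε.proj_L]
  refine ε.coeffE_iH_of_nonneg ?_ _
  have := sum_smul_stdVec k t
  simp only [Pi.sub_apply, Finset.sum_sub_distrib, this]
  omega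

theorem proj_M_iEs (k : Fin d) (q : Lattice d) (v : Es) :
    proj (ε.M k) (evolPow 𝔖.evol q (ε.iEs v)) = 0 :=
  ext_inner_right ℂ fun ξ => by
    rw [inner_proj, ← inner_coeffEs, coeffEs_proj_M, inner_zero_right, inner_zero_left]

theorem proj_Ms_iE (k : Fin d) (q : Lattice d) (v : E) :
    proj (ε.Ms k) (evolPow 𝔖.evol q (ε.iE v)) = 0 :=
  ext_inner_right ℂ fun ξ => by
    rw [inner_proj, ← inner_coeffE, coeffE_proj_Ms, inner_zero_right, inner_zero_left]

theorem block_limitE (k : Fin d) :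
    (Matrix.of fun p q => block 0 0 0 (U.limitE k p q) : FormalKernel d E Es) =
      projKernel ε.evalCLM (ε.M k) := by
  ext1 p q
  refine ContinuousLinearMap.ext fun v => ?_
  rw [projKernel_apply, map_add, map_add, proj_M_iEs, zero_add, evalCLM_apply, coeffEs_proj_M,
    ← limitE_apply]
  change WithLp.toLp 2 ((0 : Es) + 0, (0 : E) + U.limitE k p q v.snd) = _
  simp

theorem block_limitEs (k : Fin d) :
    (Matrix.of fun p q => block (U.limitEs k p q) 0 0 0 : FormalKernel d E Es) =
      projKernel ε.evalCLM (ε.Ms k) := by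
  ext1 p q
  refine ContinuousLinearMap.ext fun v => ?_
  rw [projKernel_apply, map_add, map_add, proj_Ms_iE, add_zero, evalCLM_apply, coeffE_proj_Ms,
    ← limitEs_apply]
  change WithLp.toLp 2 (U.limitEs k p q v.fst + 0, (0 : E) + 0) = _
  simp

theorem isClosed_summand {Ω : Set (Lattice d)} (i : BoundaryIndex Ω) :
    IsClosed (ε.summand i : Set K) := by
  cases i with
  | fin k n h => exact 𝔖.isClosed_translate (ε.isClosed_L k)
  | posInf k n h => exact 𝔖.isClosed_translate (ε.isClosed_M k)
  | negInf k n h => exact 𝔖.isClosed_translate (ε.isClosed_Ms k)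

theorem summandKernel_eq {Ω : Set (Lattice d)} (i : BoundaryIndex Ω) :
    U.summandKernel i = projKernel ε.evalCLM (ε.summand i) := by
  cases i with
  | fin k n h =>
    rw [Colligation.summandKernel, ε.aglerKernel_eq, ε.shiftKernel_projKernel _ (ε.isClosed_L k)]
    rfl
  | posInf k n h =>
    rw [Colligation.summandKernel, ε.block_limitE, ε.shiftKernel_projKernel _ (ε.isClosed_M k)]
    rfl
  | negInf k n h =>
    rw [Colligation.summandKernel, ε.block_limitEs, ε.shiftKernel_projKernel _ (ε.isClosed_Ms k)]
    rfl

/-- The coefficients of `ξ` are its inner products with the translates of `F` and `F_*`, which span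
`𝔖.scatMin`. -/
theorem mem_orthogonal_scatMin {ξ : K} : ξ ∈ 𝔖.scatMinᗮ ↔ ∀ n, ε.evalCLM n ξ = 0 := by
  have hle : ∀ ξ n, ε.evalCLM n ξ = 0 ↔ ε.coeffEs n ξ = 0 ∧ ε.coeffE n ξ = 0 := fun ξ n => by
    rw [evalCLM_apply, WithLp.toLp_eq_zero, Prod.mk_eq_zero]
  simp only [hle]
  constructor
  · intro h n
    refine ⟨ext_inner_left ℂ fun v => ?_, ext_inner_left ℂ fun v => ?_⟩
    · rw [inner_coeffEs, inner_zero_right]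
      exact (Submodule.mem_orthogonal _ _).1 h _ (Submodule.le_topologicalClosure _
        (Submodule.mem_sup_right (𝔖.translate_Fs_le_Ws (Set.notMem_empty n)
          (𝔖.apply_mem_translate (ε.iEs_mem v)))))
    · rw [inner_coeffE, inner_zero_right]
      exact (Submodule.mem_orthogonal _ _).1 h _ (Submodule.le_topologicalClosure _
        (Submodule.mem_sup_left (𝔖.translate_F_le_W (Set.mem_univ n)
          (𝔖.apply_mem_translate (ε.iE_mem v)))))
  · intro h
    have hsub : 𝔖.scatMin ≤ (Submodule.span ℂ {ξ})ᗮ := by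
      refine Submodule.topologicalClosure_minimal _ (sup_le ?_ ?_)
        (Submodule.isClosed_orthogonal _)
      · refine 𝔖.W_le (Submodule.isClosed_orthogonal _) fun n _ => ?_
        rintro _ ⟨η, hη, rfl⟩
        rw [← ε.range_iE] at hη
        obtain ⟨v, rfl⟩ := hη
        refine (Submodule.mem_orthogonal_singleton_iff_inner_left).2 ?_
        exact (ε.inner_coeffE n v ξ).symm.trans (by rw [(h n).2, inner_zero_right])
      · refine 𝔖.Ws_le (Submodule.isClosed_orthogonal _) fun n _ => ?_
        rintro _ ⟨η, hη, rfl⟩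
        rw [← ε.range_iEs] at hη
        obtain ⟨v, rfl⟩ := hη
        refine (Submodule.mem_orthogonal_singleton_iff_inner_left).2 ?_
        exact (ε.inner_coeffEs n v ξ).symm.trans (by rw [(h n).1, inner_zero_right])
    exact (Submodule.mem_orthogonal _ _).2 fun η hη =>
      Submodule.mem_orthogonal_singleton_iff_inner_left.1 (hsub hη)

/-! ### The kernel of the scattering subspace -/

theorem proj_translate_F (n : Lattice d) (ξ : K) :
    proj (𝔖.translate n 𝔖.F) ξ = evolPow 𝔖.evol n (ε.iE (ε.coeffE n ξ)) := by
  rw [𝔖.proj_translate 𝔖.isClosed_F]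
  congr 1
  refine proj_eq (ε.iE_mem _) ((Submodule.mem_orthogonal _ _).2 fun η hη => ?_)
  rw [← ε.range_iE] at hη
  obtain ⟨v, rfl⟩ := hη
  have h1 : inner ℂ (ε.iE v) (ε.iE (ε.coeffE n ξ)) = inner ℂ v (ε.coeffE n ξ) :=
    ε.iE.inner_map_map _ _
  have h2 : inner ℂ (ε.iE v) (evolPow 𝔖.evol (-n) ξ) = inner ℂ v (ε.coeffE n ξ) := by
    rw [inner_coeffE, inner_evolPow_left 𝔖.evol_comm]
  change inner ℂ (ε.iE v) _ = 0
  rw [inner_sub_right, h1, h2, sub_self]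

theorem proj_translate_Fs (n : Lattice d) (ξ : K) :
    proj (𝔖.translate n 𝔖.Fs) ξ = evolPow 𝔖.evol n (ε.iEs (ε.coeffEs n ξ)) := by
  rw [𝔖.proj_translate 𝔖.isClosed_Fs]
  congr 1
  refine proj_eq (ε.iEs_mem _) ((Submodule.mem_orthogonal _ _).2 fun η hη => ?_)
  rw [← ε.range_iEs] at hη
  obtain ⟨v, rfl⟩ := hη
  have h1 : inner ℂ (ε.iEs v) (ε.iEs (ε.coeffEs n ξ)) = inner ℂ v (ε.coeffEs n ξ) :=
    ε.iEs.inner_map_map _ _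
  have h2 : inner ℂ (ε.iEs v) (evolPow 𝔖.evol (-n) ξ) = inner ℂ v (ε.coeffEs n ξ) := by
    rw [inner_coeffEs, inner_evolPow_left 𝔖.evol_comm]
  change inner ℂ (ε.iEs v) _ = 0
  rw [inner_sub_right, h1, h2, sub_self]

/-- The sum is the expansion of the projection onto `W Ω` over the wandering translates `U^l F`;
this is also why it converges. -/
theorem hasSum_transfer_W (Ω : Set (Lattice d)) (n m : Lattice d) (x : Es) :
    HasSum (fun l : Ω => (U.transfer (n - l) ∘L (U.transfer (m - l))†) x)
      (ε.coeffEs n (proj (𝔖.W Ω) (evolPow 𝔖.evol m (ε.iEs x)))) := by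
  have h := (ε.coeffEs n).hasSum (𝔖.hasSum_proj_W Ω (evolPow 𝔖.evol m (ε.iEs x)))
  convert h using 2 with l
  rw [ε.proj_translate_F, coeffEs_evolPow, coeffEs_iE, coeffE_evolPow, coeffE_iEs, neg_sub]
  rfl

theorem hasSum_transfer_Ws (Ω : Set (Lattice d)) (n m : Lattice d) (x : E) :
    HasSum (fun l : ↥(Ωᶜ) => ((U.transfer (l - n))† ∘L U.transfer (l - m)) x)
      (ε.coeffE n (proj (𝔖.Ws Ω) (evolPow 𝔖.evol m (ε.iE x)))) := by
  have h := (ε.coeffE n).hasSum (𝔖.hasSum_proj_Ws Ω (evolPow 𝔖.evol m (ε.iE x)))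
  convert h using 2 with l
  rw [ε.proj_translate_Fs, coeffE_evolPow, coeffE_iEs, coeffEs_evolPow, coeffEs_iE, neg_sub]
  rfl

theorem hasSum_ofCLM_transfer_W (Ω : Set (Lattice d)) (n m : Lattice d) :
    HasSum (fun l : Ω => ContinuousLinearMapWOT.ofCLM
        (U.transfer (n - l) ∘L (U.transfer (m - l))†))
      (ContinuousLinearMapWOT.ofCLM (ε.coeffEs n ∘L proj (𝔖.W Ω) ∘L
        ((evolPow 𝔖.evol m).toContinuousLinearEquiv : K →L[ℂ] K) ∘L
          ε.iEs.toContinuousLinearMap)) :=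
  hasSum_ofCLM fun x => ε.hasSum_transfer_W Ω n m x

theorem hasSum_ofCLM_transfer_Ws (Ω : Set (Lattice d)) (n m : Lattice d) :
    HasSum (fun l : ↥(Ωᶜ) => ContinuousLinearMapWOT.ofCLM
        ((U.transfer (l - n))† ∘L U.transfer (l - m)))
      (ContinuousLinearMapWOT.ofCLM (ε.coeffE n ∘L proj (𝔖.Ws Ω) ∘L
        ((evolPow 𝔖.evol m).toContinuousLinearEquiv : K →L[ℂ] K) ∘L
          ε.iE.toContinuousLinearMap)) :=
  hasSum_ofCLM fun x => ε.hasSum_transfer_Ws Ω n m x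

theorem scatteringKernelConverges (ε : Embedding U 𝔖) (Ω : Set (Lattice d)) : U.ScatteringKernelConverges Ω :=
  fun n m => ⟨(ε.hasSum_ofCLM_transfer_W Ω n m).summable,
    (ε.hasSum_ofCLM_transfer_Ws Ω n m).summable⟩

open Classical in
theorem coeffE_proj_W (Ω : Set (Lattice d)) (n : Lattice d) (ξ : K) :
    ε.coeffE n (proj (𝔖.W Ω) ξ) = if n ∈ Ω then ε.coeffE n ξ else 0 :=
  ext_inner_left ℂ fun v => by
    rw [inner_coeffE, ← inner_proj]
    split_ifs with hn
    · rw [𝔖.proj_W_of_mem hn (𝔖.apply_mem_translate (ε.iE_mem v)), inner_coeffE]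
    · rw [𝔖.proj_W_of_notMem hn (𝔖.apply_mem_translate (ε.iE_mem v)), inner_zero_left,
        inner_zero_right]

open Classical in
theorem coeffEs_proj_Ws (Ω : Set (Lattice d)) (n : Lattice d) (ξ : K) :
    ε.coeffEs n (proj (𝔖.Ws Ω) ξ) = if n ∈ Ω then 0 else ε.coeffEs n ξ :=
  ext_inner_left ℂ fun v => by
    rw [inner_coeffEs, ← inner_proj]
    split_ifs with hn
    · rw [𝔖.proj_Ws_of_mem hn (𝔖.apply_mem_translate (ε.iEs_mem v)), inner_zero_left,
        inner_zero_right]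
    · rw [𝔖.proj_Ws_of_notMem hn (𝔖.apply_mem_translate (ε.iEs_mem v)), inner_coeffEs]

open Classical in
theorem proj_W_iE (Ω : Set (Lattice d)) (m : Lattice d) (y : E) :
    proj (𝔖.W Ω) (evolPow 𝔖.evol m (ε.iE y)) =
      if m ∈ Ω then evolPow 𝔖.evol m (ε.iE y) else 0 := by
  split_ifs with hm
  · exact 𝔖.proj_W_of_mem hm (𝔖.apply_mem_translate (ε.iE_mem y))
  · exact 𝔖.proj_W_of_notMem hm (𝔖.apply_mem_translate (ε.iE_mem y))

open Classical in
theorem proj_Ws_iEs (Ω : Set (Lattice d)) (m : Lattice d) (x : Es) :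
    proj (𝔖.Ws Ω) (evolPow 𝔖.evol m (ε.iEs x)) =
      if m ∈ Ω then 0 else evolPow 𝔖.evol m (ε.iEs x) := by
  split_ifs with hm
  · exact 𝔖.proj_Ws_of_mem hm (𝔖.apply_mem_translate (ε.iEs_mem x))
  · exact 𝔖.proj_Ws_of_notMem hm (𝔖.apply_mem_translate (ε.iEs_mem x))

/-- Here `P_V = I - P_W - P_{W_*}`. In the upper right block the three terms are `S_{n-m}`, `χ_Ω(m)
S_{n-m}` and `(1 - χ_Ω(n)) S_{n-m}`, whence the factor `χ_Ω(n) - χ_Ω(m)`. -/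
theorem scatteringKernel_eq {Ω : Set (Lattice d)} (hΩ : ShiftInvariant Ω) :
    U.scatteringKernel Ω = projKernel ε.evalCLM (𝔖.V Ω) := by
  classical
  ext1 n m
  refine ContinuousLinearMap.ext fun v => ?_
  rw [projKernel_apply, 𝔖.proj_V hΩ, Colligation.scatteringKernel, Matrix.of_apply,
    (ε.hasSum_ofCLM_transfer_W Ω n m).tsum_eq, (ε.hasSum_ofCLM_transfer_Ws Ω n m).tsum_eq,
    evalCLM_apply]
  set x := v.fst
  set y := v.snd
  have hL : block (Colligation.indDelta Ω n m - (ContinuousLinearMapWOT.ofCLM (ε.coeffEs n ∘L proj (𝔖.W Ω) ∘L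
        ((evolPow 𝔖.evol m).toContinuousLinearEquiv : K →L[ℂ] K) ∘L
          ε.iEs.toContinuousLinearMap)).toCLM)
      ((Colligation.ind Ω n - Colligation.ind Ω m) • U.transfer (n - m)) ((Colligation.ind Ω m - Colligation.ind Ω n) • (U.transfer (m - n))†)
      (Colligation.indDelta Ωᶜ n m - (ContinuousLinearMapWOT.ofCLM (ε.coeffE n ∘L proj (𝔖.Ws Ω) ∘L
        ((evolPow 𝔖.evol m).toContinuousLinearEquiv : K →L[ℂ] K) ∘L
          ε.iE.toContinuousLinearMap)).toCLM) v =
      WithLp.toLp 2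
        ((Colligation.indDelta Ω n m x - ε.coeffEs n (proj (𝔖.W Ω) (evolPow 𝔖.evol m (ε.iEs x)))) +
            (Colligation.ind Ω n - Colligation.ind Ω m) • U.transfer (n - m) y,
          (Colligation.ind Ω m - Colligation.ind Ω n) • ((U.transfer (m - n))†) x +
            (Colligation.indDelta Ωᶜ n m y - ε.coeffE n (proj (𝔖.Ws Ω) (evolPow 𝔖.evol m (ε.iE y))))) := rfl
  rw [hL]
  congr 2
  · simp only [map_sub, map_add, coeffEs_proj_Ws, proj_W_iE, coeffEs_evolPow, coeffEs_iEs,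
      coeffEs_iE, sub_eq_zero, Colligation.indDelta, Colligation.ind]
    by_cases hn : n ∈ Ω <;> by_cases hm : m ∈ Ω <;> by_cases hnm : n = m <;>
      simp [hn, hm, hnm, coeffEs_evolPow, coeffEs_iE] <;> abel
  · simp only [map_sub, map_add, coeffE_proj_W, proj_Ws_iEs, coeffE_evolPow, coeffE_iEs,
      coeffE_iE, sub_eq_zero, Colligation.indDelta, Colligation.ind]
    by_cases hn : n ∈ Ω <;> by_cases hm : m ∈ Ω <;> by_cases hnm : n = m <;>
      simp [hn, hm, hnm, coeffE_evolPow, coeffE_iEs] <;> abel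

/-! ### Unitarity of the restricted de Branges-Rovnyak maps -/

/-- Since `N ≤ V Ω`, the complement of `V Ω ⊓ N` in `V Ω` is `V Ω ⊓ 𝔖.scatMin`. -/
theorem isUnitaryOnto_V {Ω : Set (Lattice d)} (hΩ : ShiftInvariant Ω) :
    IsUnitaryOnto ε.dBR (𝔖.V Ω ⊓ 𝔖.scatMin) (U.scatteringKernel Ω) := by
  have := isUnitaryOnto_projKernel_of_ker (N := 𝔖.scatMinᗮ)
    (fun ξ => ε.mem_orthogonal_scatMin) (𝔖.isClosed_V Ω)
  rwa [inf_eq_right.2 (𝔖.orthogonal_scatMin_le_V Ω), 𝔖.orthogonal_orthogonal_scatMin,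
    ← ε.scatteringKernel_eq hΩ, ← ε.dBR_eq] at this

theorem isUnitaryOnto_L (k : Fin d) :
    IsUnitaryOnto (fun ξ n => ε.evalCLM n ξ) (ε.L k ⊓ (ε.L k ⊓ 𝔖.scatMinᗮ)ᗮ)
      (U.aglerKernel k) := by
  rw [ε.aglerKernel_eq]
  exact isUnitaryOnto_projKernel_of_ker (fun ξ => ε.mem_orthogonal_scatMin) (ε.isClosed_L k)

theorem isUnitaryOnto_translate_L (n : Lattice d) (k : Fin d) :
    IsUnitaryOnto (fun ξ n => ε.evalCLM n ξ)
      (𝔖.translate n (ε.L k) ⊓ (𝔖.translate n (ε.L k) ⊓ 𝔖.scatMinᗮ)ᗮ)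
      (shiftKernel n (U.aglerKernel k)) := by
  rw [ε.aglerKernel_eq, ε.shiftKernel_projKernel _ (ε.isClosed_L k)]
  exact isUnitaryOnto_projKernel_of_ker (fun ξ => ε.mem_orthogonal_scatMin)
    (𝔖.isClosed_translate (ε.isClosed_L k))

theorem isUnitaryOnto_summand {Ω : Set (Lattice d)} (i : BoundaryIndex Ω) :
    IsUnitaryOnto (fun ξ n => ε.evalCLM n ξ) (ε.summand i ⊓ (ε.summand i ⊓ 𝔖.scatMinᗮ)ᗮ)
      (U.summandKernel i) := by
  rw [ε.summandKernel_eq]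
  exact isUnitaryOnto_projKernel_of_ker (fun ξ => ε.mem_orthogonal_scatMin) (ε.isClosed_summand i)

end Embedding

/-! ### Boundary components -/

section Boundary

variable {d : ℕ}

theorem stdVec_nonneg (k j : Fin d) : 0 ≤ stdVec k j := by
  by_cases h : j = k
  · subst h; simp [stdVec]
  · simp [stdVec, Pi.single_eq_of_ne h]

theorem add_smul_stdVec_apply_self (n : Lattice d) (k : Fin d) (t : ℤ) :
    (n + t • stdVec k) k = n k + t := by
  simp [stdVec]

theorem add_smul_stdVec_apply_of_ne (n : Lattice d) {k j : Fin d} (h : j ≠ k) (t : ℤ) :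
    (n + t • stdVec k) j = n j := by
  simp [stdVec, Pi.single_eq_of_ne h]

theorem not_add_stdVec_le {n m : Lattice d} (k j : Fin d) (h : m j < n j) :
    ¬ n + stdVec k ≤ m := fun hle => by
  have := hle j
  have := stdVec_nonneg k j
  simp only [Pi.add_apply] at *
  omega

theorem add_smul_stdVec_eq_update {n : Lattice d} {k : Fin d} (hn : n k = 0) (t : ℤ) :
    n + t • stdVec k = Function.update n k t := by
  ext j
  by_cases h : j = k
  · subst h
    rw [add_smul_stdVec_apply_self, Function.update_self, hn, zero_add]
  · rw [add_smul_stdVec_apply_of_ne n h, Function.update_of_ne h]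

variable {Ω : Set (Lattice d)}

theorem mem_of_mem_finBoundary {n : Lattice d} {k : Fin d} (h : n ∈ finBoundary Ω k) : n ∈ Ω := by
  have := h.1
  rwa [Set.mem_ofPred_eq, Function.update_eq_self] at this

theorem sub_notMem_of_mem_finBoundary {n : Lattice d} {k : Fin d} (h : n ∈ finBoundary Ω k) :
    n - stdVec k ∉ Ω := fun hm => by
  have h1 : n - stdVec k = Function.update n k (n k - 1) := by
    ext j
    by_cases hj : j = k
    · subst hj; simp [stdVec]
    · simp [stdVec, Function.update_of_ne hj, Pi.single_eq_of_ne hj]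
  rw [h1] at hm
  have := h.2 hm
  omega

theorem add_notMem_of_mem_posInfBoundary {n : Lattice d} {k : Fin d}
    (h : n ∈ posInfBoundary Ω k) (t : ℤ) : n + t • stdVec k ∉ Ω := by
  rw [add_smul_stdVec_eq_update h.1]; exact h.2 t

theorem add_mem_of_mem_negInfBoundary {n : Lattice d} {k : Fin d}
    (h : n ∈ negInfBoundary Ω k) (t : ℤ) : n + t • stdVec k ∈ Ω := by
  rw [add_smul_stdVec_eq_update h.1]; exact h.2 t

/-- The direction of a boundary component. -/
def BoundaryIndex.dir : BoundaryIndex Ω → Fin d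
  | .fin k _ _ => k
  | .posInf k _ _ => k
  | .negInf k _ _ => k

/-- The base point of a boundary component. -/
def BoundaryIndex.base : BoundaryIndex Ω → Lattice d
  | .fin _ n _ => n
  | .posInf _ n _ => n
  | .negInf _ n _ => n

/-- The filter along which a boundary component is approached on its line. -/
noncomputable def BoundaryIndex.filter : BoundaryIndex Ω → Filter ℤ
  | .fin _ _ _ => pure 0
  | .posInf _ _ _ => atTop
  | .negInf _ _ _ => atBot

instance (i : BoundaryIndex Ω) : i.filter.NeBot := by
  cases i <;> simp only [BoundaryIndex.filter] <;> infer_instance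

/-- The points on the line of a boundary component. -/
def BoundaryIndex.point (i : BoundaryIndex Ω) (t : ℤ) : Lattice d := i.base + t • stdVec i.dir

/-- Two boundary components are separated if their approximating points are such that neither one
can be reached from the other one by a nontrivial path ending in the direction of the component. -/
def BoundaryIndex.Separated (i j : BoundaryIndex Ω) : Prop :=
  ∀ᶠ s in i.filter, ∀ᶠ t in j.filter, ¬ i.point s + stdVec j.dir ≤ j.point t ∧
    ¬ j.point t + stdVec i.dir ≤ i.point s ∧ (i.point s ≠ j.point t ∨ i.dir ≠ j.dir)

theorem exists_coord_ne {n m : Lattice d} {k : Fin d} (hn : n k = 0) (hm : m k = 0) (h : n ≠ m) :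
    ∃ i, i ≠ k ∧ n i ≠ m i := by
  obtain ⟨i, hi⟩ := Function.ne_iff.1 h
  refine ⟨i, ?_, hi⟩
  rintro rfl
  exact hi (hn.trans hm.symm)

/-- A forbidden inequality contradicts either upward closure of `Ω` or a comparison of one
coordinate, arranged by going far enough along a line at infinity. Two parallel lines at the same
infinity differ in a transversal coordinate, whose sign decides which limit must be the inner one;
hence the disjunction. -/
theorem separated_or_separated (hΩ : ShiftInvariant Ω) (i j : BoundaryIndex Ω) (hij : i ≠ j) :
    i.Separated j ∨ j.Separated i := by
  have hsub : ∀ {n m : Lattice d} {k : Fin d}, n ∈ Ω → m - stdVec k ∉ Ω → ¬ n + stdVec k ≤ m :=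
    fun hn hm hle => hm (hΩ.mem_of_le hn (le_sub_iff_add_le.2 hle))
  have hadd : ∀ {n m : Lattice d} {k : Fin d}, n ∈ Ω → m ∉ Ω → ¬ n + stdVec k ≤ m :=
    fun {n m k} hn hm hle => hm (hΩ.mem_of_le (hΩ n hn k) hle)
  have fin_pos : ∀ k n h j m h', (BoundaryIndex.fin (Ω := Ω) k n h).Separated (.posInf j m h') := by
    intro k n h j m h'
    simp only [BoundaryIndex.Separated, BoundaryIndex.filter, eventually_pure,
      BoundaryIndex.point, BoundaryIndex.base, BoundaryIndex.dir, zero_smul, add_zero]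
    filter_upwards [eventually_gt_atTop (n j - m j)] with t ht
    have hn := mem_of_mem_finBoundary h
    have hm := add_notMem_of_mem_posInfBoundary h' t
    exact ⟨hadd hn hm, not_add_stdVec_le k j (by rw [add_smul_stdVec_apply_self]; omega),
      .inl fun h => hm (h ▸ hn)⟩
  have fin_neg : ∀ k n h j m h', (BoundaryIndex.fin (Ω := Ω) k n h).Separated (.negInf j m h') := by
    intro k n h j m h'
    simp only [BoundaryIndex.Separated, BoundaryIndex.filter, eventually_pure,
      BoundaryIndex.point, BoundaryIndex.base, BoundaryIndex.dir, zero_smul, add_zero]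
    filter_upwards [eventually_lt_atBot (n j - m j)] with t ht
    have hm := add_mem_of_mem_negInfBoundary h' t
    refine ⟨not_add_stdVec_le j j (by rw [add_smul_stdVec_apply_self]; omega),
      hsub hm (sub_notMem_of_mem_finBoundary h), .inl fun h => ?_⟩
    have := congrFun h j
    rw [add_smul_stdVec_apply_self] at this
    omega
  have pos_neg : ∀ k n h j m h',
      (BoundaryIndex.posInf (Ω := Ω) k n h).Separated (.negInf j m h') := by
    intro k n h j m h'
    simp only [BoundaryIndex.Separated, BoundaryIndex.filter,
      BoundaryIndex.point, BoundaryIndex.base, BoundaryIndex.dir]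
    refine Eventually.of_forall fun s => ?_
    filter_upwards [eventually_lt_atBot ((n + s • stdVec k) j - m j)] with t ht
    have hn := add_notMem_of_mem_posInfBoundary h s
    have hm := add_mem_of_mem_negInfBoundary h' t
    exact ⟨not_add_stdVec_le j j (by rw [add_smul_stdVec_apply_self]; omega), hadd hm hn,
      .inl fun h => hn (h ▸ hm)⟩
  have pos_pos : ∀ k n h m h', (∃ i, i ≠ k ∧ m i < n i) →
      (BoundaryIndex.posInf (Ω := Ω) k n h).Separated (.posInf k m h') := by
    rintro k n h m h' ⟨i, hik, hi⟩
    simp only [BoundaryIndex.Separated, BoundaryIndex.filter,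
      BoundaryIndex.point, BoundaryIndex.base, BoundaryIndex.dir]
    refine Eventually.of_forall fun s => ?_
    filter_upwards [eventually_gt_atTop ((n + s • stdVec k) k - m k)] with t ht
    refine ⟨not_add_stdVec_le k i ?_,
      not_add_stdVec_le k k (by rw [add_smul_stdVec_apply_self m]; omega), .inl fun h => ?_⟩
    · rwa [add_smul_stdVec_apply_of_ne _ hik, add_smul_stdVec_apply_of_ne _ hik]
    · have := congrFun h i
      rw [add_smul_stdVec_apply_of_ne _ hik, add_smul_stdVec_apply_of_ne _ hik] at this
      omega
  have neg_neg : ∀ k n h m h', (∃ i, i ≠ k ∧ n i < m i) →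
      (BoundaryIndex.negInf (Ω := Ω) k n h).Separated (.negInf k m h') := by
    rintro k n h m h' ⟨i, hik, hi⟩
    simp only [BoundaryIndex.Separated, BoundaryIndex.filter,
      BoundaryIndex.point, BoundaryIndex.base, BoundaryIndex.dir]
    refine Eventually.of_forall fun s => ?_
    filter_upwards [eventually_lt_atBot ((n + s • stdVec k) k - m k)] with t ht
    refine ⟨not_add_stdVec_le k k (by rw [add_smul_stdVec_apply_self m]; omega),
      not_add_stdVec_le k i ?_, .inl fun h => ?_⟩
    · rwa [add_smul_stdVec_apply_of_ne _ hik, add_smul_stdVec_apply_of_ne _ hik]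
    · have := congrFun h i
      rw [add_smul_stdVec_apply_of_ne _ hik, add_smul_stdVec_apply_of_ne _ hik] at this
      omega
  match i, j, hij with
  | .fin k n h, .fin j m h', hij =>
    left
    simp only [BoundaryIndex.Separated, BoundaryIndex.filter, eventually_pure,
      BoundaryIndex.point, BoundaryIndex.base, BoundaryIndex.dir, zero_smul, add_zero]
    refine ⟨hsub (mem_of_mem_finBoundary h) (sub_notMem_of_mem_finBoundary h'),
      hsub (mem_of_mem_finBoundary h') (sub_notMem_of_mem_finBoundary h), ?_⟩
    by_contra! hc
    obtain ⟨rfl, rfl⟩ := hc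
    exact hij rfl
  | .fin k n h, .posInf j m h', _ => exact .inl (fin_pos ..)
  | .fin k n h, .negInf j m h', _ => exact .inl (fin_neg ..)
  | .posInf k n h, .fin j m h', _ => exact .inr (fin_pos ..)
  | .negInf k n h, .fin j m h', _ => exact .inr (fin_neg ..)
  | .posInf k n h, .negInf j m h', _ => exact .inl (pos_neg ..)
  | .negInf k n h, .posInf j m h', _ => exact .inr (pos_neg ..)
  | .posInf k n h, .posInf j m h', hij =>
    by_cases hkj : k = j
    · subst hkj
      obtain ⟨i, hik, hi⟩ := exists_coord_ne h.1 h'.1 fun hnm => hij (by subst hnm; rfl)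
      rcases hi.lt_or_gt with hi | hi
      · exact .inr (pos_pos _ _ _ _ _ ⟨i, hik, hi⟩)
      · exact .inl (pos_pos _ _ _ _ _ ⟨i, hik, hi⟩)
    · left
      simp only [BoundaryIndex.Separated, BoundaryIndex.filter,
        BoundaryIndex.point, BoundaryIndex.base, BoundaryIndex.dir]
      filter_upwards [eventually_gt_atTop (m k - n k)] with s hs
      filter_upwards [eventually_gt_atTop ((n + s • stdVec k) j - m j)] with t ht
      exact ⟨not_add_stdVec_le j k (by
          rw [add_smul_stdVec_apply_self, add_smul_stdVec_apply_of_ne _ hkj]; omega),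
        not_add_stdVec_le k j (by rw [add_smul_stdVec_apply_self]; omega), .inr hkj⟩
  | .negInf k n h, .negInf j m h', hij =>
    by_cases hkj : k = j
    · subst hkj
      obtain ⟨i, hik, hi⟩ := exists_coord_ne h.1 h'.1 fun hnm => hij (by subst hnm; rfl)
      rcases hi.lt_or_gt with hi | hi
      · exact .inl (neg_neg _ _ _ _ _ ⟨i, hik, hi⟩)
      · exact .inr (neg_neg _ _ _ _ _ ⟨i, hik, hi⟩)
    · left
      simp only [BoundaryIndex.Separated, BoundaryIndex.filter,
        BoundaryIndex.point, BoundaryIndex.base, BoundaryIndex.dir]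
      filter_upwards [eventually_lt_atBot (m k - n k)] with s hs
      filter_upwards [eventually_lt_atBot ((n + s • stdVec k) j - m j)] with t ht
      exact ⟨not_add_stdVec_le j j (by rw [add_smul_stdVec_apply_self]; omega),
        not_add_stdVec_le k k (by
          rw [add_smul_stdVec_apply_self, add_smul_stdVec_apply_of_ne _ hkj]; omega), .inr hkj⟩

end Boundary

/-! ### Orthogonality of the summands of an arbitrary shift-invariant set -/

namespace Embedding

variable {d : ℕ} {K H E Es : Type*}
  [NormedAddCommGroup K] [InnerProductSpace ℂ K] [CompleteSpace K]
  [NormedAddCommGroup H] [InnerProductSpace ℂ H] [CompleteSpace H]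
  [NormedAddCommGroup E] [InnerProductSpace ℂ E] [CompleteSpace E]
  [NormedAddCommGroup Es] [InnerProductSpace ℂ Es] [CompleteSpace Es]
  {U : Colligation d H E Es} {𝔖 : ScatteringSystem d K} (ε : Embedding U 𝔖)

/-- The adjoint system equation trades `U^m L j` for `U^{m - e_j}` applied to states and inputs.
Inputs are orthogonal to states in degree `≥ 0`, and states have dropped one degree, down to the
balanced decomposition in degree zero. -/
theorem inner_iH_evolPow_iH_P (N : ℕ) : ∀ (j : Fin d) (m : Lattice d), ∑ k, m k = N + 1 →
    ¬ stdVec j ≤ m → ∀ h h', inner ℂ (ε.iH h) (evolPow 𝔖.evol m (ε.iH (U.P j h'))) = 0 := by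
  have step : ∀ (N : ℕ) (j : Fin d) (m : Lattice d), ∑ k, m k = N + 1 →
      (∀ i a b, inner ℂ (ε.iH a) (evolPow 𝔖.evol (m - stdVec j) (ε.iH (U.P i b))) = 0) →
      ∀ h h', inner ℂ (ε.iH h) (evolPow 𝔖.evol m (ε.iH (U.P j h'))) = 0 := by
    intro N j m hm hi h h'
    have hs : 0 ≤ ∑ k, (m - stdVec j) k := by rw [sum_sub_stdVec]; omega
    rw [← sub_add_cancel m (stdVec j), evolPow_add_apply 𝔖.evol_comm, ε.evolPow_stdVec_iH_P,
      map_add, inner_add_right, ← inner_conj_symm _ (evolPow _ _ (ε.iE _)), ε.inner_iE_iH hs,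
      map_zero, add_zero, ← ε.sum_iH_P ((U.A†) _), map_sum, inner_sum]
    exact Finset.sum_eq_zero fun i _ => hi i _ _
  induction N with
  | zero =>
    intro j m hm hj
    refine step 0 j m hm fun i a b => ?_
    rw [← ε.sum_iH_P a, sum_inner]
    refine Finset.sum_eq_zero fun k _ => ε.inner_iH_P_iH_P ?_ (.inl fun h => hj ?_) _ _
    · rw [sum_sub_stdVec, hm]; simp
    · rw [sub_eq_zero.1 h]
  | succ N ih =>
    intro j m hm hj
    refine step (N + 1) j m hm fun i => ih i _ ?_ fun h => hj ?_
    · rw [sum_sub_stdVec, hm]; push_cast; ring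
    -- The obstruction persists: `e_i ≤ m - e_j` would give `e_j ≤ e_i + e_j ≤ m`.
    · have h1 := le_sub_iff_add_le.1 h
      exact le_trans (le_add_of_nonneg_left fun k => stdVec_nonneg i k) h1

theorem isOrtho_translate_L {n m : Lattice d} {j k : Fin d} (h₁ : ¬ n + stdVec j ≤ m)
    (h₂ : ¬ m + stdVec k ≤ n) (h₃ : n ≠ m ∨ k ≠ j) :
    𝔖.translate n (ε.L k) ⟂ 𝔖.translate m (ε.L j) := by
  have aux : ∀ {n m : Lattice d} {j k : Fin d}, ¬ n + stdVec j ≤ m → 0 < ∑ i, (m - n) i →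
      𝔖.translate n (ε.L k) ⟂ 𝔖.translate m (ε.L j) := by
    intro n m j k h hs
    rw [𝔖.translate_isOrtho_translate]
    intro x hx y hy
    obtain ⟨a, rfl⟩ := ε.mem_L.1 hx
    obtain ⟨b, rfl⟩ := ε.mem_L.1 hy
    refine ε.inner_iH_evolPow_iH_P ((∑ i, (m - n) i) - 1).toNat j _ (by omega) ?_ _ _
    rwa [le_sub_iff_add_le, add_comm]
  have hneg : ∑ i, (n - m) i = -∑ i, (m - n) i := by
    simp [Finset.sum_sub_distrib]
  rcases lt_trichotomy 0 (∑ i, (m - n) i) with h | h | h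
  · exact aux h₁ h
  · rw [𝔖.translate_isOrtho_translate]
    intro x hx y hy
    obtain ⟨a, rfl⟩ := ε.mem_L.1 hx
    obtain ⟨b, rfl⟩ := ε.mem_L.1 hy
    exact ε.inner_iH_P_iH_P h.symm (h₃.imp_left fun h => sub_ne_zero.2 h.symm) _ _
  · exact (aux h₂ (by rw [hneg]; omega)).symm

variable {Ω : Set (Lattice d)}

/-- This treats the three types of components alike: each is approached by translates of `L` along
its line, with the filter `pure 0` for finite points. -/
theorem tendsto_proj_summand (i : BoundaryIndex Ω) (ξ : K) :
    Tendsto (fun t => proj (𝔖.translate (i.point t) (ε.L i.dir)) ξ) i.filter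
      (𝓝 (proj (ε.summand i) ξ)) := by
  have aux : ∀ {l : Filter ℤ} {k : Fin d} {n : Lattice d} {X : Submodule ℂ K},
      IsClosed (X : Set K) →
      (∀ ξ, Tendsto (fun m : ℤ => proj (image (𝔖.evol k ^ m) (ε.L k)) ξ) l (𝓝 (proj X ξ))) →
      Tendsto (fun t : ℤ => proj (𝔖.translate (n + t • stdVec k) (ε.L k)) ξ) l
        (𝓝 (proj (𝔖.translate n X) ξ)) := by
    intro l k n X hX h
    rw [𝔖.proj_translate hX]
    have h1 : ∀ t : ℤ, proj (𝔖.translate (n + t • stdVec k) (ε.L k)) ξ = evolPow 𝔖.evol n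
        (proj (image (𝔖.evol k ^ t) (ε.L k)) (evolPow 𝔖.evol (-n) ξ)) := fun t => by
      rw [𝔖.image_evol_zpow, ← 𝔖.proj_translate (𝔖.isClosed_translate (ε.isClosed_L k)),
        𝔖.translate_translate]
    simp only [h1]
    exact (evolPow 𝔖.evol n).continuous.continuousAt.tendsto.comp (h _)
  cases i with
  | fin k n h =>
    have := tendsto_pure_nhds
      (fun t : ℤ => proj (𝔖.translate (n + t • stdVec k) (ε.L k)) ξ) 0
    simp only [zero_smul, add_zero] at this
    exact this
  | posInf k n h => exact aux (ε.isClosed_M k) (ε.slim k)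
  | negInf k n h => exact aux (ε.isClosed_Ms k) (ε.slim_s k)

/-- The inner product is an iterated limit of inner products between orthogonal translates, first in
`t`, then in `s`. -/
theorem isOrtho_summand_of_separated {i j : BoundaryIndex Ω} (h : i.Separated j) :
    ε.summand i ⟂ ε.summand j := by
  rw [Submodule.isOrtho_iff_inner_eq]
  intro x hx y hy
  have hx' := ε.tendsto_proj_summand i x
  have hy' := ε.tendsto_proj_summand j y
  rw [proj_eq_self hx] at hx'
  rw [proj_eq_self hy] at hy'
  refine tendsto_nhds_unique_of_eventuallyEq
    (hx'.inner tendsto_const_nhds : Tendsto (fun s => inner ℂ _ y) _ _) tendsto_const_nhds ?_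
  filter_upwards [h] with s hs
  refine tendsto_nhds_unique_of_eventuallyEq
    ((tendsto_const_nhds.inner hy' : Tendsto (fun t => inner ℂ
      (proj (𝔖.translate (i.point s) (ε.L i.dir)) x) _) _ _)) tendsto_const_nhds ?_
  filter_upwards [hs] with t ht
  exact (ε.isOrtho_translate_L ht.1 ht.2.1 ht.2.2).inner_eq
    (proj_mem (𝔖.isClosed_translate (ε.isClosed_L _)) _)
    (proj_mem (𝔖.isClosed_translate (ε.isClosed_L _)) _)

/-- The subspaces attached to the boundary components of a shift-invariant set are pairwise
orthogonal, whether or not they span the scattering subspace. -/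
theorem isOrtho_summand (hΩ : ShiftInvariant Ω) (i j : BoundaryIndex Ω) (hij : i ≠ j) :
    ε.summand i ⟂ ε.summand j :=
  (separated_or_separated hΩ i j hij).elim ε.isOrtho_summand_of_separated
    fun h => (ε.isOrtho_summand_of_separated h).symm

end Embedding

/-! ### Invariance under adjoints, resolvents and projections -/

theorem InvariantUnder.orthogonal_adjoint {H : Type*} [NormedAddCommGroup H]
    [InnerProductSpace ℂ H] [CompleteSpace H] {X : Submodule ℂ H} {T : H →L[ℂ] H}
    (h : InvariantUnder X T) : InvariantUnder Xᗮ (T†) :=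
  fun ξ hξ => (Submodule.mem_orthogonal _ _).2 fun η hη => by
    rw [ContinuousLinearMap.adjoint_inner_right]
    exact (Submodule.mem_orthogonal _ _).1 hξ _ (h η hη)

theorem invariantUnder_resolventCoeff {d : ℕ} {H : Type*} [NormedAddCommGroup H]
    [InnerProductSpace ℂ H] {P : Fin d → H →L[ℂ] H} {A : H →L[ℂ] H} {X : Submodule ℂ H}
    (hP : ∀ k, ∀ ξ ∈ X, P k ξ ∈ X) (hA : ∀ ξ ∈ X, A ξ ∈ X) (n : Lattice d) :
    ∀ ξ ∈ X, resolventCoeff P A n ξ ∈ X := by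
  have : ∀ (N : ℕ) (n : Lattice d), ∀ ξ ∈ X, powCoeff P A N n ξ ∈ X := by
    intro N
    induction N with
    | zero =>
      intro n ξ hξ
      rw [powCoeff]
      split_ifs
      · exact hξ
      · exact X.zero_mem
    | succ N ih =>
      intro n ξ hξ
      rw [powCoeff, _root_.sum_apply]
      exact sum_mem fun k _ => hP k _ (hA _ (ih _ ξ hξ))
  exact this _ n

/-- If `S` is closed and invariant under the projection onto the closed subspace `X`, then the
projection onto `X ⊓ S` is the product of the projections. -/
theorem proj_inf {K : Type*} [NormedAddCommGroup K] [InnerProductSpace ℂ K] [CompleteSpace K]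
    {X S : Submodule ℂ K} (hX : IsClosed (X : Set K)) (hS : IsClosed (S : Set K))
    (h : InvariantUnder S (proj X)) (ξ : K) : proj (X ⊓ S) ξ = proj X (proj S ξ) := by
  refine proj_eq ⟨proj_mem hX _, h _ (proj_mem hS ξ)⟩
    ((Submodule.mem_orthogonal _ _).2 fun η hη => ?_)
  rw [inner_sub_right, ← inner_proj, proj_eq_self hη.1, ← inner_proj, proj_eq_self hη.2, sub_self]

namespace Colligation

variable {d : ℕ} {H E Es : Type*}
  [NormedAddCommGroup H] [InnerProductSpace ℂ H] [CompleteSpace H]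
  [NormedAddCommGroup E] [InnerProductSpace ℂ E] [CompleteSpace E]
  [NormedAddCommGroup Es] [InnerProductSpace ℂ Es] [CompleteSpace Es]
  (U : Colligation d H E Es)

theorem isClosed_closelyConnectedPart : IsClosed (U.closelyConnectedPart : Set H) := by
  rw [closelyConnectedPart, Submodule.coe_sInf]
  exact isClosed_biInter fun X hX => hX.1

theorem B_mem_closelyConnectedPart (e : E) : U.B e ∈ U.closelyConnectedPart :=
  Submodule.mem_sInf.2 fun _ hX => hX.2.1 ⟨e, rfl⟩

theorem C_adjoint_mem_closelyConnectedPart (e : Es) : (U.C†) e ∈ U.closelyConnectedPart :=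
  Submodule.mem_sInf.2 fun _ hX => hX.2.2.1 ⟨e, rfl⟩

theorem invariantUnder_A : InvariantUnder U.closelyConnectedPart U.A := fun ξ hξ =>
  Submodule.mem_sInf.2 fun X hX => hX.2.2.2.1 ξ (Submodule.mem_sInf.1 hξ X hX)

theorem invariantUnder_A_adjoint : InvariantUnder U.closelyConnectedPart (U.A†) := fun ξ hξ =>
  Submodule.mem_sInf.2 fun X hX => hX.2.2.2.2.1 ξ (Submodule.mem_sInf.1 hξ X hX)

theorem invariantUnder_P (k : Fin d) : InvariantUnder U.closelyConnectedPart (U.P k) :=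
  fun ξ hξ => Submodule.mem_sInf.2 fun X hX => hX.2.2.2.2.2 k ξ (Submodule.mem_sInf.1 hξ X hX)

end Colligation

/-! ### Invariance of the orthogonal complement of the scattering-minimal part -/

namespace Embedding

variable {d : ℕ} {K H E Es : Type*}
  [NormedAddCommGroup K] [InnerProductSpace ℂ K] [CompleteSpace K]
  [NormedAddCommGroup H] [InnerProductSpace ℂ H] [CompleteSpace H]
  [NormedAddCommGroup E] [InnerProductSpace ℂ E] [CompleteSpace E]
  [NormedAddCommGroup Es] [InnerProductSpace ℂ Es] [CompleteSpace Es]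
  {U : Colligation d H E Es} {𝔖 : ScatteringSystem d K} (ε : Embedding U 𝔖)
  {Ω : Set (Lattice d)}

theorem evolPow_mem_orthogonal_scatMin (ε : Embedding U 𝔖) (n : Lattice d) {ξ : K}
    (hξ : ξ ∈ 𝔖.scatMinᗮ) : evolPow 𝔖.evol n ξ ∈ 𝔖.scatMinᗮ :=
  ε.mem_orthogonal_scatMin.2 fun m => by
    rw [evalCLM_evolPow]
    exact ε.mem_orthogonal_scatMin.1 hξ _

theorem evolPow_mem_scatMin (ε : Embedding U 𝔖) (n : Lattice d) {ξ : K}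
    (hξ : ξ ∈ 𝔖.scatMin) : evolPow 𝔖.evol n ξ ∈ 𝔖.scatMin := by
  rw [← 𝔖.orthogonal_orthogonal_scatMin]
  refine (Submodule.mem_orthogonal _ _).2 fun η hη => ?_
  rw [inner_evolPow_right 𝔖.evol_comm]
  exact (Submodule.mem_orthogonal' _ _).1 (ε.evolPow_mem_orthogonal_scatMin _ hη) _ hξ

theorem translate_inf_scatMin (ε : Embedding U 𝔖) (n : Lattice d) (X : Submodule ℂ K) :
    𝔖.translate n (X ⊓ 𝔖.scatMin) = 𝔖.translate n X ⊓ 𝔖.scatMin := by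
  ext ξ
  rw [Submodule.mem_inf, 𝔖.mem_translate, 𝔖.mem_translate, Submodule.mem_inf]
  refine and_congr_right fun _ => ⟨fun h => ?_, ε.evolPow_mem_scatMin _⟩
  have := ε.evolPow_mem_scatMin n h
  rwa [evolPow_apply_neg_self 𝔖.evol_comm] at this

theorem invariantUnder_translate (ε : Embedding U 𝔖) {X : Submodule ℂ K}
    (hX : IsClosed (X : Set K)) (h : InvariantUnder 𝔖.scatMinᗮ (proj X)) (n : Lattice d) :
    InvariantUnder 𝔖.scatMinᗮ (proj (𝔖.translate n X)) := fun ξ hξ => by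
  rw [𝔖.proj_translate hX]
  exact ε.evolPow_mem_orthogonal_scatMin _ (h _ (ε.evolPow_mem_orthogonal_scatMin _ hξ))

/-- Invariance passes to translates because `N` is invariant under all `U^n`, and to strong limits
because `N` is closed. -/
theorem invariantUnder_summand
    (h : ∀ k, InvariantUnder 𝔖.scatMinᗮ (proj (ε.L k))) (i : BoundaryIndex Ω) :
    InvariantUnder 𝔖.scatMinᗮ (proj (ε.summand i)) := fun ξ hξ =>
  (Submodule.isClosed_orthogonal _).mem_of_tendsto (ε.tendsto_proj_summand i ξ)
    (Eventually.of_forall fun _ =>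
      ε.invariantUnder_translate (ε.isClosed_L _) (h _) _ ξ hξ)

theorem invariantUnder_M (h : ∀ k, InvariantUnder 𝔖.scatMinᗮ (proj (ε.L k))) (k : Fin d) :
    InvariantUnder 𝔖.scatMinᗮ (proj (ε.M k)) := fun ξ hξ =>
  (Submodule.isClosed_orthogonal _).mem_of_tendsto (ε.slim k ξ)
    (Eventually.of_forall fun t => by
      rw [𝔖.image_evol_zpow]
      exact ε.invariantUnder_translate (ε.isClosed_L _) (h _) _ ξ hξ)

theorem invariantUnder_Ms (h : ∀ k, InvariantUnder 𝔖.scatMinᗮ (proj (ε.L k))) (k : Fin d) :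
    InvariantUnder 𝔖.scatMinᗮ (proj (ε.Ms k)) := fun ξ hξ =>
  (Submodule.isClosed_orthogonal _).mem_of_tendsto (ε.slim_s k ξ)
    (Eventually.of_forall fun t => by
      rw [𝔖.image_evol_zpow]
      exact ε.invariantUnder_translate (ε.isClosed_L _) (h _) _ ξ hξ)

/-! ### Triviality of the overlapping spaces -/

theorem boundaryOverlapTrivial (hΩ : ShiftInvariant Ω)
    (h : ∀ i : BoundaryIndex Ω, InvariantUnder 𝔖.scatMinᗮ (proj (ε.summand i))) :
    U.BoundaryOverlapTrivial Ω :=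
  overlapTrivial_of_invariantUnder (fun _ => ε.mem_orthogonal_scatMin) (ε.isOrtho_summand hΩ)
    ε.isClosed_summand ε.isUnitaryOnto_summand h

theorem invariantUnder_of_boundaryOverlapTrivial (hΩ : ShiftInvariant Ω)
    (hOD : 𝔖.OrthDecomp ε.L ε.M ε.Ms Ω) (h : U.BoundaryOverlapTrivial Ω)
    (i : BoundaryIndex Ω) : InvariantUnder 𝔖.scatMinᗮ (proj (ε.summand i)) :=
  invariantUnder_of_overlapTrivial (χ := fun i : BoundaryIndex Ω => ε.summand i)
    (fun _ => ε.mem_orthogonal_scatMin) (ε.isOrtho_summand hΩ)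
    ε.isClosed_summand ε.isUnitaryOnto_summand
    ((𝔖.orthogonal_scatMin_le_V Ω).trans hOD.2.le) h i

theorem summand_le_V (hOD : 𝔖.OrthDecomp ε.L ε.M ε.Ms Ω) (i : BoundaryIndex Ω) :
    ε.summand i ≤ 𝔖.V Ω := by
  rw [hOD.2]
  exact (le_iSup (fun i : BoundaryIndex Ω => 𝔖.summand ε.L ε.M ε.Ms i) i).trans
    (Submodule.le_topologicalClosure _)

/-- Within `V Ω` the two subspaces are orthogonal complements, and the projection is self-adjoint
with range in `V Ω`. -/
theorem invariantUnder_V_inf_scatMin_iff (hOD : 𝔖.OrthDecomp ε.L ε.M ε.Ms Ω)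
    (i : BoundaryIndex Ω) : InvariantUnder (𝔖.V Ω ⊓ 𝔖.scatMin) (proj (ε.summand i)) ↔
      InvariantUnder 𝔖.scatMinᗮ (proj (ε.summand i)) := by
  have hle := ε.summand_le_V hOD i
  constructor
  · intro h ξ hξ
    refine (Submodule.mem_orthogonal _ _).2 fun η hη => ?_
    -- Invariance is known only inside `V Ω`, so `η` is replaced by its projection there; the
    -- difference lies in `𝔖.scatMin` and is killed by the projection onto the summand.
    have h1 : proj (𝔖.V Ω) η ∈ 𝔖.V Ω ⊓ 𝔖.scatMin := by
      refine ⟨proj_mem (𝔖.isClosed_V Ω) η, ?_⟩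
      have h2 : η - proj (𝔖.V Ω) η ∈ 𝔖.scatMin := by
        rw [← 𝔖.orthogonal_orthogonal_scatMin]
        exact Submodule.orthogonal_le (𝔖.orthogonal_scatMin_le_V Ω) (sub_proj_mem η)
      have := sub_mem hη h2
      rwa [sub_sub_cancel] at this
    have h3 : proj (ε.summand i) η = proj (ε.summand i) (proj (𝔖.V Ω) η) := by
      rw [← sub_eq_zero, ← map_sub]
      exact proj_eq_zero (Submodule.orthogonal_le hle (sub_proj_mem η))
    rw [← inner_proj, h3]
    exact (Submodule.mem_orthogonal _ _).1 hξ _ (h _ h1).2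
  · intro h ξ hξ
    refine ⟨hle (proj_mem (ε.isClosed_summand i) ξ), ?_⟩
    have := h.orthogonal ξ
    rw [𝔖.orthogonal_orthogonal_scatMin] at this
    exact this hξ.2

theorem boundaryOverlapTrivial_tfae (hΩ : ShiftInvariant Ω)
    (hOD : 𝔖.OrthDecomp ε.L ε.M ε.Ms Ω) :
    [U.BoundaryOverlapTrivial Ω,
      𝔖.V Ω ⊓ 𝔖.scatMinᗮ = 𝔖.scatMinᗮ ∧
        ∀ i : BoundaryIndex Ω, InvariantUnder (𝔖.scatMinᗮ) (proj (ε.summand i)),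
      ∀ i : BoundaryIndex Ω,
        InvariantUnder (𝔖.V Ω ⊓ 𝔖.scatMin) (proj (ε.summand i))].TFAE := by
  tfae_have 1 → 2 := fun h => ⟨inf_eq_right.2 (𝔖.orthogonal_scatMin_le_V Ω),
    ε.invariantUnder_of_boundaryOverlapTrivial hΩ hOD h⟩
  tfae_have 2 → 1 := fun h => ε.boundaryOverlapTrivial hΩ h.2
  tfae_have 2 → 3 := fun h i => (ε.invariantUnder_V_inf_scatMin_iff hOD i).2 (h.2 i)
  tfae_have 3 → 2 := fun h => ⟨inf_eq_right.2 (𝔖.orthogonal_scatMin_le_V Ω),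
    fun i => (ε.invariantUnder_V_inf_scatMin_iff hOD i).1 (h i)⟩
  tfae_finish

/-- A finite boundary point makes a translate of `L k` a summand, and invariance is translated back.
-/
theorem invariantUnder_L_of_boundaryOverlapTrivial (hΩ : ShiftInvariant Ω)
    (hOD : 𝔖.OrthDecomp ε.L ε.M ε.Ms Ω) (hne : ∀ k, (finBoundary Ω k).Nonempty)
    (h : U.BoundaryOverlapTrivial Ω) (k : Fin d) :
    InvariantUnder 𝔖.scatMinᗮ (proj (ε.L k)) := by
  obtain ⟨n, hn⟩ := hne k
  have h1 : InvariantUnder 𝔖.scatMinᗮ (proj (𝔖.translate n (ε.L k))) :=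
    ε.invariantUnder_of_boundaryOverlapTrivial hΩ hOD h (.fin k n hn)
  have h2 := ε.invariantUnder_translate (𝔖.isClosed_translate (ε.isClosed_L k)) h1 (-n)
  rwa [𝔖.translate_translate, neg_add_cancel, 𝔖.translate_zero] at h2

theorem strictlyCloselyConnected (h : ∀ k, InvariantUnder 𝔖.scatMinᗮ (proj (ε.L k))) :
    U.StrictlyCloselyConnected := by
  refine ⟨overlapTrivial_of_invariantUnder (fun _ => ε.mem_orthogonal_scatMin)
    (fun i j hij => ε.isOrtho_L_L hij) ε.isClosed_L ε.isUnitaryOnto_L h,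
    overlapTrivial_of_invariantUnder (fun _ => ε.mem_orthogonal_scatMin)
    (χ := fun k => 𝔖.translate (stdVec k) (ε.L k)) (fun i j hij => ?_)
    (fun k => 𝔖.isClosed_translate (ε.isClosed_L k))
    (fun k => ε.isUnitaryOnto_translate_L (stdVec k) k)
    fun k => ε.invariantUnder_translate (ε.isClosed_L k) (h k) _⟩
  have := ε.cdp_shift i j hij
  rwa [𝔖.image_evol, 𝔖.image_evol] at this

theorem minimalAglerDecomp (h : ∀ k, InvariantUnder 𝔖.scatMinᗮ (proj (ε.L k)))
    (hΩ : ShiftInvariant Ω) : U.MinimalAglerDecomp Ω :=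
  ⟨ε.strictlyCloselyConnected h, ε.boundaryOverlapTrivial hΩ (ε.invariantUnder_summand h)⟩

/-! ### The closely connected part -/

theorem B_adjoint_P (k : Fin d) (h : H) :
    (U.B†) (U.P k h) = ε.coeffE (-stdVec k) (ε.iH (U.P k h)) := by
  have h1 := ε.coeffE_evolPow 0 (stdVec k) (ε.iH (U.P k h))
  rw [ε.evolPow_stdVec_iH_P, map_add, ε.coeffE_iH_of_nonneg (by simp), zero_add, ε.coeffE_iE,
    if_pos rfl, zero_sub] at h1
  exact h1

theorem C_apply (h : H) : U.C h = ε.coeffEs 0 (ε.iH h) := by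
  rw [ε.C_eq, coeffEs_apply, neg_zero, evolPow_zero_apply]

theorem coeffEs_eq_zero {ξ : K} (hξ : ξ ∈ 𝔖.scatMinᗮ) (n : Lattice d) : ε.coeffEs n ξ = 0 :=
  congrArg WithLp.fst (ε.mem_orthogonal_scatMin.1 hξ n)

theorem coeffE_eq_zero {ξ : K} (hξ : ξ ∈ 𝔖.scatMinᗮ) (n : Lattice d) : ε.coeffE n ξ = 0 :=
  congrArg WithLp.snd (ε.mem_orthogonal_scatMin.1 hξ n)

/-- The vectors of the state space whose images are orthogonal to the scattering-minimal part. -/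
noncomputable def scatNull : Submodule ℂ H := 𝔖.scatMinᗮ.comap ε.iH.toLinearMap

theorem mem_scatNull {h : H} : h ∈ ε.scatNull ↔ ε.iH h ∈ 𝔖.scatMinᗮ := Iff.rfl

/-- The complement is invariant under `A`, `A^*` and the `P_k`, and is annihilated by `C` and `B^*`,
so all coefficients computed through the resolvents vanish on it. -/
theorem orthogonal_closelyConnectedPart_le : U.closelyConnectedPartᗮ ≤ ε.scatNull := by
  have hA : InvariantUnder U.closelyConnectedPartᗮ U.A := by
    simpa using U.invariantUnder_A_adjoint.orthogonal_adjoint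
  have hP : ∀ k, InvariantUnder U.closelyConnectedPartᗮ (U.P k) := fun k => by
    simpa only [U.P_selfAdjoint] using (U.invariantUnder_P k).orthogonal_adjoint
  have hB : ∀ h ∈ U.closelyConnectedPartᗮ, (U.B†) h = 0 := fun h hh =>
    ext_inner_left ℂ fun v => by
      rw [ContinuousLinearMap.adjoint_inner_right, inner_zero_right]
      exact (Submodule.mem_orthogonal _ _).1 hh _ (U.B_mem_closelyConnectedPart v)
  have hC : ∀ h ∈ U.closelyConnectedPartᗮ, U.C h = 0 := fun h hh =>
    ext_inner_left ℂ fun v => by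
      rw [← ContinuousLinearMap.adjoint_inner_left, inner_zero_right]
      exact (Submodule.mem_orthogonal _ _).1 hh _ (U.C_adjoint_mem_closelyConnectedPart v)
  intro h hh
  refine ε.mem_scatNull.2 (ε.mem_orthogonal_scatMin.2 fun n => ?_)
  have h1 : ε.coeffEs n (ε.iH h) = 0 := by
    rw [coeffEs_iH]
    exact hC _ (invariantUnder_resolventCoeff hP hA n h hh)
  have h2 : ε.coeffE n (ε.iH h) = 0 := by
    rw [← ε.sum_iH_P h, map_sum]
    refine Finset.sum_eq_zero fun k _ => ?_
    rw [coeffE_iH_P]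
    exact hB _ (invariantUnder_resolventCoeff hP U.invariantUnder_A.orthogonal_adjoint _ _
      (hP k h hh))
  rw [evalCLM_apply, h1, h2]
  rfl

/-- For the reverse inclusion, `ε.scatNullᗮ` is shown to be one of the subspaces in the infimum
defining the closely connected part. -/
theorem orthogonal_closelyConnectedPart
    (hinv : ∀ k, InvariantUnder 𝔖.scatMinᗮ (proj (ε.L k))) :
    U.closelyConnectedPartᗮ = ε.scatNull := by
  refine le_antisymm ε.orthogonal_closelyConnectedPart_le ?_
  have hP : ∀ k, InvariantUnder ε.scatNull (U.P k) := fun k h hh => by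
    have := hinv k _ hh
    rwa [LinearIsometry.coe_toLinearMap, proj_L, iH_adjoint_iH] at this
  have hB : ∀ h ∈ ε.scatNull, (U.B†) h = 0 := fun h hh => by
    rw [← U.sum_P h, map_sum]
    refine Finset.sum_eq_zero fun k _ => ?_
    rw [ε.B_adjoint_P]
    exact ε.coeffE_eq_zero (hP k h hh) _
  have hC : ∀ h ∈ ε.scatNull, U.C h = 0 := fun h hh => by
    rw [ε.C_apply]
    exact ε.coeffEs_eq_zero hh _
  have hA' : InvariantUnder ε.scatNull (U.A†) := fun h hh => by
    rw [mem_scatNull]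
    -- With `B^* P_k h = 0` the adjoint system equation makes `A^*` act as `U_k` on `P_k h`.
    have h1 : ∀ k, ε.iH ((U.A†) (U.P k h)) = evolPow 𝔖.evol (stdVec k) (ε.iH (U.P k h)) :=
      fun k => by rw [ε.evolPow_stdVec_iH_P, hB _ (hP k h hh), map_zero, add_zero]
    rw [← U.sum_P h, map_sum, map_sum]
    refine sum_mem fun k _ => ?_
    rw [h1]
    exact ε.evolPow_mem_orthogonal_scatMin _ (hP k h hh)
  have hA : InvariantUnder ε.scatNull U.A := fun h hh => by
    rw [mem_scatNull, ← ε.sum_iH_P]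
    refine sum_mem fun k _ => ?_
    rw [ε.A_eq, ← proj_L, inv_apply_eq_evolPow 𝔖.evol_comm]
    exact hinv k _ (ε.evolPow_mem_orthogonal_scatMin _ hh)
  have key : U.closelyConnectedPart ≤ ε.scatNullᗮ := by
    refine sInf_le ⟨Submodule.isClosed_orthogonal _, ?_, ?_, ?_, hA.orthogonal_adjoint, fun k => ?_⟩
    · rintro _ ⟨e, rfl⟩
      refine (Submodule.mem_orthogonal _ _).2 fun η hη => ?_
      change inner ℂ η (U.B e) = 0
      rw [← ContinuousLinearMap.adjoint_inner_left, hB η hη, inner_zero_left]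
    · rintro _ ⟨e, rfl⟩
      refine (Submodule.mem_orthogonal _ _).2 fun η hη => ?_
      change inner ℂ η ((U.C†) e) = 0
      rw [ContinuousLinearMap.adjoint_inner_right, hC η hη, inner_zero_left]
    · simpa using hA'.orthogonal_adjoint
    · simpa only [U.P_selfAdjoint] using (hP k).orthogonal_adjoint
  exact (Submodule.le_orthogonal_orthogonal _).trans (Submodule.orthogonal_le key)

/-- By invariance, a vector of `L k` is orthogonal to `N` as soon as it is orthogonal to `L k ⊓ N`,
and this is visible inside `H` through `scatNull`. -/
theorem Lcc_eq (hinv : ∀ k, InvariantUnder 𝔖.scatMinᗮ (proj (ε.L k))) (k : Fin d) :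
    ε.Lcc k = ε.L k ⊓ 𝔖.scatMin := by
  have hcc := ε.orthogonal_closelyConnectedPart hinv
  have : CompleteSpace U.closelyConnectedPart :=
    U.isClosed_closelyConnectedPart.completeSpace_coe
  have hcc' : U.closelyConnectedPart = ε.scatNullᗮ := by
    rw [← hcc, Submodule.orthogonal_orthogonal]
  ext ξ
  constructor
  · rintro ⟨_, ⟨h, hh, rfl⟩, rfl⟩
    refine ⟨ε.iH_P_mem_L k h, ?_⟩
    rw [← 𝔖.orthogonal_orthogonal_scatMin]
    refine (Submodule.mem_orthogonal _ _).2 fun η hη => ?_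
    have h1 := hinv k η hη
    change inner ℂ η (ε.iH (U.P k h)) = 0
    rw [← proj_eq_self (ε.iH_P_mem_L k h), ← inner_proj]
    rw [proj_L] at h1 ⊢
    rw [ε.iH.inner_map_map]
    have h2 := U.invariantUnder_P k h hh
    rw [hcc'] at h2
    exact (Submodule.mem_orthogonal _ _).1 h2 _ h1
  · rintro ⟨hL, hs⟩
    obtain ⟨h, rfl⟩ := ε.mem_L.1 hL
    refine ⟨U.P k h, ⟨U.P k h, ?_, U.P_P k h⟩, rfl⟩
    rw [SetLike.mem_coe, hcc']
    refine (Submodule.mem_orthogonal _ _).2 fun η hη => ?_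
    rw [← ε.iH.inner_map_map]
    exact (Submodule.mem_orthogonal' _ _).1 hη _ hs

theorem invariantUnder_scatMin {X : Submodule ℂ K}
    (h : InvariantUnder 𝔖.scatMinᗮ (proj X)) : InvariantUnder 𝔖.scatMin (proj X) := by
  have := h.orthogonal
  rwa [𝔖.orthogonal_orthogonal_scatMin] at this

/-- The projections onto `U_k^m (Lcc k)` are those onto `U_k^m (L k)` preceded by the fixed
projection onto `𝔖.scatMin`. -/
theorem tendsto_proj_Lcc (hinv : ∀ k, InvariantUnder 𝔖.scatMinᗮ (proj (ε.L k))) (k : Fin d)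
    {l : Filter ℤ} {X : Submodule ℂ K} (hX : IsClosed (X : Set K))
    (hXinv : InvariantUnder 𝔖.scatMinᗮ (proj X))
    (h : ∀ ξ, Tendsto (fun m : ℤ => proj (image (𝔖.evol k ^ m) (ε.L k)) ξ) l (𝓝 (proj X ξ)))
    (ξ : K) : Tendsto (fun m : ℤ => proj (image (𝔖.evol k ^ m) (ε.Lcc k)) ξ) l
      (𝓝 (proj (X ⊓ 𝔖.scatMin) ξ)) := by
  rw [proj_inf hX 𝔖.isClosed_scatMin (invariantUnder_scatMin hXinv)]
  have h1 : ∀ m : ℤ, proj (image (𝔖.evol k ^ m) (ε.Lcc k)) ξ =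
      proj (image (𝔖.evol k ^ m) (ε.L k)) (proj 𝔖.scatMin ξ) := fun m => by
    rw [𝔖.image_evol_zpow, 𝔖.image_evol_zpow, ε.Lcc_eq hinv, ε.translate_inf_scatMin]
    exact proj_inf (𝔖.isClosed_translate (ε.isClosed_L k)) 𝔖.isClosed_scatMin
      (invariantUnder_scatMin (ε.invariantUnder_translate (ε.isClosed_L k) (hinv k) _)) ξ
  simp only [h1]
  exact h _

theorem limitSubspace_Lcc (hinv : ∀ k, InvariantUnder 𝔖.scatMinᗮ (proj (ε.L k))) (k : Fin d)
    {l : Filter ℤ} [l.NeBot] {X : Submodule ℂ K} (hX : IsClosed (X : Set K))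
    (hXinv : InvariantUnder 𝔖.scatMinᗮ (proj X))
    (h : ∀ ξ, Tendsto (fun m : ℤ => proj (image (𝔖.evol k ^ m) (ε.L k)) ξ) l (𝓝 (proj X ξ))) :
    𝔖.limitSubspace l k (ε.Lcc k) = X ⊓ 𝔖.scatMin := by
  ext ξ
  have h1 := ε.tendsto_proj_Lcc hinv k hX hXinv h ξ
  constructor
  · intro hξ
    rw [← tendsto_nhds_unique h1 hξ]
    exact proj_mem (hX.inter 𝔖.isClosed_scatMin) ξ
  · intro hξ
    rw [proj_eq_self hξ] at h1
    exact h1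

theorem Mcc_eq (hinv : ∀ k, InvariantUnder 𝔖.scatMinᗮ (proj (ε.L k))) (k : Fin d) :
    ε.Mcc k = ε.M k ⊓ 𝔖.scatMin :=
  ε.limitSubspace_Lcc hinv k (ε.isClosed_M k) (ε.invariantUnder_M hinv k) (ε.slim k)

theorem Mscc_eq (hinv : ∀ k, InvariantUnder 𝔖.scatMinᗮ (proj (ε.L k))) (k : Fin d) :
    ε.Mscc k = ε.Ms k ⊓ 𝔖.scatMin :=
  ε.limitSubspace_Lcc hinv k (ε.isClosed_Ms k) (ε.invariantUnder_Ms hinv k) (ε.slim_s k)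

theorem ccLimitsExist (hinv : ∀ k, InvariantUnder 𝔖.scatMinᗮ (proj (ε.L k))) :
    ε.CcLimitsExist := fun k ξ => by
  rw [ε.Mcc_eq hinv, ε.Mscc_eq hinv]
  exact ⟨ε.tendsto_proj_Lcc hinv k (ε.isClosed_M k) (ε.invariantUnder_M hinv k) (ε.slim k) ξ,
    ε.tendsto_proj_Lcc hinv k (ε.isClosed_Ms k) (ε.invariantUnder_Ms hinv k) (ε.slim_s k) ξ⟩

theorem summand_cc (hinv : ∀ k, InvariantUnder 𝔖.scatMinᗮ (proj (ε.L k)))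
    (i : BoundaryIndex Ω) :
    𝔖.summand ε.Lcc ε.Mcc ε.Mscc i = ε.summand i ⊓ 𝔖.scatMin := by
  cases i with
  | fin k n h =>
    rw [ScatteringSystem.summand, ε.Lcc_eq hinv, ε.translate_inf_scatMin]; rfl
  | posInf k n h =>
    rw [ScatteringSystem.summand, ε.Mcc_eq hinv, ε.translate_inf_scatMin]; rfl
  | negInf k n h =>
    rw [ScatteringSystem.summand, ε.Mscc_eq hinv, ε.translate_inf_scatMin]; rfl

theorem V_inf_orthogonal_Vcc (hinv : ∀ k, InvariantUnder 𝔖.scatMinᗮ (proj (ε.L k)))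
    (hΩ : ShiftInvariant Ω) (hOD : 𝔖.OrthDecomp ε.L ε.M ε.Ms Ω) :
    𝔖.V Ω ⊓ (ε.Vcc Ω)ᗮ = 𝔖.scatMinᗮ := by
  have hVcc : ε.Vcc Ω = (⨆ i : BoundaryIndex Ω, ε.summand i ⊓ 𝔖.scatMin).topologicalClosure := by
    rw [Vcc]
    simp only [ε.summand_cc hinv]
  rw [hVcc, Submodule.orthogonal_closure]
  apply le_antisymm
  · rintro ξ ⟨hV, hξ⟩
    have hsub : ξ - proj 𝔖.scatMin ξ ∈ 𝔖.scatMinᗮ := sub_proj_mem ξ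
    have hs : proj 𝔖.scatMin ξ ∈ (⨆ i : BoundaryIndex Ω, ε.summand i).topologicalClosure := by
      have := sub_mem hV (𝔖.orthogonal_scatMin_le_V Ω hsub)
      rw [sub_sub_cancel] at this
      exact hOD.2.le this
    -- On each summand the component of `ξ` in `𝔖.scatMin` projects to the projection of `ξ` onto
    -- `summand ⊓ 𝔖.scatMin`, which is zero; so this component vanishes.
    have h0 := mem_of_mem_closure_of_proj_eq_zero
      (χ := fun i : BoundaryIndex Ω => ε.summand i) ε.isClosed_summand
      (ε.isOrtho_summand hΩ) hs fun i => by
        have hi := invariantUnder_scatMin (ε.invariantUnder_summand hinv i)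
        rw [← proj_inf (ε.isClosed_summand i) 𝔖.isClosed_scatMin hi]
        exact proj_eq_zero (Submodule.orthogonal_le
          (le_iSup (fun i : BoundaryIndex Ω => ε.summand i ⊓ 𝔖.scatMin) i) hξ)
    rwa [h0, sub_zero] at hsub
  · exact le_inf (𝔖.orthogonal_scatMin_le_V Ω)
      (Submodule.orthogonal_le (iSup_le fun i => inf_le_right))

/-- If no nonzero state lies in `N`, invariance makes `N` orthogonal to every `L k`, hence to all
translates and limits. But `N` lies in the balanced scattering subspace, which they span. -/
theorem isCloselyConnected_iff (hinv : ∀ k, InvariantUnder 𝔖.scatMinᗮ (proj (ε.L k))) :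
    U.IsCloselyConnected ↔ 𝔖.IsScatteringMinimal := by
  have hcc := ε.orthogonal_closelyConnectedPart hinv
  have : CompleteSpace U.closelyConnectedPart :=
    U.isClosed_closelyConnectedPart.completeSpace_coe
  have : CompleteSpace 𝔖.scatMin := 𝔖.isClosed_scatMin.completeSpace_coe
  rw [Colligation.IsCloselyConnected, ScatteringSystem.IsScatteringMinimal,
    ← Submodule.orthogonal_eq_bot_iff, ← Submodule.orthogonal_eq_bot_iff, hcc]
  constructor
  · intro h
    refine (Submodule.eq_bot_iff _).2 fun ξ hξ => ?_
    have hL : ∀ k, ∀ η ∈ 𝔖.scatMinᗮ, proj (ε.L k) η = 0 := fun k η hη => by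
      have h1 := hinv k η hη
      rw [proj_L] at h1 ⊢
      rw [(Submodule.eq_bot_iff _).1 h _ h1, map_zero]
    have hΩ : ShiftInvariant (balanced d) := fun n hn k => by
      simp only [balanced, Set.mem_ofPred_eq, sum_add_stdVec] at hn ⊢
      omega
    refine mem_of_mem_closure_of_proj_eq_zero
      (χ := fun i : BoundaryIndex (balanced d) => ε.summand i) ε.isClosed_summand
      (ε.isOrtho_summand hΩ) (ε.orthDecomp.2.le (𝔖.orthogonal_scatMin_le_V _ hξ)) fun i => ?_
    refine tendsto_nhds_unique (ε.tendsto_proj_summand i ξ) ?_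
    have h0 : ∀ t, proj (𝔖.translate (i.point t) (ε.L i.dir)) ξ = 0 := fun t => by
      rw [𝔖.proj_translate (ε.isClosed_L _), hL _ _ (ε.evolPow_mem_orthogonal_scatMin _ hξ),
        map_zero]
    simp only [h0]
    exact tendsto_const_nhds
  · intro h
    refine (Submodule.eq_bot_iff _).2 fun y hy => ?_
    have := (Submodule.eq_bot_iff _).1 h _ hy
    exact (map_eq_zero_iff ε.iH ε.iH.injective).1 this

end Embedding

end Multievolution

/-! ### The proposition -/

theorem proposition6p14 {d : ℕ} (hd : 0 < d) {K H E Es : Type*}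
    [NormedAddCommGroup K] [InnerProductSpace ℂ K] [CompleteSpace K]
    [NormedAddCommGroup H] [InnerProductSpace ℂ H] [CompleteSpace H]
    [NormedAddCommGroup E] [InnerProductSpace ℂ E] [CompleteSpace E]
    [NormedAddCommGroup Es] [InnerProductSpace ℂ Es] [CompleteSpace Es]
    (U : Colligation d H E Es) (𝔖 : ScatteringSystem d K) (ε : Embedding U 𝔖) :
    -- the kernels are well defined
    U.LimitKernelsConverge ∧
    (∀ Ω : Set (Lattice d), ShiftInvariant Ω → U.ScatteringKernelConverges Ω) ∧
    -- (1) unitarity of the restricted de Branges-Rovnyak maps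
    (∀ Ω : Set (Lattice d), ShiftInvariant Ω →
      IsUnitaryOnto ε.dBR (𝔖.V Ω ⊓ 𝔖.scatMin) (U.scatteringKernel Ω) ∧
      ∀ i : BoundaryIndex Ω,
        IsUnitaryOnto ε.dBR (ε.summand i ⊓ (ε.summand i ⊓ 𝔖.scatMinᗮ)ᗮ) (U.summandKernel i)) ∧
    -- (2) criteria for a trivial overlapping space
    (∀ Ω : Set (Lattice d), ShiftInvariant Ω → 𝔖.OrthDecomp ε.L ε.M ε.Ms Ω →
      [U.BoundaryOverlapTrivial Ω,
        𝔖.V Ω ⊓ 𝔖.scatMinᗮ = 𝔖.scatMinᗮ ∧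
          ∀ i : BoundaryIndex Ω, InvariantUnder (𝔖.scatMinᗮ) (proj (ε.summand i)),
        ∀ i : BoundaryIndex Ω,
          InvariantUnder (𝔖.V Ω ⊓ 𝔖.scatMin) (proj (ε.summand i))].TFAE) ∧
    -- (3) trivial overlapping space and invariance under the projections onto the `L_k`
    (∀ Ω : Set (Lattice d), ShiftInvariant Ω → 𝔖.OrthDecomp ε.L ε.M ε.Ms Ω →
      (∀ k, (finBoundary Ω k).Nonempty) → U.BoundaryOverlapTrivial Ω →
      ∀ k, InvariantUnder (𝔖.scatMinᗮ) (proj (ε.L k))) ∧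
    ((∀ k, InvariantUnder (𝔖.scatMinᗮ) (proj (ε.L k))) →
      ∀ Ω : Set (Lattice d), ShiftInvariant Ω → U.BoundaryOverlapTrivial Ω) ∧
    -- (4) minimality of the augmented Agler decomposition
    (∀ Ω : Set (Lattice d), ShiftInvariant Ω → 𝔖.OrthDecomp ε.L ε.M ε.Ms Ω →
      (∀ k, (finBoundary Ω k).Nonempty) →
      (U.MinimalAglerDecomp Ω ↔ ∀ k, InvariantUnder (𝔖.scatMinᗮ) (proj (ε.L k)))) ∧
    ((∀ k, InvariantUnder (𝔖.scatMinᗮ) (proj (ε.L k))) →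
      (∀ Ω : Set (Lattice d), ShiftInvariant Ω → U.MinimalAglerDecomp Ω) ∧
      ε.CcLimitsExist ∧
      (∀ Ω : Set (Lattice d), ShiftInvariant Ω → 𝔖.OrthDecomp ε.L ε.M ε.Ms Ω →
        𝔖.V Ω ⊓ (ε.Vcc Ω)ᗮ = 𝔖.scatMinᗮ) ∧
      (U.IsCloselyConnected ↔ 𝔖.IsScatteringMinimal)) := by
  refine ⟨ε.limitKernelsConverge, fun Ω _ => ε.scatteringKernelConverges Ω,
    fun Ω hΩ => ⟨ε.isUnitaryOnto_V hΩ, fun i => ?_⟩,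
    fun Ω hΩ hOD => ε.boundaryOverlapTrivial_tfae hΩ hOD,
    fun Ω hΩ hOD hne h => ε.invariantUnder_L_of_boundaryOverlapTrivial hΩ hOD hne h,
    fun h Ω hΩ => ε.boundaryOverlapTrivial hΩ (ε.invariantUnder_summand h),
    fun Ω hΩ hOD hne => ⟨fun h => ε.invariantUnder_L_of_boundaryOverlapTrivial hΩ hOD hne h.2,
      fun h => ε.minimalAglerDecomp h hΩ⟩,
    fun h => ⟨fun Ω hΩ => ε.minimalAglerDecomp h hΩ, ε.ccLimitsExist h,
      fun Ω hΩ hOD => ε.V_inf_orthogonal_Vcc h hΩ hOD, ε.isCloselyConnected_iff h⟩⟩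
  rw [ε.dBR_eq]
  exact ε.isUnitaryOnto_summand i
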